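/- Conventions. A ray is a half-line $\rho=\mathbb{R}_{\ge 0}u_\rho\subset\mathbb{R}^2$ with $u_\rho\in\mathbb{Z}^2$ primitive (coprime coordinates); put $|\rho|=\max\{|x|,|y|\}$ for $u_\rho=(x,y)$. A fan is a nonempty finite collection of strongly convex rational polyhedral cones in $\mathbb{R}^2$ that is closed under taking faces and in which any two cones meet in a common face. The completion of a finite set $S$ of rays is the fan that is maximal with respect to inclusion among all fans whose set of rays is $S$. For $h\in\mathbb{N}$ and $p\in[0,1]$, $T(h,p)$ denotes the distribution of the fan obtained by choosing each ray $\rho$ with $|\rho|\le h$ independently with probability $p$ and completing the chosen set. $\Sigma_h$ is the completion of the set of all rays with $|\rho|\le h$, and the empty fan is $\{\{0\}\}$. $X(\Sigma)$ is the toric surface over $\mathbb{C}$ of $\Sigma$. The torus-fixed point corresponding to a two-dimensional cone with boundary rays $\rho,\tau$ has singularity index $|u_\rho\wedge u_\tau|=|\det(u_\rho,u_\tau)|$. For functions $f,g$ of $h$, $f\prec g$ (equivalently $g\succ f$) means $\lim_{h\to\infty}f(h)/g(h)=0$, where $g(h)\neq 0$ for all large $h$. "With high probability" means with probability tending to $1$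 as $h\to\infty$. Theorem 1.1. Let $q=q(h)\in[0,1]$ be a function of $h\in\mathbb{N}$, and let $\Sigma$ be chosen with respect to $T(h,1-q)$. 1. If $q\prec 1/h^2$, then with high probability $\Sigma=\Sigma_h$, and with high probability $X(\Sigma)$ is smooth. If $1-q\prec 1/h^2$, then with high probability $\Sigma$ is the empty fan, and with high probability $X(\Sigma)$ is smooth. 2. If $q\succ 1/h^2$ and $1-q\succ 1/h^2$, then with high probability $X(\Sigma)$ is singular. In addition, for every integer $k>1$, if $1-q\succ 1/h$ and $q\succ 1/h^2$, then with high probability $X(\Sigma)$ has a singular torus-fixed point of singularity index at least $k$. -/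

import Mathlib

namespace RandomToric


/-- The inclusion of the lattice `N = ℤ²` into `N_ℝ = ℝ²`. -/
def latticeToReal (u : Fin 2 → ℤ) : Fin 2 → ℝ := fun i => (u i : ℝ)

/-- The determinant `u ∧ v` of two lattice vectors. -/
def wedge (u v : Fin 2 → ℤ) : ℤ := u 0 * v 1 - u 1 * v 0

/-- A lattice vector is primitive if its coordinates are coprime. -/
def IsPrimitive (u : Fin 2 → ℤ) : Prop := IsCoprime (u 0) (u 1)

/-- The cone in `ℝ²` generated by a set of lattice vectors. -/
noncomputable def latticeCone (s : Set (Fin 2 → ℤ)) : PointedCone ℝ (Fin 2 → ℝ) :=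
  PointedCone.hull ℝ (latticeToReal '' s)

/-- A fan in `ℝ²`: a nonempty finite collection of strongly convex rational polyhedral cones which
contains every face of each of its members, and in which any two members meet in a common face
(the last condition is required for `(σ, τ)` and for `(τ, σ)`). -/
@[ext]
structure Fan where
  cones : Set (PointedCone ℝ (Fin 2 → ℝ))
  finite : cones.Finite
  nonempty : cones.Nonempty
  rational : ∀ σ ∈ cones, ∃ s : Finset (Fin 2 → ℤ), σ = latticeCone (s : Set (Fin 2 → ℤ))
  salient : ∀ σ ∈ cones, (σ : ConvexCone ℝ (Fin 2 → ℝ)).Salient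
  face_mem : ∀ σ ∈ cones, ∀ τ : PointedCone ℝ (Fin 2 → ℝ), τ.IsFaceOf σ → τ ∈ cones
  inf_isFaceOf : ∀ σ ∈ cones, ∀ τ ∈ cones, (σ ⊓ τ).IsFaceOf σ

theorem Fan.cones_injective : Function.Injective Fan.cones := fun _ _ h => Fan.ext h

/-- Fans are ordered by inclusion. -/
instance : PartialOrder Fan := PartialOrder.lift Fan.cones Fan.cones_injective

/-- Rays with rational slope: such a ray is spanned by its minimal lattice point `u`, which is a
primitive vector. -/
def IsLatticeRay (ρ : PointedCone ℝ (Fin 2 → ℝ)) : Prop :=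
  ∃ u : Fin 2 → ℤ, IsPrimitive u ∧ ρ = latticeCone {u}

/-- `Σ(1)`, the set of rays of a fan. -/
def Fan.rays (F : Fan) : Set (PointedCone ℝ (Fin 2 → ℝ)) := {ρ ∈ F.cones | IsLatticeRay ρ}

theorem mem_latticeCone_pair {u v : Fin 2 → ℤ} {x : Fin 2 → ℝ} :
    x ∈ latticeCone {u, v} ↔ ∃ a b : ℝ, 0 ≤ a ∧ 0 ≤ b ∧
      a • latticeToReal u + b • latticeToReal v = x := by
  unfold latticeCone
  rw [Set.image_pair, PointedCone.hull, Submodule.mem_span_pair]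
  constructor
  · rintro ⟨a, b, rfl⟩
    exact ⟨a, b, a.2, b.2, rfl⟩
  · rintro ⟨a, b, ha, hb, rfl⟩
    exact ⟨⟨a, ha⟩, ⟨b, hb⟩, rfl⟩

theorem mem_latticeCone_singleton {u : Fin 2 → ℤ} {x : Fin 2 → ℝ} :
    x ∈ latticeCone {u} ↔ ∃ a : ℝ, 0 ≤ a ∧ a • latticeToReal u = x := by
  unfold latticeCone
  rw [Set.image_singleton, PointedCone.hull, Submodule.mem_span_singleton]
  constructor
  · rintro ⟨a, rfl⟩
    exact ⟨a, a.2, rfl⟩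
  · rintro ⟨a, ha, rfl⟩
    exact ⟨⟨a, ha⟩, rfl⟩

theorem latticeToReal_mem_latticeCone {s : Set (Fin 2 → ℤ)} {u : Fin 2 → ℤ} (hu : u ∈ s) :
    latticeToReal u ∈ latticeCone s :=
  Submodule.subset_span ⟨u, hu, rfl⟩

theorem latticeCone_le {s : Set (Fin 2 → ℤ)} {σ : PointedCone ℝ (Fin 2 → ℝ)}
    (h : ∀ u ∈ s, latticeToReal u ∈ σ) : latticeCone s ≤ σ :=
  Submodule.span_le.2 (by rintro _ ⟨u, hu, rfl⟩; exact h u hu)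

theorem salient_eq_zero {σ : PointedCone ℝ (Fin 2 → ℝ)}
    (h : (σ : ConvexCone ℝ (Fin 2 → ℝ)).Salient) {x : Fin 2 → ℝ} (hx : x ∈ σ) (hx' : -x ∈ σ) :
    x = 0 := by
  by_contra h0
  exact h x hx h0 hx'

theorem latticeToReal_eq_zero {u : Fin 2 → ℤ} : latticeToReal u = 0 ↔ u = 0 := by
  constructor
  · intro h
    ext i
    have := congrFun h i
    simpa [latticeToReal] using this
  · rintro rfl
    ext i
    simp [latticeToReal]

theorem mem_pair_of_smul_eq {x y z : Fin 2 → ℤ} {a b c : ℤ} (hc : 0 < c) (ha : 0 ≤ a) (hb : 0 ≤ b)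
    (h : ∀ i, c * x i = a * y i + b * z i) : latticeToReal x ∈ latticeCone {y, z} := by
  rw [mem_latticeCone_pair]
  have hc' : (0 : ℝ) < c := by exact_mod_cast hc
  refine ⟨a / c, b / c, div_nonneg (by exact_mod_cast ha) hc'.le,
    div_nonneg (by exact_mod_cast hb) hc'.le, ?_⟩
  ext i
  have h' : (c : ℝ) * x i = a * y i + b * z i := by exact_mod_cast h i
  simp only [latticeToReal, Pi.add_apply, Pi.smul_apply, smul_eq_mul]
  field_simp
  linarith

theorem neg_mem_pair_of_smul_eq {x y z : Fin 2 → ℤ} {a b c : ℤ} (hc : 0 < c) (ha : 0 ≤ a)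
    (hb : 0 ≤ b) (h : ∀ i, c * x i + a * y i + b * z i = 0) :
    -latticeToReal x ∈ latticeCone {y, z} := by
  have := mem_pair_of_smul_eq (x := -x) (y := y) (z := z) hc ha hb (by
    intro i; have := h i; simp only [Pi.neg_apply]; linarith)
  convert this using 1
  ext i
  simp [latticeToReal]

theorem exists_pair_of_triple {w u v : Fin 2 → ℤ} (hd : v = u ∨ 0 < wedge u v)
    (hs : ((latticeCone {w, u, v} : PointedCone ℝ (Fin 2 → ℝ)) :
      ConvexCone ℝ (Fin 2 → ℝ)).Salient) :
    ∃ x y : Fin 2 → ℤ, latticeCone {w, u, v} = latticeCone {x, y} ∧ (y = x ∨ 0 < wedge x y) := by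
  have key : ∀ x y : Fin 2 → ℤ, x ∈ ({w, u, v} : Set (Fin 2 → ℤ)) →
      y ∈ ({w, u, v} : Set (Fin 2 → ℤ)) → latticeToReal w ∈ latticeCone {x, y} →
      latticeToReal u ∈ latticeCone {x, y} → latticeToReal v ∈ latticeCone {x, y} →
      latticeCone {w, u, v} = latticeCone {x, y} := by
    intro x y hx hy h1 h2 h3
    apply le_antisymm
    · refine latticeCone_le ?_
      rintro z (rfl | rfl | rfl) <;> assumption
    · refine latticeCone_le ?_
      rintro z (rfl | rfl) <;> exact latticeToReal_mem_latticeCone (by assumption)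
  have key2 : ∀ x y z : Fin 2 → ℤ, x ∈ ({w, u, v} : Set (Fin 2 → ℤ)) →
      y ∈ ({w, u, v} : Set (Fin 2 → ℤ)) → z ∈ ({w, u, v} : Set (Fin 2 → ℤ)) →
      ∀ a b c : ℤ, 0 < c → 0 ≤ a → 0 ≤ b → (∀ i, c * x i + a * y i + b * z i = 0) → x = 0 := by
    intro x y z hx hy hz a b c hc ha hb h
    have h1 := neg_mem_pair_of_smul_eq hc ha hb h
    have h2 : latticeCone {y, z} ≤ latticeCone {w, u, v} := by
      refine latticeCone_le ?_
      rintro t (rfl | rfl) <;> exact latticeToReal_mem_latticeCone (by assumption)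
    exact latticeToReal_eq_zero.1
      (salient_eq_zero hs (latticeToReal_mem_latticeCone hx) (h2 h1))
  have hl : ∀ x y : Fin 2 → ℤ, latticeToReal x ∈ latticeCone {x, y} :=
    fun x y => latticeToReal_mem_latticeCone (by simp)
  have hr : ∀ x y : Fin 2 → ℤ, latticeToReal y ∈ latticeCone {x, y} :=
    fun x y => latticeToReal_mem_latticeCone (by simp)
  rcases hd with rfl | hd
  · rcases lt_trichotomy (wedge w v) 0 with h | h | h
    · exact ⟨v, w, key v w (by simp) (by simp) (hr _ _) (hl _ _) (hl _ _), Or.inr (by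
        unfold wedge at *; linarith)⟩
    · by_cases hw : w = 0
      · refine ⟨v, v, key v v (by simp) (by simp) ?_ (hl _ _) (hl _ _), Or.inl rfl⟩
        rw [hw, latticeToReal_eq_zero.2 rfl]
        exact zero_mem _
      · -- `v` is a nonnegative multiple of `w`: `(w ⬝ w) v = (w ⬝ v) w`
        have hww : 0 < w 0 * w 0 + w 1 * w 1 := by
          by_contra hcon
          apply hw
          ext i
          fin_cases i <;> simp <;> nlinarith [mul_self_nonneg (w 0), mul_self_nonneg (w 1)]
        have hi : ∀ i, (w 0 * w 0 + w 1 * w 1) * v i = (w 0 * v 0 + w 1 * v 1) * w i := by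
          unfold wedge at h
          intro i
          fin_cases i <;> simp
          · linear_combination (-w 1) * h
          · linear_combination (w 0) * h
        have hv : latticeToReal v ∈ latticeCone {w, w} := by
          rcases le_or_gt 0 (w 0 * v 0 + w 1 * v 1) with h0 | h0
          · exact mem_pair_of_smul_eq hww h0 le_rfl (fun i => by rw [hi i]; ring)
          · have : v = 0 := key2 v w w (by simp) (by simp) (by simp)
              (-(w 0 * v 0 + w 1 * v 1)) 0 _ hww (by linarith) le_rfl
              (fun i => by rw [hi i]; ring)
            rw [this, latticeToReal_eq_zero.2 rfl]
            exact zero_mem _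
        exact ⟨w, w, key w w (by simp) (by simp) (hl _ _) hv hv, Or.inl rfl⟩
    · exact ⟨w, v, key w v (by simp) (by simp) (hl _ _) (hr _ _) (hr _ _), Or.inr h⟩
  · have hid : ∀ i, wedge u v * w i = wedge w v * u i + wedge u w * v i := by
      unfold wedge
      intro i
      fin_cases i <;> simp <;> ring
    have h0 : w = 0 → wedge u w = 0 ∧ wedge w v = 0 := by
      rintro rfl
      simp [wedge]
    rcases le_or_gt 0 (wedge u w) with ha | ha <;> rcases le_or_gt 0 (wedge w v) with hb | hb
    · exact ⟨u, v, key u v (by simp) (by simp) (mem_pair_of_smul_eq hd hb ha hid) (hl _ _) (hr _ _),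
        Or.inr hd⟩
    · rcases ha.eq_or_lt with ha | ha
      · have := h0 (key2 w u u (by simp) (by simp) (by simp) (-wedge w v) 0 _ hd (by linarith)
          le_rfl (fun i => by rw [hid i, ← ha]; ring))
        omega
      · exact ⟨u, w, key u w (by simp) (by simp) (hr _ _) (hl _ _)
          (mem_pair_of_smul_eq (a := -wedge w v) (b := wedge u v) ha (by linarith) hd.le
            (fun i => by linarith [hid i])), Or.inr ha⟩
    · rcases hb.eq_or_lt with hb | hb
      · have := h0 (key2 w v v (by simp) (by simp) (by simp) (-wedge u w) 0 _ hd (by linarith)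
          le_rfl (fun i => by rw [hid i, ← hb]; ring))
        omega
      · exact ⟨w, v, key w v (by simp) (by simp) (hl _ _)
          (mem_pair_of_smul_eq (a := wedge u v) (b := -wedge u w) hb hd.le (by linarith)
            (fun i => by linarith [hid i])) (hr _ _), Or.inr hb⟩
    · have := h0 (key2 w u v (by simp) (by simp) (by simp) (-wedge w v) (-wedge u w) _ hd
        (by linarith) (by linarith) (fun i => by rw [hid i]; ring))
      omega

/-- In dimension two every strongly convex rational cone is spanned by two lattice vectors, linearly
independent unless they agree. -/
theorem exists_pair (s : Finset (Fin 2 → ℤ))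
    (hs : ((latticeCone (s : Set (Fin 2 → ℤ)) : PointedCone ℝ (Fin 2 → ℝ)) :
      ConvexCone ℝ (Fin 2 → ℝ)).Salient) :
    ∃ u v : Fin 2 → ℤ, latticeCone (s : Set (Fin 2 → ℤ)) = latticeCone {u, v} ∧
      (v = u ∨ 0 < wedge u v) := by
  classical
  induction s using Finset.induction_on with
  | empty =>
    refine ⟨0, 0, ?_, Or.inl rfl⟩
    apply le_antisymm
    · exact latticeCone_le (by simp)
    · refine latticeCone_le ?_
      intro u hu
      have : u = 0 := by simpa using hu
      rw [this, latticeToReal_eq_zero.2 rfl]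
      exact zero_mem _
  | insert w s hw ih =>
    have hle : latticeCone (s : Set (Fin 2 → ℤ)) ≤
        latticeCone ((insert w s : Finset (Fin 2 → ℤ)) : Set (Fin 2 → ℤ)) :=
      latticeCone_le fun u hu => latticeToReal_mem_latticeCone (by simp_all)
    obtain ⟨u, v, huv, hd⟩ := ih (by
      intro x hx h0 hx'
      exact hs x (hle hx) h0 (hle hx'))
    have hw' : latticeToReal w ∈
        latticeCone ((insert w s : Finset (Fin 2 → ℤ)) : Set (Fin 2 → ℤ)) :=
      latticeToReal_mem_latticeCone (by simp)
    have hins : latticeCone ((insert w s : Finset (Fin 2 → ℤ)) : Set (Fin 2 → ℤ)) =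
        latticeCone {w, u, v} := by
      apply le_antisymm
      · refine latticeCone_le ?_
        intro x hx
        rcases (by simpa using hx : x = w ∨ x ∈ s) with rfl | hx
        · exact latticeToReal_mem_latticeCone (by simp)
        · have h1 : latticeToReal x ∈ latticeCone {u, v} :=
            huv ▸ latticeToReal_mem_latticeCone (by simpa using hx)
          exact (latticeCone_le (s := {u, v}) fun y hy =>
            latticeToReal_mem_latticeCone (by simp_all)) h1
      · refine latticeCone_le ?_
        intro x hx
        rcases (by simpa using hx : x = w ∨ x = u ∨ x = v) with rfl | rfl | rfl
        · exact hw'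
        · exact hle (huv ▸ latticeToReal_mem_latticeCone (by simp))
        · exact hle (huv ▸ latticeToReal_mem_latticeCone (by simp))
    rw [hins] at hs ⊢
    exact exists_pair_of_triple hd hs

/-- The pairing of `m ∈ M = ℤ²` with `x ∈ N_ℝ`. -/
def pairing (m : Fin 2 → ℤ) (x : Fin 2 → ℝ) : ℝ := ∑ i, (m i : ℝ) * x i

theorem mem_face_of_add {σ τ : PointedCone ℝ (Fin 2 → ℝ)} (h : τ.IsFaceOf σ) {x y : Fin 2 → ℝ}
    (hx : x ∈ σ) (hy : y ∈ σ) (hxy : x + y ∈ τ) : x ∈ τ ∧ y ∈ τ :=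
  ⟨h.mem_of_add_mem_left hx hy hxy, h.mem_of_add_mem_right hx hy hxy⟩

/-- Every face of a strongly convex rational cone is cut out by an integral linear form. -/
theorem exists_pairing_of_isFaceOf {σ τ : PointedCone ℝ (Fin 2 → ℝ)} {s : Finset (Fin 2 → ℤ)}
    (hσ : σ = latticeCone (s : Set (Fin 2 → ℤ)))
    (hs : (σ : ConvexCone ℝ (Fin 2 → ℝ)).Salient) (h : τ.IsFaceOf σ) :
    ∃ m : Fin 2 → ℤ, (∀ x ∈ σ, 0 ≤ pairing m x) ∧ ∀ x, x ∈ τ ↔ x ∈ σ ∧ pairing m x = 0 := by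
  subst hσ
  obtain ⟨u, v, huv, hd⟩ := exists_pair s hs
  rw [huv] at hs h ⊢
  have hu : latticeToReal u ∈ latticeCone {u, v} := latticeToReal_mem_latticeCone (by simp)
  have hv : latticeToReal v ∈ latticeCone {u, v} := latticeToReal_mem_latticeCone (by simp)
  have hsub : ∀ {w : Fin 2 → ℤ} {c : ℝ}, 0 < c → c • latticeToReal w ∈ τ → latticeToReal w ∈ τ := by
    intro w c hc hw
    have := PointedCone.smul_mem τ (inv_nonneg.2 hc.le) hw
    rwa [smul_smul, inv_mul_cancel₀ hc.ne', one_smul] at this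
  by_cases h1 : latticeToReal u ∈ τ ∧ latticeToReal v ∈ τ
  · refine ⟨0, by simp [pairing], fun x => ⟨fun hx => ⟨h.le hx, by simp [pairing]⟩, ?_⟩⟩
    rintro ⟨hx, -⟩
    exact (latticeCone_le (s := {u, v}) (by rintro z (rfl | rfl); exacts [h1.1, h1.2])) hx
  rcases hd with rfl | hd
  · have h1' : latticeToReal v ∉ τ := fun hh => h1 ⟨hh, hh⟩
    have hv0 : v ≠ 0 := by
      rintro rfl
      exact h1' (by rw [latticeToReal_eq_zero.2 rfl]; exact zero_mem _)
    have hvv : (0 : ℝ) < v 0 * v 0 + v 1 * v 1 := by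
      have : 0 < v 0 * v 0 + v 1 * v 1 := by
        by_contra hcon
        apply hv0
        ext i
        fin_cases i <;> simp <;> nlinarith [mul_self_nonneg (v 0), mul_self_nonneg (v 1)]
      exact_mod_cast this
    have hp : ∀ a b : ℝ, pairing v (a • latticeToReal v + b • latticeToReal v) =
        (a + b) * (v 0 * v 0 + v 1 * v 1) := by
      intro a b
      simp [pairing, latticeToReal, Fin.sum_univ_two]
      ring
    refine ⟨v, ?_, ?_⟩
    · intro x hx
      obtain ⟨a, b, ha, hb, rfl⟩ := mem_latticeCone_pair.1 hx
      rw [hp]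
      positivity
    · intro x
      constructor
      · intro hx
        refine ⟨h.le hx, ?_⟩
        obtain ⟨a, b, ha, hb, rfl⟩ := mem_latticeCone_pair.1 (h.le hx)
        rw [hp]
        rw [← add_smul] at hx
        rcases (add_nonneg ha hb).eq_or_lt with h0 | h0
        · rw [← h0, zero_mul]
        · exact absurd (hsub h0 hx) h1'
      · rintro ⟨hx, hx0⟩
        obtain ⟨a, b, ha, hb, rfl⟩ := mem_latticeCone_pair.1 hx
        rw [hp] at hx0
        rw [← add_smul, (mul_eq_zero.1 hx0).resolve_right hvv.ne', zero_smul]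
        exact zero_mem _
  · have hd' : (0 : ℝ) < u 0 * v 1 - u 1 * v 0 := by exact_mod_cast hd
    -- weights on the two coordinates
    have main : ∀ ε δ : ℤ, 0 ≤ ε → 0 ≤ δ → (ε = 0 ↔ latticeToReal u ∈ τ) →
        (δ = 0 ↔ latticeToReal v ∈ τ) →
        ∃ m : Fin 2 → ℤ, (∀ x ∈ latticeCone {u, v}, 0 ≤ pairing m x) ∧
          ∀ x, x ∈ τ ↔ x ∈ latticeCone {u, v} ∧ pairing m x = 0 := by
      intro ε δ hε hδ hεu hδv
      have hε' : (0 : ℝ) ≤ ε := by exact_mod_cast hε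
      have hδ' : (0 : ℝ) ≤ δ := by exact_mod_cast hδ
      have hp : ∀ a b : ℝ, pairing ![ε * v 1 - δ * u 1, δ * u 0 - ε * v 0]
          (a • latticeToReal u + b • latticeToReal v) =
          (ε * a + δ * b) * (u 0 * v 1 - u 1 * v 0) := by
        intro a b
        simp [pairing, latticeToReal, Fin.sum_univ_two]
        ring
      refine ⟨![ε * v 1 - δ * u 1, δ * u 0 - ε * v 0], ?_, ?_⟩
      · intro x hx
        obtain ⟨a, b, ha, hb, rfl⟩ := mem_latticeCone_pair.1 hx
        rw [hp]
        positivity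
      · intro x
        constructor
        · intro hx
          refine ⟨h.le hx, ?_⟩
          obtain ⟨a, b, ha, hb, rfl⟩ := mem_latticeCone_pair.1 (h.le hx)
          obtain ⟨hx1, hx2⟩ := mem_face_of_add h (PointedCone.smul_mem _ ha hu)
            (PointedCone.smul_mem _ hb hv) hx
          rw [hp]
          have e1 : (ε : ℝ) * a = 0 := by
            rcases ha.eq_or_lt with h0 | h0
            · rw [← h0, mul_zero]
            · rw [hεu.2 (hsub h0 hx1)]; simp
          have e2 : (δ : ℝ) * b = 0 := by
            rcases hb.eq_or_lt with h0 | h0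
            · rw [← h0, mul_zero]
            · rw [hδv.2 (hsub h0 hx2)]; simp
          rw [e1, e2]; simp
        · rintro ⟨hx, hx0⟩
          obtain ⟨a, b, ha, hb, rfl⟩ := mem_latticeCone_pair.1 hx
          rw [hp] at hx0
          have h3 := (mul_eq_zero.1 hx0).resolve_right hd'.ne'
          have h4 := mul_nonneg hε' ha
          have h5 := mul_nonneg hδ' hb
          refine add_mem ?_ ?_
          · rcases mul_eq_zero.1 (show (ε : ℝ) * a = 0 by linarith) with h0 | h0
            · exact PointedCone.smul_mem τ ha (hεu.1 (by exact_mod_cast h0))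
            · rw [h0, zero_smul]; exact zero_mem _
          · rcases mul_eq_zero.1 (show (δ : ℝ) * b = 0 by linarith) with h0 | h0
            · exact PointedCone.smul_mem τ hb (hδv.1 (by exact_mod_cast h0))
            · rw [h0, zero_smul]; exact zero_mem _
    classical
    refine main (if latticeToReal u ∈ τ then 0 else 1) (if latticeToReal v ∈ τ then 0 else 1)
      ?_ ?_ ?_ ?_ <;> split_ifs <;> simp_all

theorem isLatticeRay_latticeCone {u : Fin 2 → ℤ} (hu : u ≠ 0) : IsLatticeRay (latticeCone {u}) := by
  have hg : 0 < Int.gcd (u 0) (u 1) := by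
    rw [Int.gcd_pos_iff]
    by_contra hcon
    push Not at hcon
    exact hu (by ext i; fin_cases i <;> simp [hcon.1, hcon.2])
  obtain ⟨a, b, hab, ha, hb⟩ := Int.exists_gcd_one hg
  have hg' : (0 : ℝ) < Int.gcd (u 0) (u 1) := by exact_mod_cast hg
  have e : latticeToReal u = (Int.gcd (u 0) (u 1) : ℝ) • latticeToReal ![a, b] := by
    ext i
    fin_cases i
    · simp only [latticeToReal, Pi.smul_apply, smul_eq_mul]
      simp only [Fin.zero_eta, Matrix.cons_val_zero]
      conv_lhs => rw [ha]
      push_cast; ring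
    · simp only [latticeToReal, Pi.smul_apply, smul_eq_mul]
      simp only [Fin.mk_one, Matrix.cons_val_one, Matrix.cons_val_fin_one]
      conv_lhs => rw [hb]
      push_cast; ring
  refine ⟨![a, b], ?_, ?_⟩
  · simpa [IsPrimitive, Int.isCoprime_iff_gcd_eq_one] using hab
  · apply le_antisymm
    · refine latticeCone_le ?_
      rintro _ rfl
      rw [e]
      exact PointedCone.smul_mem _ hg'.le (latticeToReal_mem_latticeCone rfl)
    · refine latticeCone_le ?_
      rintro _ rfl
      have := PointedCone.smul_mem (latticeCone {u}) (inv_nonneg.2 hg'.le)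
        (latticeToReal_mem_latticeCone (s := {u}) rfl)
      rwa [e, smul_smul, inv_mul_cancel₀ hg'.ne', one_smul] at this

theorem isFaceOf_pair {u v : Fin 2 → ℤ} (h : wedge u v ≠ 0) :
    (latticeCone {u}).IsFaceOf (latticeCone {u, v}) := by
  refine ⟨latticeCone_le (by rintro _ rfl; exact latticeToReal_mem_latticeCone (by simp)), ?_⟩
  intro x y c hx hy hc hxy
  obtain ⟨a, b, ha, hb, rfl⟩ := mem_latticeCone_pair.1 hx
  obtain ⟨a', b', ha', hb', rfl⟩ := mem_latticeCone_pair.1 hy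
  obtain ⟨t, ht, h'⟩ := mem_latticeCone_singleton.1 hxy
  have h0 := congrFun h' 0
  have h1 := congrFun h' 1
  simp only [latticeToReal, Pi.add_apply, Pi.smul_apply, smul_eq_mul] at h0 h1
  have hw : ((u 0 : ℝ) * v 1 - u 1 * v 0) ≠ 0 := by exact_mod_cast h
  have hcb : (c * b + b') * ((u 0 : ℝ) * v 1 - u 1 * v 0) = 0 := by
    linear_combination (u 1 : ℝ) * h0 - (u 0 : ℝ) * h1
  have hb0 : b = 0 := by
    have h3 := (mul_eq_zero.1 hcb).resolve_right hw
    have h4 := mul_nonneg hc.le hb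
    have h5 : c * b = 0 := by linarith
    exact (mul_eq_zero.1 h5).resolve_left hc.ne'
  rw [hb0, zero_smul, add_zero]
  exact PointedCone.smul_mem _ ha (latticeToReal_mem_latticeCone rfl)

theorem Fan.cone_eq_sSup (F : Fan) {σ : PointedCone ℝ (Fin 2 → ℝ)} (hσ : σ ∈ F.cones) :
    σ = sSup {ρ ∈ F.rays | ρ ≤ σ} := by
  apply le_antisymm _ (sSup_le fun ρ hρ => hρ.2)
  obtain ⟨s, hs⟩ := F.rational σ hσ
  obtain ⟨u, v, huv, hd⟩ := exists_pair s (hs ▸ F.salient σ hσ)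
  rw [huv] at hs
  have ray : ∀ w : Fin 2 → ℤ, (w ≠ 0 → latticeCone {w} ∈ F.cones) → latticeCone {w} ≤ σ →
      latticeToReal w ∈ sSup {ρ ∈ F.rays | ρ ≤ σ} := by
    intro w hw hle
    by_cases h0 : w = 0
    · rw [h0, latticeToReal_eq_zero.2 rfl]
      exact zero_mem _
    · have h1 : latticeCone {w} ≤ sSup {ρ ∈ F.rays | ρ ≤ σ} :=
        le_sSup ⟨⟨hw h0, isLatticeRay_latticeCone h0⟩, hle⟩
      exact h1 (latticeToReal_mem_latticeCone rfl)
  rcases hd with rfl | hd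
  · rw [Set.pair_eq_singleton] at hs
    conv_lhs => rw [hs]
    refine latticeCone_le ?_
    rintro _ rfl
    exact ray _ (fun _ => hs ▸ hσ) hs.ge
  · have f1 : (latticeCone {u}).IsFaceOf σ := hs ▸ isFaceOf_pair hd.ne'
    have f2 : (latticeCone {v}).IsFaceOf σ := by
      rw [hs, Set.pair_comm]
      exact isFaceOf_pair (by unfold wedge at *; intro h; linarith)
    conv_lhs => rw [hs]
    refine latticeCone_le ?_
    rintro _ (rfl | rfl)
    · exact ray _ (fun _ => F.face_mem σ hσ _ f1) f1.le
    · exact ray _ (fun _ => F.face_mem σ hσ _ f2) f2.le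

theorem finite_setOf_rays_eq {S : Set (PointedCone ℝ (Fin 2 → ℝ))} (hS : S.Finite) :
    {F : Fan | F.rays = S}.Finite := by
  have hK : ((fun A : Set (PointedCone ℝ (Fin 2 → ℝ)) => sSup A) '' 𝒫 S).Finite :=
    hS.powerset.image _
  refine Set.Finite.of_finite_image (f := Fan.cones) (hK.powerset.subset ?_)
    Fan.cones_injective.injOn
  rintro _ ⟨F, rfl, rfl⟩ σ hσ
  exact ⟨_, fun ρ hρ => hρ.1, (F.cone_eq_sSup hσ).symm⟩

theorem eq_bot_or_eq_of_isFaceOf_ray {u : Fin 2 → ℤ} {τ : PointedCone ℝ (Fin 2 → ℝ)}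
    (h : τ ≤ latticeCone {u}) : τ = ⊥ ∨ τ = latticeCone {u} := by
  by_cases h0 : τ = ⊥
  · exact Or.inl h0
  · right
    obtain ⟨x, hx, hx0⟩ := (Submodule.ne_bot_iff _).1 h0
    obtain ⟨a, ha, rfl⟩ := mem_latticeCone_singleton.1 (h hx)
    have ha' : 0 < a := ha.lt_of_ne (by rintro rfl; simp at hx0)
    refine le_antisymm h (latticeCone_le ?_)
    rintro _ rfl
    have := PointedCone.smul_mem τ (inv_nonneg.2 ha) hx
    rwa [smul_smul, inv_mul_cancel₀ ha'.ne', one_smul] at this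

theorem salient_ray {u : Fin 2 → ℤ} (hu : u ≠ 0) :
    ((latticeCone {u} : PointedCone ℝ (Fin 2 → ℝ)) : ConvexCone ℝ (Fin 2 → ℝ)).Salient := by
  intro x hx h0 hx'
  obtain ⟨a, ha, rfl⟩ := mem_latticeCone_singleton.1 hx
  obtain ⟨b, hb, hb'⟩ := mem_latticeCone_singleton.1 hx'
  have : (b + a) • latticeToReal u = 0 := by rw [add_smul, hb', neg_add_cancel]
  rcases smul_eq_zero.1 this with h | h
  · exact h0 (by rw [show a = 0 by linarith, zero_smul])
  · exact hu (latticeToReal_eq_zero.1 h)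

theorem IsPrimitive.ne_zero {u : Fin 2 → ℤ} (h : IsPrimitive u) : u ≠ 0 := by
  rintro rfl
  exact not_isCoprime_zero_zero (by simpa [IsPrimitive] using h)

theorem bot_isFaceOf {σ : PointedCone ℝ (Fin 2 → ℝ)}
    (h : (σ : ConvexCone ℝ (Fin 2 → ℝ)).Salient) : (⊥ : PointedCone ℝ (Fin 2 → ℝ)).IsFaceOf σ := by
  refine ⟨bot_le, ?_⟩
  intro x y a hx hy ha hxy
  have h1 : a • x = 0 := salient_eq_zero h (PointedCone.smul_mem _ ha.le hx) (by
    have : a • x + y = 0 := by simpa using hxy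
    rwa [neg_eq_of_add_eq_zero_right this])
  simpa [ha.ne'] using h1

/-- The fan consisting of the origin and a finite set of rays. -/
def raysFan (S : Set (PointedCone ℝ (Fin 2 → ℝ))) (hS : ∀ ρ ∈ S, IsLatticeRay ρ)
    (hfin : S.Finite) : Fan :=
  have sal : ∀ σ ∈ insert ⊥ S, (σ : ConvexCone ℝ (Fin 2 → ℝ)).Salient := by
    rintro σ (rfl | hσ)
    · intro x hx h0
      exact absurd (by simpa using hx) h0
    · obtain ⟨u, hu, rfl⟩ := hS σ hσ
      exact salient_ray hu.ne_zero
  have sub : ∀ σ ∈ insert ⊥ S, ∀ τ ≤ σ, τ = ⊥ ∨ τ = σ := by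
    rintro σ (rfl | hσ) τ hτ
    · exact Or.inl (le_bot_iff.1 hτ)
    · obtain ⟨u, hu, rfl⟩ := hS σ hσ
      exact eq_bot_or_eq_of_isFaceOf_ray hτ
  { cones := insert ⊥ S
    finite := hfin.insert _
    nonempty := ⟨⊥, by simp⟩
    rational := by
      rintro σ (rfl | hσ)
      · exact ⟨∅, by simp [latticeCone]⟩
      · obtain ⟨u, hu, rfl⟩ := hS σ hσ
        exact ⟨{u}, by simp⟩
    salient := sal
    face_mem := by
      intro σ hσ τ hτ
      rcases sub σ hσ τ hτ.le with rfl | rfl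
      · simp
      · exact hσ
    inf_isFaceOf := by
      intro σ hσ τ hτ
      rcases sub σ hσ (σ ⊓ τ) inf_le_left with h | h
      · rw [h]; exact bot_isFaceOf (sal σ hσ)
      · rw [h] }

theorem rays_raysFan {S : Set (PointedCone ℝ (Fin 2 → ℝ))} (hS : ∀ ρ ∈ S, IsLatticeRay ρ)
    (hfin : S.Finite) : (raysFan S hS hfin).rays = S := by
  ext ρ
  constructor
  · rintro ⟨h | h, u, hu, rfl⟩
    · have := latticeToReal_mem_latticeCone (s := {u}) rfl
      rw [h] at this
      exact absurd (latticeToReal_eq_zero.1 (by simpa using this)) hu.ne_zero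
    · exact h
  · intro h
    exact ⟨Or.inr h, hS ρ h⟩

theorem exists_completion (S : Set (PointedCone ℝ (Fin 2 → ℝ))) (hS : ∀ ρ ∈ S, IsLatticeRay ρ)
    (hfin : S.Finite) : ∃ F : Fan, Maximal (fun F' : Fan => F'.rays = S) F :=
  (finite_setOf_rays_eq hfin).exists_maximal ⟨raysFan S hS hfin, rays_raysFan hS hfin⟩

/-- The completion of a finite set `S` of rays: the maximal fan `Σ` with `Σ(1) = S`. -/
noncomputable def completion (S : Set (PointedCone ℝ (Fin 2 → ℝ))) (hS : ∀ ρ ∈ S, IsLatticeRay ρ)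
    (hfin : S.Finite) : Fan :=
  (exists_completion S hS hfin).choose

theorem completion_spec (S : Set (PointedCone ℝ (Fin 2 → ℝ))) (hS : ∀ ρ ∈ S, IsLatticeRay ρ)
    (hfin : S.Finite) : Maximal (fun F : Fan => F.rays = S) (completion S hS hfin) :=
  (exists_completion S hS hfin).choose_spec

/-- The set `R` of rays whose minimal lattice point has max-norm at most `h`. -/
def raysUpTo (h : ℕ) : Set (PointedCone ℝ (Fin 2 → ℝ)) :=
  {ρ | ∃ u : Fin 2 → ℤ, IsPrimitive u ∧ (∀ i, |u i| ≤ h) ∧ ρ = latticeCone {u}}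

theorem raysUpTo_finite (h : ℕ) : (raysUpTo h).Finite := by
  have : (Set.Icc (fun _ => -(h : ℤ)) (fun _ => (h : ℤ)) : Set (Fin 2 → ℤ)).Finite :=
    Set.finite_Icc _ _
  refine (this.image fun u => latticeCone {u}).subset ?_
  rintro _ ⟨u, -, hu, rfl⟩
  exact ⟨u, ⟨fun i => (abs_le.1 (hu i)).1, fun i => (abs_le.1 (hu i)).2⟩, rfl⟩

instance (h : ℕ) : Finite (raysUpTo h) := (raysUpTo_finite h).to_subtype

/-- The completion of a set of rays chosen among the rays of norm at most `h`. -/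
noncomputable def completionUpTo (h : ℕ) (S : Set (raysUpTo h)) : Fan :=
  completion (Subtype.val '' S)
    (by rintro _ ⟨⟨_, u, hu, -, rfl⟩, -, rfl⟩; exact ⟨u, hu, rfl⟩)
    ((Set.toFinite S).image _)

/-- Every set of fans is an event. -/
instance : MeasurableSpace Fan := ⊤

/-- `Σ_h`, the completion of the set of all rays of norm at most `h`. -/
noncomputable def fullFan (h : ℕ) : Fan := completionUpTo h Set.univ

/-- The distribution `T(h, p)` on fans: each ray of norm at most `h` is chosen independently with
probability `p`, and the chosen set of rays is completed to a fan. -/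
noncomputable def T (h : ℕ) (p : unitInterval) : MeasureTheory.Measure Fan :=
  (ProbabilityTheory.setBernoulli (Set.univ : Set (raysUpTo h)) p).map (completionUpTo h)

instance (h : ℕ) (p : unitInterval) : MeasureTheory.IsProbabilityMeasure (T h p) :=
  MeasureTheory.Measure.isProbabilityMeasure_map (measurable_of_countable _).aemeasurable

open CategoryTheory AlgebraicGeometry

theorem pairing_add (m m' : Fin 2 → ℤ) (x : Fin 2 → ℝ) :
    pairing (m + m') x = pairing m x + pairing m' x := by
  simp [pairing, Fin.sum_univ_two]; ring

/-- The semigroup `S_σ = σ^∨ ∩ M` as a submonoid of `M = ℤ²`. -/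
def dualMonoid (σ : PointedCone ℝ (Fin 2 → ℝ)) : AddSubmonoid (Fin 2 → ℤ) where
  carrier := {m | ∀ x ∈ σ, 0 ≤ pairing m x}
  zero_mem' := by intro x _; simp [pairing]
  add_mem' := by
    intro m m' hm hm' x hx
    rw [pairing_add]
    exact add_nonneg (hm x hx) (hm' x hx)

theorem dualMonoid_anti {σ τ : PointedCone ℝ (Fin 2 → ℝ)} (h : τ ≤ σ) :
    dualMonoid σ ≤ dualMonoid τ := fun _ hm x hx => hm x (h hx)

/-- The semigroup algebra `ℂ[S_σ]`. -/
abbrev coneAlgebra (σ : PointedCone ℝ (Fin 2 → ℝ)) : Type := AddMonoidAlgebra ℂ (dualMonoid σ)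

/-- The restriction `ℂ[S_σ] → ℂ[S_τ]` for `τ ⊆ σ`. -/
noncomputable def coneRestrict {σ τ : PointedCone ℝ (Fin 2 → ℝ)} (h : τ ≤ σ) :
    coneAlgebra σ →+* coneAlgebra τ :=
  AddMonoidAlgebra.mapDomainRingHom ℂ (AddSubmonoid.inclusion (dualMonoid_anti h))

theorem coneRestrict_algebraMap {σ τ : PointedCone ℝ (Fin 2 → ℝ)} (h : τ ≤ σ) (c : ℂ) :
    coneRestrict h (algebraMap ℂ (coneAlgebra σ) c) = algebraMap ℂ (coneAlgebra τ) c := by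
  simp [coneRestrict]

theorem coneRestrict_injective {σ τ : PointedCone ℝ (Fin 2 → ℝ)} (h : τ ≤ σ) :
    Function.Injective (coneRestrict h) :=
  AddMonoidAlgebra.mapDomain_injective (AddSubmonoid.inclusion_injective _)

theorem pairing_neg (m : Fin 2 → ℤ) (x : Fin 2 → ℝ) : pairing (-m) x = -pairing m x := by
  simp [pairing, Fin.sum_univ_two, add_comm]

theorem pairing_nsmul (N : ℕ) (m : Fin 2 → ℤ) (x : Fin 2 → ℝ) :
    pairing (N • m) x = N * pairing m x := by
  simp [pairing, Fin.sum_univ_two]; ring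

theorem pairing_latticeToReal (m u : Fin 2 → ℤ) :
    pairing m (latticeToReal u) = ((m 0 * u 0 + m 1 * u 1 : ℤ) : ℝ) := by
  simp [pairing, latticeToReal, Fin.sum_univ_two]

theorem mem_dualMonoid_latticeCone {s : Set (Fin 2 → ℤ)} {m : Fin 2 → ℤ} :
    m ∈ dualMonoid (latticeCone s) ↔ ∀ u ∈ s, 0 ≤ pairing m (latticeToReal u) := by
  constructor
  · intro h u hu
    exact h _ (latticeToReal_mem_latticeCone hu)
  · intro h x hx
    refine Submodule.span_induction ?_ ?_ ?_ ?_ hx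
    · rintro _ ⟨u, hu, rfl⟩; exact h u hu
    · simp [pairing]
    · intro x y _ _ hx hy
      have : pairing m (x + y) = pairing m x + pairing m y := by
        simp [pairing, Fin.sum_univ_two]; ring
      rw [this]; exact add_nonneg hx hy
    · intro a x _ hx
      have : pairing m (a • x) = (a : ℝ) * pairing m x := by
        have e : ∀ i, (a • x) i = (a : ℝ) * x i := fun i => rfl
        simp only [pairing, Fin.sum_univ_two, e]; ring
      rw [this]; exact mul_nonneg a.2 hx

theorem exists_shift_mem {σ τ : PointedCone ℝ (Fin 2 → ℝ)} {s : Finset (Fin 2 → ℤ)}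
    (hσ : σ = latticeCone (s : Set (Fin 2 → ℤ))) (m : Fin 2 → ℤ) (hmσ : m ∈ dualMonoid σ)
    (hm : ∀ x, x ∈ τ ↔ x ∈ σ ∧ pairing m x = 0) (w : Fin 2 → ℤ) (hw : w ∈ dualMonoid τ) :
    ∃ N : ℕ, w + N • m ∈ dualMonoid σ := by
  refine ⟨∑ u ∈ s, (w 0 * u 0 + w 1 * u 1).natAbs, ?_⟩
  set N := ∑ u ∈ s, (w 0 * u 0 + w 1 * u 1).natAbs with hN
  rw [hσ, mem_dualMonoid_latticeCone]
  intro u hu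
  have huσ : latticeToReal u ∈ σ := hσ ▸ latticeToReal_mem_latticeCone hu
  have h1 := hmσ _ huσ
  rw [pairing_add, pairing_nsmul]
  rcases h1.eq_or_lt with h0 | h0
  · have := hw _ ((hm _).2 ⟨huσ, h0.symm⟩)
    rw [← h0]; simpa using this
  · rw [pairing_latticeToReal] at h0
    rw [pairing_latticeToReal, pairing_latticeToReal]
    have h2 : 1 ≤ m 0 * u 0 + m 1 * u 1 := by exact_mod_cast h0
    have h3 : (w 0 * u 0 + w 1 * u 1).natAbs ≤ N :=
      Finset.single_le_sum (f := fun u : Fin 2 → ℤ => (w 0 * u 0 + w 1 * u 1).natAbs)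
        (fun _ _ => Nat.zero_le _) (by simpa using hu)
    have h4 : 0 ≤ (w 0 * u 0 + w 1 * u 1) + (N : ℤ) * (m 0 * u 0 + m 1 * u 1) := by
      have : -(w 0 * u 0 + w 1 * u 1) ≤ (N : ℤ) := by omega
      nlinarith
    exact_mod_cast h4

theorem isLocalization_coneRestrict {σ τ : PointedCone ℝ (Fin 2 → ℝ)} {s : Finset (Fin 2 → ℤ)}
    (hσ : σ = latticeCone (s : Set (Fin 2 → ℤ))) (h : τ ≤ σ) (m : dualMonoid σ)
    (hm : ∀ x, x ∈ τ ↔ x ∈ σ ∧ pairing m x = 0) :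
    letI := (coneRestrict h).toAlgebra
    IsLocalization.Away (AddMonoidAlgebra.single m 1 : coneAlgebra σ) (coneAlgebra τ) := by
  let := (coneRestrict h).toAlgebra
  have halg : ∀ z, algebraMap (coneAlgebra σ) (coneAlgebra τ) z = coneRestrict h z := fun _ => rfl
  have hsingle : ∀ (w : dualMonoid σ) (c : ℂ), coneRestrict h (AddMonoidAlgebra.single w c) =
      AddMonoidAlgebra.single (AddSubmonoid.inclusion (dualMonoid_anti h) w) c :=
    fun w c => AddMonoidAlgebra.mapDomain_single
  have hpow : ∀ N : ℕ, (AddMonoidAlgebra.single m 1 : coneAlgebra σ) ^ N =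
      AddMonoidAlgebra.single (N • m) 1 := fun N => by
    rw [AddMonoidAlgebra.single_pow, one_pow]
  let m' : dualMonoid τ := AddSubmonoid.inclusion (dualMonoid_anti h) m
  have hshift : ∀ w : dualMonoid τ, ∃ N : ℕ, ∃ w' : dualMonoid σ,
      AddSubmonoid.inclusion (dualMonoid_anti h) w' = w + N • m' := by
    intro w
    obtain ⟨N, hN⟩ := exists_shift_mem hσ m.1 m.2 hm w.1 w.2
    exact ⟨N, ⟨_, hN⟩, Subtype.ext (by simp [m'])⟩
  have hunit : IsUnit (AddMonoidAlgebra.single m' 1 : coneAlgebra τ) := by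
    have hneg : -(m : Fin 2 → ℤ) ∈ dualMonoid τ := by
      intro x hx
      have := ((hm x).1 hx).2
      rw [pairing_neg, this, neg_zero]
    refine IsUnit.of_mul_eq_one (AddMonoidAlgebra.single ⟨_, hneg⟩ 1) ?_
    rw [AddMonoidAlgebra.single_mul_single, AddMonoidAlgebra.one_def, mul_one]
    congr 1
    exact Subtype.ext (by simp [m'])
  refine ⟨?_, ?_, ?_⟩
  · rintro ⟨_, N, rfl⟩
    rw [halg, map_pow, hsingle]
    exact hunit.pow N
  · intro z
    suffices hz : ∃ (N : ℕ) (y : coneAlgebra σ), z * (AddMonoidAlgebra.single m' 1) ^ N =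
        coneRestrict h y by
      obtain ⟨N, y, hy⟩ := hz
      refine ⟨⟨y, ⟨_, N, rfl⟩⟩, ?_⟩
      rw [halg, halg, map_pow, hsingle, ← hy]
    induction z using AddMonoidAlgebra.induction_linear with
    | zero => exact ⟨0, 0, by simp⟩
    | add x y hx hy =>
      obtain ⟨N, a, ha⟩ := hx
      obtain ⟨N', b, hb⟩ := hy
      refine ⟨N + N', a * AddMonoidAlgebra.single m 1 ^ N' + b * AddMonoidAlgebra.single m 1 ^ N, ?_⟩
      rw [map_add, map_mul, map_mul, map_pow, map_pow, hsingle, ← ha, ← hb]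
      change (x + y) * AddMonoidAlgebra.single m' 1 ^ (N + N') =
        x * AddMonoidAlgebra.single m' 1 ^ N * AddMonoidAlgebra.single m' 1 ^ N' +
        y * AddMonoidAlgebra.single m' 1 ^ N' * AddMonoidAlgebra.single m' 1 ^ N
      ring
    | single w c =>
      obtain ⟨N, w', hw'⟩ := hshift w
      refine ⟨N, AddMonoidAlgebra.single w' c, ?_⟩
      rw [hsingle, hw', AddMonoidAlgebra.single_pow, one_pow, AddMonoidAlgebra.single_mul_single,
        mul_one]
  · intro x y hxy
    exact ⟨1, by rw [coneRestrict_injective h hxy]⟩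

theorem Fan.isFaceOf_of_le (F : Fan) {σ τ : PointedCone ℝ (Fin 2 → ℝ)} (hσ : σ ∈ F.cones)
    (hτ : τ ∈ F.cones) (h : τ ≤ σ) : τ.IsFaceOf σ := by
  have := F.inf_isFaceOf σ hσ τ hτ
  rwa [inf_eq_right.2 h] at this

theorem Fan.exists_isLocalization (F : Fan) {τ σ : F.cones} (h : τ.1 ≤ σ.1) :
    ∃ m : dualMonoid σ.1, (∀ x, x ∈ τ.1 ↔ x ∈ σ.1 ∧ pairing m x = 0) ∧
      letI := (coneRestrict h).toAlgebra
      IsLocalization.Away (AddMonoidAlgebra.single m 1 : coneAlgebra σ.1) (coneAlgebra τ.1) := by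
  obtain ⟨s, hs⟩ := F.rational σ.1 σ.2
  obtain ⟨m, hm, hτ⟩ := exists_pairing_of_isFaceOf hs (F.salient σ.1 σ.2)
    (F.isFaceOf_of_le σ.2 τ.2 h)
  exact ⟨⟨m, hm⟩, hτ, isLocalization_coneRestrict hs h ⟨m, hm⟩ hτ⟩

/-- `U_σ = Spec ℂ[S_σ]`. -/
noncomputable abbrev affineToric (σ : PointedCone ℝ (Fin 2 → ℝ)) : Scheme.{0} :=
  Spec (CommRingCat.of (coneAlgebra σ))

/-- The diagram of the affine toric varieties `U_σ`, `σ ∈ Σ`, with the maps `U_τ → U_σ`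
for `τ ⊆ σ`. -/
noncomputable def Fan.diagram (F : Fan) : F.cones ⥤ Scheme.{0} where
  obj σ := affineToric σ
  map f := Spec.map (CommRingCat.ofHom (coneRestrict (leOfHom f)))
  map_id σ := by
    have : coneRestrict (le_refl σ.1) = RingHom.id _ := by
      refine RingHom.ext fun z => ?_
      exact congrFun (congrArg _ (AddMonoidAlgebra.mapDomainRingHom_id (R := ℂ))) z
    change Spec.map (CommRingCat.ofHom (coneRestrict (le_refl σ.1))) = _
    rw [this]
    exact Spec.map_id _
  map_comp {ρ τ σ} f g := by
    rw [← Spec.map_comp, ← CommRingCat.ofHom_comp]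
    congr 2
    unfold coneRestrict
    rw [← AddMonoidAlgebra.mapDomainRingHom_comp]
    rfl

instance (F : Fan) {σ τ : F.cones} (f : τ ⟶ σ) : IsOpenImmersion (F.diagram.map f) := by
  obtain ⟨m, hm, hτ⟩ := F.exists_isLocalization (leOfHom f)
  let := (coneRestrict (leOfHom f : τ.1 ≤ σ.1)).toAlgebra
  have := hτ
  exact IsOpenImmersion.of_isLocalization (S := coneAlgebra τ.1)
    (AddMonoidAlgebra.single m 1 : coneAlgebra σ.1)

instance (F : Fan) : (F.diagram ⋙ Scheme.forget).IsLocallyDirected := by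
  constructor
  intro τ₁ τ₂ σ f₁ f₂ x₁ x₂ hx
  obtain ⟨m₁, hm₁, h₁⟩ := F.exists_isLocalization (leOfHom f₁)
  obtain ⟨m₂, hm₂, h₂⟩ := F.exists_isLocalization (leOfHom f₂)
  have hmem : τ₁.1 ⊓ τ₂.1 ∈ F.cones :=
    F.face_mem _ τ₁.2 _ (F.inf_isFaceOf _ τ₁.2 _ τ₂.2)
  let ρ : F.cones := ⟨τ₁.1 ⊓ τ₂.1, hmem⟩
  let g₁ : ρ ⟶ τ₁ := homOfLE (inf_le_left : τ₁.1 ⊓ τ₂.1 ≤ τ₁.1)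
  let g₂ : ρ ⟶ τ₂ := homOfLE (inf_le_right : τ₁.1 ⊓ τ₂.1 ≤ τ₂.1)
  have hρσ : ρ.1 ≤ σ.1 := le_trans inf_le_left (leOfHom f₁)
  have hρ : ∀ x, x ∈ ρ.1 ↔ x ∈ σ.1 ∧ pairing ((m₁ + m₂ : dualMonoid σ.1) : Fin 2 → ℤ) x = 0 := by
    intro x
    have e : pairing ((m₁ + m₂ : dualMonoid σ.1) : Fin 2 → ℤ) x = pairing m₁ x + pairing m₂ x :=
      pairing_add _ _ _
    rw [e]
    change (x ∈ τ₁.1 ∧ x ∈ τ₂.1) ↔ _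
    rw [hm₁, hm₂]
    constructor
    · rintro ⟨⟨h, h'⟩, -, h''⟩
      exact ⟨h, by rw [h', h'', add_zero]⟩
    · rintro ⟨h, h'⟩
      have p₁ := m₁.2 x h
      have p₂ := m₂.2 x h
      exact ⟨⟨h, by linarith⟩, h, by linarith⟩
  obtain ⟨s, hs⟩ := F.rational σ.1 σ.2
  have h₃ := isLocalization_coneRestrict hs hρσ (m₁ + m₂) hρ
  have range : ∀ {τ : PointedCone ℝ (Fin 2 → ℝ)} (h : τ ≤ σ.1) (m : dualMonoid σ.1),
      (letI := (coneRestrict h).toAlgebra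
      IsLocalization.Away (AddMonoidAlgebra.single m 1 : coneAlgebra σ.1) (coneAlgebra τ)) →
      Set.range (PrimeSpectrum.comap (coneRestrict h)) =
        PrimeSpectrum.basicOpen (AddMonoidAlgebra.single m 1 : coneAlgebra σ.1) := by
    intro τ h m hloc
    let := (coneRestrict h).toAlgebra
    have := hloc
    exact PrimeSpectrum.localization_away_comap_range (coneAlgebra τ)
      (AddMonoidAlgebra.single m 1 : coneAlgebra σ.1)
  let y : PrimeSpectrum (coneAlgebra σ.1) := PrimeSpectrum.comap (coneRestrict (leOfHom f₁)) x₁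
  have hy₁ : y ∈ Set.range (PrimeSpectrum.comap (coneRestrict (leOfHom f₁))) := ⟨x₁, rfl⟩
  have hy₂ : y ∈ Set.range (PrimeSpectrum.comap (coneRestrict (leOfHom f₂))) := ⟨x₂, hx.symm⟩
  rw [range _ m₁ h₁] at hy₁
  rw [range _ m₂ h₂] at hy₂
  have hy₃ : y ∈ Set.range (PrimeSpectrum.comap (coneRestrict hρσ)) := by
    rw [range _ (m₁ + m₂) h₃]
    have e : (AddMonoidAlgebra.single (m₁ + m₂) 1 : coneAlgebra σ.1) =
        AddMonoidAlgebra.single m₁ 1 * AddMonoidAlgebra.single m₂ 1 := by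
      rw [AddMonoidAlgebra.single_mul_single, mul_one]
    rw [e, PrimeSpectrum.basicOpen_mul]
    exact ⟨hy₁, hy₂⟩
  obtain ⟨z, hz⟩ := hy₃
  refine ⟨ρ, g₁, g₂, z, ?_, ?_⟩
  · apply (F.diagram.map f₁).isOpenEmbedding.injective
    change (F.diagram.map g₁ ≫ F.diagram.map f₁) z = _
    rw [← F.diagram.map_comp]
    exact hz
  · apply (F.diagram.map f₂).isOpenEmbedding.injective
    change (F.diagram.map g₂ ≫ F.diagram.map f₂) z = _
    rw [← F.diagram.map_comp]
    exact hz.trans hx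

/-- The toric surface `X(Σ)`, glued from the affine charts `U_σ`, `σ ∈ Σ`, along common faces. -/
noncomputable def Fan.toricSurface (F : Fan) : Scheme.{0} := Limits.colimit F.diagram

/-- The structure morphism `X(Σ) → Spec ℂ`. -/
noncomputable def Fan.structureMap (F : Fan) : F.toricSurface ⟶ Spec (CommRingCat.of ℂ) :=
  Limits.colimit.desc F.diagram
    { pt := Spec (CommRingCat.of ℂ)
      ι :=
        { app := fun σ => Spec.map (CommRingCat.ofHom (algebraMap ℂ (coneAlgebra σ.1)))
          naturality := by
            intro τ σ f
            change Spec.map _ ≫ Spec.map _ = Spec.map _ ≫ 𝟙 _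
            rw [← Spec.map_comp, ← CommRingCat.ofHom_comp, Category.comp_id]
            congr 2
            exact RingHom.ext fun c => coneRestrict_algebraMap (leOfHom f) c } }

/-- `X(Σ)` is smooth (over `ℂ`). -/
def Fan.IsSmooth (F : Fan) : Prop := Smooth F.structureMap

/-- A point of `X(Σ)` is smooth if it has a smooth open neighbourhood. -/
def Fan.IsSmoothAt (F : Fan) (x : F.toricSurface) : Prop :=
  ∃ U : F.toricSurface.Opens, x ∈ U ∧ Smooth (U.ι ≫ F.structureMap)

/-- The semigroup homomorphism `S_σ → ℂ` equal to `1` on `σ^⊥` and to `0` elsewhere. -/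
noncomputable def distinguishedHom (σ : PointedCone ℝ (Fin 2 → ℝ)) :
    Multiplicative (dualMonoid σ) →* ℂ :=
  open Classical in
  { toFun := fun m => if ∀ x ∈ σ, pairing (m.toAdd : Fin 2 → ℤ) x = 0 then 1 else 0
    map_one' := by simp [pairing]
    map_mul' := by
      intro a b
      have key : (∀ x ∈ σ, pairing ((a * b).toAdd : Fin 2 → ℤ) x = 0) ↔
          (∀ x ∈ σ, pairing (a.toAdd : Fin 2 → ℤ) x = 0) ∧
            ∀ x ∈ σ, pairing (b.toAdd : Fin 2 → ℤ) x = 0 := by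
        have e : ∀ x, pairing ((a * b).toAdd : Fin 2 → ℤ) x =
            pairing (a.toAdd : Fin 2 → ℤ) x + pairing (b.toAdd : Fin 2 → ℤ) x :=
          fun x => pairing_add _ _ x
        constructor
        · intro h
          constructor <;> intro x hx <;>
            linarith [h x hx, e x, a.toAdd.2 x hx, b.toAdd.2 x hx]
        · rintro ⟨h, h'⟩ x hx
          rw [e, h x hx, h' x hx, add_zero]
      by_cases h1 : ∀ x ∈ σ, pairing (a.toAdd : Fin 2 → ℤ) x = 0 <;>
        by_cases h2 : ∀ x ∈ σ, pairing (b.toAdd : Fin 2 → ℤ) x = 0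
      · rw [if_pos (key.2 ⟨h1, h2⟩), if_pos h1, if_pos h2, one_mul]
      · rw [if_neg (fun h => h2 (key.1 h).2), if_neg h2, mul_zero]
      · rw [if_neg (fun h => h1 (key.1 h).1), if_neg h1, zero_mul]
      · rw [if_neg (fun h => h1 (key.1 h).1), if_neg h1, zero_mul] }

/-- The distinguished point of `U_σ`, the closed point of `Spec ℂ[S_σ]` given by the homomorphism
`ℂ[S_σ] → ℂ` that extends `distinguishedHom`. -/
noncomputable def distinguishedPoint (σ : PointedCone ℝ (Fin 2 → ℝ)) : affineToric σ :=
  (⟨RingHom.ker (AddMonoidAlgebra.lift ℂ ℂ (dualMonoid σ) (distinguishedHom σ)),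
    RingHom.ker_isPrime _⟩ : PrimeSpectrum (coneAlgebra σ))

/-- The distinguished point of `X(Σ)` attached to a cone `σ ∈ Σ`; for a two-dimensional `σ` it is the
torus-fixed point of the orbit-cone correspondence. -/
noncomputable def Fan.fixedPoint (F : Fan) (σ : F.cones) : F.toricSurface :=
  Limits.colimit.ι F.diagram σ (distinguishedPoint σ)

/-- The two-dimensional cone `σ` has singularity index `k = |u_ρ ∧ u_τ|`, where `u_ρ`, `u_τ` are the
minimal lattice points on its two boundary rays. -/
def HasIndex (σ : PointedCone ℝ (Fin 2 → ℝ)) (k : ℕ) : Prop :=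
  ∃ u v : Fin 2 → ℤ, IsPrimitive u ∧ IsPrimitive v ∧ wedge u v ≠ 0 ∧ σ = latticeCone {u, v} ∧
    (wedge u v).natAbs = k

/-- `X(Σ)` has a singular torus-fixed point of singularity index at least `k`. -/
def Fan.HasSingularityOfIndexAtLeast (F : Fan) (k : ℕ) : Prop :=
  ∃ σ : F.cones, ∃ n : ℕ, k ≤ n ∧ HasIndex σ.1 n ∧ ¬ F.IsSmoothAt (F.fixedPoint σ)

/-- `f ≺ g`: the quotient `f(h) / g(h)` is defined for large `h` and tends to `0`. -/
def Prec (f g : ℕ → ℝ) : Prop :=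
  (∀ᶠ h in Filter.atTop, g h ≠ 0) ∧
    Filter.Tendsto (fun h => f h / g h) Filter.atTop (nhds 0)

/-- A fan chosen with respect to `T(h, p(h))` has the property `P` with high probability, that is,
with probability tending to `1` as `h → ∞`. -/
def WithHighProbability (p : ℕ → unitInterval) (P : ℕ → Fan → Prop) : Prop :=
  Filter.Tendsto (fun h => T h (p h) {F | P h F}) Filter.atTop (nhds 1)

end RandomToric

/-! ### Smoothness of the surface, read off the affine charts. -/

namespace RandomToric
open CategoryTheory AlgebraicGeometry

/-! Let `p = 1 - q` be the probability of keeping a ray and write `∧` for the determinant.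

The geometry is local. The chart of a cone spanned by primitive `u`, `v` is an affine plane if `|u ∧
v| = 1`, and its fixed point is singular if `|u ∧ v| ≥ 2` (`smooth_coneAlgebra_pair`,
`Fan.not_isSmoothAt_fixedPoint`). In a completion, two chosen rays with `u ∧ v > 0` and no chosen
ray strictly between them span a cone (`pair_mem_of_maximal`). Singularities are thus a matter of
consecutive chosen vectors.

Extreme regimes: there are `O(h²)` rays, so below the threshold `1/h²` all of them, respectively
none, are chosen with high probability. The full fan is smooth because a cone of index at least two
has in its interior a primitive vector no longer than its generators
(`exists_isPrimitive_interior`).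

Singularities by deletion: a primitive `w` of norm at most `h/k` has neighbours `u`, `v` just inside
the norm bound with `u ∧ w = w ∧ v = 1`. Then `u + v = (u ∧ v) w`, which makes `u ∧ v` at least `k`,
and `w` is the only admissible vector strictly between them (`exists_neighbours`). Choosing `u`, `v`
and omitting `w` creates a singular point. There are of order `h²/k²` such patterns, each
overlapping boundedly many others, so Chebyshev's inequality bounds the failure probability by a
multiple of `k²/(h² p² (1 - p))` (`setBernoulli_real_not_hasSingularity_le`). This gives the
statement for general `k`.

Sparse sets: for small `p` one counts instead. If no index exceeds one, consecutive chosen vectors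
of the sector `0 < y < x ≤ h` form lattice bases (`card_filter_sector_le`). Among the `N` primitive
vectors of the sector there are at most `2N` bases, so about `Np` vectors but on average at most
`2Np²` bases are chosen, which is too few (`setBernoulli_real_not_hasSingularity_two_le`). A cut at
a small constant value of `p` combines both bounds. -/

theorem Fan.ι_structureMap (F : Fan) (σ : F.cones) :
    Limits.colimit.ι F.diagram σ ≫ F.structureMap =
      Spec.map (CommRingCat.ofHom (algebraMap ℂ (coneAlgebra σ.1))) :=
  Limits.colimit.ι_desc _ _

theorem smooth_specMap_algebraMap_iff (A : Type) [CommRing A] [Algebra ℂ A] :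
    Smooth (Spec.map (CommRingCat.ofHom (algebraMap ℂ A))) ↔ Algebra.Smooth ℂ A := by
  rw [HasRingHomProperty.Spec_iff (P := @AlgebraicGeometry.Smooth), CommRingCat.hom_ofHom, RingHom.smooth_algebraMap]

/-- Smoothness is Zariski local on the source, and the charts form an open cover of the colimit
because the gluing diagram is locally directed. -/
theorem Fan.isSmooth_of_charts (F : Fan) (h : ∀ σ ∈ F.cones, Algebra.Smooth ℂ (coneAlgebra σ)) :
    F.IsSmooth := by
  have key : ∀ σ : F.cones, Smooth (Limits.colimit.ι F.diagram σ ≫ F.structureMap) := by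
    intro σ
    rw [F.ι_structureMap]
    exact (smooth_specMap_algebraMap_iff _).2 (h σ.1 σ.2)
  have : IsZariskiLocalAtSource @AlgebraicGeometry.Smooth :=
    HasRingHomProperty.instIsZariskiLocalAtSource (P := @AlgebraicGeometry.Smooth) (Q := RingHom.Smooth)
  refine (IsZariskiLocalAtSource.iff_of_openCover (P := @AlgebraicGeometry.Smooth)
    (Scheme.IsLocallyDirected.openCover F.diagram)).2 key

theorem Fan.IsSmooth.isSmoothAt {F : Fan} (h : F.IsSmooth) (x : F.toricSurface) :
    F.IsSmoothAt x := by
  have : Smooth F.structureMap := h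
  exact ⟨⊤, trivial, inferInstance⟩

/-- The chart is open in the surface, so a smooth neighbourhood pulls back to an open subset of a
spectrum, which contains a basic open set around the point. This turns the scheme-theoretic notion
into one about algebras. -/
theorem Fan.IsSmoothAt.exists_smooth_localization {F : Fan} {σ : F.cones}
    {z : PrimeSpectrum (coneAlgebra σ.1)}
    (h : F.IsSmoothAt (Limits.colimit.ι F.diagram σ z)) :
    ∃ f : coneAlgebra σ.1, f ∉ z.asIdeal ∧ Algebra.Smooth ℂ (Localization.Away f) := by
  obtain ⟨U, hzU, hU⟩ := h
  set j : affineToric σ.1 ⟶ F.toricSurface := Limits.colimit.ι F.diagram σ with hj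
  have : IsOpenImmersion j := inferInstanceAs (IsOpenImmersion (Limits.colimit.ι F.diagram σ))
  obtain ⟨_, ⟨_, ⟨f, rfl⟩, rfl⟩, hzf, hfU⟩ := PrimeSpectrum.isBasis_basic_opens.exists_subset_of_mem_open
    (show z ∈ ((j ⁻¹ᵁ U).1 : Set (PrimeSpectrum (coneAlgebra σ.1))) from hzU) (j ⁻¹ᵁ U).2
  refine ⟨f, hzf, ?_⟩
  let i : Spec (CommRingCat.of (Localization.Away f)) ⟶ affineToric σ.1 :=
    Spec.map (CommRingCat.ofHom (algebraMap (coneAlgebra σ.1) (Localization.Away f)))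
  have hi : IsOpenImmersion i := IsOpenImmersion.of_isLocalization f
  have hrange : Set.range (i ≫ j) ⊆ Set.range U.ι := by
    rw [Scheme.Opens.range_ι]
    rintro _ ⟨y, rfl⟩
    rw [Scheme.Hom.comp_apply]
    have h1 : i y ∈ Set.range (PrimeSpectrum.comap
        (algebraMap (coneAlgebra σ.1) (Localization.Away f))) := ⟨y, rfl⟩
    rw [PrimeSpectrum.localization_away_comap_range _ f] at h1
    exact hfU h1
  -- The basic open set embeds into `U`, so its structure morphism is an open immersion followed by
  -- a smooth morphism.
  have key : IsOpenImmersion.lift U.ι (i ≫ j) hrange ≫ U.ι ≫ F.structureMap =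
      Spec.map (CommRingCat.ofHom (algebraMap ℂ (Localization.Away f))) := by
    rw [IsOpenImmersion.lift_fac_assoc, Category.assoc]
    erw [F.ι_structureMap σ]
    rw [← Spec.map_comp, ← CommRingCat.ofHom_comp, ← IsScalarTower.algebraMap_eq]
  rw [← smooth_specMap_algebraMap_iff, ← key]
  infer_instance

end RandomToric

/-! ### An obstruction to formal smoothness of monoid algebras. -/

section MonoidAlgebra

open Polynomial

/-- An explicit infinitesimal lifting problem without solution. Modulo `e²`, send the two
irreducible elements `a`, `c` to `e` and all other nonzero elements to `0`. Any lift respects `a + c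
= x + y`, but the left side gives `e²` and the right side a multiple of `e⁴ = 0`. -/
theorem AddMonoidAlgebra.not_formallySmooth_localization_away_aux {B : Type*} [CommRing B] [Algebra ℂ B] {e : B}
    (he3 : e ^ 3 = 0) (he2 : e ^ 2 ≠ 0) {M : Type*} [AddCommMonoid M]
    [DecidableEq M] {a c x y : M}
    (hzero : ∀ m n : M, m + n = 0 → m = 0)
    (ha : ∀ m n : M, m + n = a → m = 0 ∨ n = 0) (hc : ∀ m n : M, m + n = c → m = 0 ∨ n = 0)
    (ha0 : a ≠ 0) (hc0 : c ≠ 0) (hx0 : x ≠ 0) (hy0 : y ≠ 0)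
    (hxa : x ≠ a) (hxc : x ≠ c) (hya : y ≠ a) (hyc : y ≠ c) (h : a + c = x + y)
    (δ : AddMonoidAlgebra ℂ M →ₐ[ℂ] ℂ) (hδ : ∀ m, δ (single m 1) = if m = 0 then 1 else 0)
    {f : AddMonoidAlgebra ℂ M} (hf : δ f ≠ 0) :
    ¬ Algebra.FormallySmooth ℂ (Localization.Away f) := by
  intro hsm
  let I : Ideal B := Ideal.span {e ^ 2}
  have hI : IsNilpotent I := ⟨2, by
    rw [Ideal.span_singleton_pow, ← pow_mul, show e ^ (2 * 2) = e ^ 3 * e by ring, he3, zero_mul]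
    simp⟩
  let ε : B ⧸ I := Ideal.Quotient.mk _ e
  have hε : ε * ε = 0 := by
    rw [← map_mul, ← pow_two]
    exact Ideal.Quotient.eq_zero_iff_mem.2 (Ideal.mem_span_singleton_self _)
  -- For nonzero `m`, `n` both sides vanish: the left by irreducibility of `a` and `c`, the right
  -- because `ε² = 0`.
  have hmul₀ : ∀ m n : M, (if m + n = 0 then 1 else if m + n = a ∨ m + n = c then ε else 0) =
      (if m = 0 then 1 else if m = a ∨ m = c then ε else 0) *
        (if n = 0 then 1 else if n = a ∨ n = c then ε else 0) := by
    intro m n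
    by_cases hm : m = 0
    · subst hm; simp
    by_cases hn : n = 0
    · subst hn; simp
    have h1 : m + n ≠ 0 := fun h => hm (hzero _ _ h)
    have h2 : ¬ (m + n = a ∨ m + n = c) := by
      rintro (h | h)
      · rcases ha _ _ h <;> contradiction
      · rcases hc _ _ h <;> contradiction
    simp only [hm, hn, h1, h2, if_false]
    split_ifs <;> simp [hε]
  let ψ₀ : Multiplicative M →* B ⧸ I :=
    { toFun := fun m => if m.toAdd = 0 then 1 else if m.toAdd = a ∨ m.toAdd = c then ε else 0
      map_one' := by simp
      map_mul' := fun m n => hmul₀ m.toAdd n.toAdd }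
  let ψ : AddMonoidAlgebra ℂ M →ₐ[ℂ] B ⧸ I := AddMonoidAlgebra.lift ℂ _ M ψ₀
  have hψ : ∀ m, ψ (single m 1) = if m = 0 then 1 else if m = a ∨ m = c then ε else 0 := by
    intro m
    simp [ψ, ψ₀, AddMonoidAlgebra.lift_single]
  -- Up to nilpotents `ψ` is evaluation at the point `δ`. As `δ f ≠ 0`, the image of `f` is a unit
  -- and `ψ` extends to the localization.
  have hnear : ∀ z, ∃ r, ψ z = algebraMap ℂ _ (δ z) + r * ε := by
    intro z
    induction z using AddMonoidAlgebra.induction_linear with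
    | zero => exact ⟨0, by simp⟩
    | add z w hz hw =>
      obtain ⟨r, hr⟩ := hz
      obtain ⟨s, hs⟩ := hw
      exact ⟨r + s, by rw [map_add, map_add, map_add, hr, hs]; ring⟩
    | single m t =>
      have e1 : (single m t : AddMonoidAlgebra ℂ M) = t • single m 1 := by simp
      rw [e1, map_smul, map_smul, hψ, hδ]
      split_ifs
      · exact ⟨0, by simp [Algebra.smul_def]⟩
      · exact ⟨algebraMap ℂ _ t, by simp [Algebra.smul_def]⟩
      · exact ⟨0, by simp⟩
  have hunit : ∀ z : Submonoid.powers f, IsUnit (ψ z) := by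
    rintro ⟨_, N, rfl⟩
    simp only [map_pow]
    refine IsUnit.pow N ?_
    obtain ⟨r, hr⟩ := hnear f
    rw [hr]
    refine IsNilpotent.isUnit_add_left_of_commute ⟨2, ?_⟩ ?_ (Commute.all _ _)
    · rw [mul_pow, pow_two ε, hε, mul_zero]
    · exact (IsUnit.mk0 _ hf).map (algebraMap ℂ (B ⧸ I))
  obtain ⟨φ, hφ⟩ := Algebra.FormallySmooth.exists_lift I hI
    (IsLocalization.liftAlgHom (M := Submonoid.powers f) (S := Localization.Away f) (f := ψ) hunit)
  let θ : AddMonoidAlgebra ℂ M → B := fun z => φ (algebraMap _ _ z)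
  have hθ : ∀ z, (Ideal.Quotient.mk I (θ z)) = ψ z := by
    intro z
    have := DFunLike.congr_fun hφ (algebraMap _ _ z)
    simpa using this
  have hθe : ∀ m, m = a ∨ m = c → ∃ r, θ (single m 1) = e + e ^ 2 * r := by
    intro m hm
    have h1 := hθ (single m 1)
    have hm0 : m ≠ 0 := by rcases hm with rfl | rfl <;> assumption
    rw [hψ, if_neg hm0, if_pos hm, Ideal.Quotient.eq, Ideal.mem_span_singleton] at h1
    obtain ⟨r, hr⟩ := h1
    exact ⟨r, by rw [← hr]; ring⟩
  have hθ0 : ∀ m, m ≠ 0 → m ≠ a → m ≠ c → ∃ r, θ (single m 1) = e ^ 2 * r := by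
    intro m hm0 hma hmc
    have h1 := hθ (single m 1)
    rw [hψ, if_neg hm0, if_neg (by tauto), Ideal.Quotient.eq_zero_iff_mem,
      Ideal.mem_span_singleton] at h1
    exact h1
  obtain ⟨r₁, h₁⟩ := hθe a (Or.inl rfl)
  obtain ⟨r₂, h₂⟩ := hθe c (Or.inr rfl)
  obtain ⟨r₃, h₃⟩ := hθ0 x hx0 hxa hxc
  obtain ⟨r₄, h₄⟩ := hθ0 y hy0 hya hyc
  have hmul : θ (single a 1) * θ (single c 1) = θ (single x 1) * θ (single y 1) := by
    simp only [θ, ← map_mul, single_mul_single, h, mul_one]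
  rw [h₁, h₂, h₃, h₄] at hmul
  apply he2
  linear_combination hmul + (e * r₃ * r₄ - r₁ - r₂ - e * r₁ * r₂) * he3

/-- The test ring is `ℂ[X]/(X³)`, with `e` the class of `X`. -/
theorem AddMonoidAlgebra.not_formallySmooth_localization_away {M : Type*} [AddCommMonoid M]
    [DecidableEq M] {a c x y : M}
    (hzero : ∀ m n : M, m + n = 0 → m = 0)
    (ha : ∀ m n : M, m + n = a → m = 0 ∨ n = 0) (hc : ∀ m n : M, m + n = c → m = 0 ∨ n = 0)
    (ha0 : a ≠ 0) (hc0 : c ≠ 0) (hx0 : x ≠ 0) (hy0 : y ≠ 0)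
    (hxa : x ≠ a) (hxc : x ≠ c) (hya : y ≠ a) (hyc : y ≠ c) (h : a + c = x + y)
    (δ : AddMonoidAlgebra ℂ M →ₐ[ℂ] ℂ) (hδ : ∀ m, δ (single m 1) = if m = 0 then 1 else 0)
    {f : AddMonoidAlgebra ℂ M} (hf : δ f ≠ 0) :
    ¬ Algebra.FormallySmooth ℂ (Localization.Away f) := by
  intro hsm
  let e : ℂ[X] ⧸ Ideal.span {(X : ℂ[X]) ^ 3} := Ideal.Quotient.mk _ X
  have he3 : e ^ 3 = 0 := by
    rw [← map_pow]
    exact Ideal.Quotient.eq_zero_iff_mem.2 (Ideal.mem_span_singleton_self _)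
  have he2 : e ^ 2 ≠ 0 := by
    rw [← map_pow]
    intro h0
    rw [Ideal.Quotient.eq_zero_iff_mem, Ideal.mem_span_singleton] at h0
    have := natDegree_le_of_dvd h0 (pow_ne_zero 2 X_ne_zero)
    simp at this
  exact not_formallySmooth_localization_away_aux he3 he2 hzero ha hc ha0 hc0 hx0 hy0 hxa hxc hya hyc
    h δ hδ hf hsm

end MonoidAlgebra

/-! ### Charts of index one are smooth; fixed points of larger index are singular. -/

namespace RandomToric

theorem mem_dualMonoid_pair {u v m : Fin 2 → ℤ} :
    m ∈ dualMonoid (latticeCone {u, v}) ↔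
      0 ≤ m 0 * u 0 + m 1 * u 1 ∧ 0 ≤ m 0 * v 0 + m 1 * v 1 := by
  rw [mem_dualMonoid_latticeCone]
  simp only [Set.mem_insert_iff, Set.mem_singleton_iff, forall_eq_or_imp, forall_eq,
    pairing_latticeToReal]
  norm_cast

theorem eq_of_pairing_eq {u v m n : Fin 2 → ℤ} (h : wedge u v ≠ 0)
    (hu : m 0 * u 0 + m 1 * u 1 = n 0 * u 0 + n 1 * u 1)
    (hv : m 0 * v 0 + m 1 * v 1 = n 0 * v 0 + n 1 * v 1) : m = n := by
  unfold wedge at h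
  ext i
  fin_cases i
  · apply mul_left_cancel₀ h
    simp only [Fin.zero_eta]
    linear_combination (v 1) * hu - (u 1) * hv
  · apply mul_left_cancel₀ h
    simp only [Fin.mk_one]
    linear_combination (u 0) * hv - (v 0) * hu

/-- The dual monoid of a cone spanned by a lattice basis is free on the dual basis. -/
noncomputable def dualMonoidEquiv {u v : Fin 2 → ℤ} (h : wedge u v = 1) :
    dualMonoid (latticeCone {u, v}) ≃+ (Fin 2 →₀ ℕ) :=
  AddEquiv.symm
  { toFun := fun n => ⟨![n 0 * v 1 - n 1 * u 1, n 1 * u 0 - n 0 * v 0], by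
      rw [mem_dualMonoid_pair]
      unfold wedge at h
      simp only [Matrix.cons_val_zero, Matrix.cons_val_one]
      constructor
      · have : ((n 0 : ℤ) * v 1 - n 1 * u 1) * u 0 + (n 1 * u 0 - n 0 * v 0) * u 1 = n 0 := by
          linear_combination (n 0 : ℤ) * h
        rw [this]; positivity
      · have : ((n 0 : ℤ) * v 1 - n 1 * u 1) * v 0 + (n 1 * u 0 - n 0 * v 0) * v 1 = n 1 := by
          linear_combination (n 1 : ℤ) * h
        rw [this]; positivity⟩
    invFun := fun m => Finsupp.equivFunOnFinite.symm
      ![(m.1 0 * u 0 + m.1 1 * u 1).toNat, (m.1 0 * v 0 + m.1 1 * v 1).toNat]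
    left_inv := by
      intro n
      unfold wedge at h
      ext i
      fin_cases i
      · simp only [Matrix.cons_val_zero, Matrix.cons_val_one, Finsupp.equivFunOnFinite_symm_apply_apply,
          Fin.zero_eta]
        have : ((n 0 : ℤ) * v 1 - n 1 * u 1) * u 0 + (n 1 * u 0 - n 0 * v 0) * u 1 = n 0 := by
          linear_combination (n 0 : ℤ) * h
        rw [this]; simp
      · simp only [Matrix.cons_val_zero, Matrix.cons_val_one, Finsupp.equivFunOnFinite_symm_apply_apply,
          Fin.mk_one]
        have : ((n 0 : ℤ) * v 1 - n 1 * u 1) * v 0 + (n 1 * u 0 - n 0 * v 0) * v 1 = n 1 := by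
          linear_combination (n 1 : ℤ) * h
        rw [this]; simp
    right_inv := by
      rintro ⟨m, hm⟩
      obtain ⟨h1, h2⟩ := mem_dualMonoid_pair.1 hm
      apply Subtype.ext
      apply eq_of_pairing_eq (u := u) (v := v) (by rw [h]; exact one_ne_zero) <;>
      · unfold wedge at h
        simp only [Matrix.cons_val_zero, Matrix.cons_val_one,
          Finsupp.equivFunOnFinite_symm_apply_apply, Int.toNat_of_nonneg h1, Int.toNat_of_nonneg h2]
        first
        | linear_combination (m 0 * u 0 + m 1 * u 1) * h
        | linear_combination (m 0 * v 0 + m 1 * v 1) * h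
    map_add' := by
      intro m n
      apply Subtype.ext
      ext i
      fin_cases i <;> simp <;> ring }

theorem smooth_coneAlgebra_pair {u v : Fin 2 → ℤ} (h : wedge u v = 1) :
    Algebra.Smooth ℂ (coneAlgebra (latticeCone {u, v})) := by
  have : Algebra.Smooth ℂ (MvPolynomial (Fin 2) ℂ) := ⟨inferInstance, inferInstance⟩
  have e : MvPolynomial (Fin 2) ℂ ≃ₐ[ℂ] coneAlgebra (latticeCone {u, v}) :=
    AddMonoidAlgebra.domCongr ℂ ℂ (dualMonoidEquiv h).symm
  exact Algebra.Smooth.of_equiv e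

/-- The algebra of a face is the localization of a polynomial ring at a monomial, hence smooth over
it. This covers the origin and the rays. -/
theorem smooth_coneAlgebra_of_isFaceOf {u v : Fin 2 → ℤ} (h : wedge u v = 1)
    (hs : ((latticeCone {u, v} : PointedCone ℝ (Fin 2 → ℝ)) : ConvexCone ℝ (Fin 2 → ℝ)).Salient)
    {τ : PointedCone ℝ (Fin 2 → ℝ)} (hτ : τ.IsFaceOf (latticeCone {u, v})) :
    Algebra.Smooth ℂ (coneAlgebra τ) := by
  classical
  have e : latticeCone {u, v} = latticeCone (({u, v} : Finset (Fin 2 → ℤ)) : Set (Fin 2 → ℤ)) := by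
    simp
  obtain ⟨m, hm, hmτ⟩ := exists_pairing_of_isFaceOf e hs hτ
  let := (coneRestrict hτ.le).toAlgebra
  have := isLocalization_coneRestrict e hτ.le ⟨m, hm⟩ hmτ
  have := smooth_coneAlgebra_pair h
  have : Algebra.Smooth (coneAlgebra (latticeCone {u, v})) (coneAlgebra τ) :=
    Algebra.Smooth.of_isLocalization_Away
      (AddMonoidAlgebra.single ⟨m, hm⟩ 1 : coneAlgebra (latticeCone {u, v}))
  have : IsScalarTower ℂ (coneAlgebra (latticeCone {u, v})) (coneAlgebra τ) :=
    IsScalarTower.of_algebraMap_eq fun c => (coneRestrict_algebraMap hτ.le c).symm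
  exact Algebra.Smooth.comp ℂ (coneAlgebra (latticeCone {u, v})) (coneAlgebra τ)

/-- Record `m` by its pairings with `u` and `v`. With `d = u ∧ v`, the elements `(0, d)` and `(d,
0)` are irreducible, and their sum also splits as `(1, r) + (d - 1, d - r)` with `0 < r < d`. These
are the data of the lifting obstruction. -/
theorem Fan.not_isSmoothAt_fixedPoint (F : Fan) (σ : F.cones) {u v : Fin 2 → ℤ}
    (hu : IsPrimitive u) (hv : IsPrimitive v) (hd : 2 ≤ wedge u v)
    (hσ : σ.1 = latticeCone {u, v}) : ¬ F.IsSmoothAt (F.fixedPoint σ) := by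
  classical
  intro h
  obtain ⟨f, hf, hsm⟩ := Fan.IsSmoothAt.exists_smooth_localization h
  obtain ⟨σ, hσF⟩ := σ
  change σ = _ at hσ
  subst hσ
  have hd0 : wedge u v ≠ 0 := by omega
  have hmem : ∀ m : dualMonoid (latticeCone {u, v}),
      0 ≤ m.1 0 * u 0 + m.1 1 * u 1 ∧ 0 ≤ m.1 0 * v 0 + m.1 1 * v 1 :=
    fun m => mem_dualMonoid_pair.1 m.2
  obtain ⟨s, t, hst⟩ : ∃ s t, s * u 0 + t * u 1 = 1 := hu
  -- the linear forms vanishing on one of the two rays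
  have hvw : ∀ m : Fin 2 → ℤ, m 0 * v 0 + m 1 * v 1 = 0 → wedge u v ∣ m 0 * u 0 + m 1 * u 1 := by
    intro m hm
    obtain ⟨p, q, hpq⟩ : ∃ p q, p * v 0 + q * v 1 = 1 := hv
    refine ⟨m 0 * q - m 1 * p, ?_⟩
    unfold wedge
    linear_combination (p * u 0 + q * u 1) * hm - (m 0 * u 0 + m 1 * u 1) * hpq
  have huw : ∀ m : Fin 2 → ℤ, m 0 * u 0 + m 1 * u 1 = 0 → wedge u v ∣ m 0 * v 0 + m 1 * v 1 := by
    intro m hm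
    refine ⟨m 1 * s - m 0 * t, ?_⟩
    unfold wedge
    linear_combination (s * v 0 + t * v 1) * hm - (m 0 * v 0 + m 1 * v 1) * hst
  set d := wedge u v with hddef
  have hdef : d = u 0 * v 1 - u 1 * v 0 := rfl
  have hdpos : 0 < d := by omega
  -- The form `(s, t)` takes the value `1` on `u`. Subtracting `c` times the form `(-u 1, u 0)`,
  -- with values `0` on `u` and `d` on `v`, reduces its value on `v` modulo `d`.
  set r := (s * v 0 + t * v 1) % d with hr
  have hr0 : 0 ≤ r := Int.emod_nonneg _ hd0
  have hrd : r < d := Int.emod_lt_of_pos _ (by omega)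
  set c := (s * v 0 + t * v 1) / d with hcdef
  have hdiv : r + d * c = s * v 0 + t * v 1 := Int.emod_add_mul_ediv _ _
  have hmk : ∀ m : Fin 2 → ℤ, ∀ i j, m 0 * u 0 + m 1 * u 1 = i → m 0 * v 0 + m 1 * v 1 = j →
      0 ≤ i → 0 ≤ j → ∃ n : dualMonoid (latticeCone {u, v}),
        n.1 0 * u 0 + n.1 1 * u 1 = i ∧ n.1 0 * v 0 + n.1 1 * v 1 = j := by
    rintro m i j rfl rfl hi hj
    exact ⟨⟨m, mem_dualMonoid_pair.2 ⟨hi, hj⟩⟩, rfl, rfl⟩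
  obtain ⟨a, ha₁, ha₂⟩ := hmk ![-u 1, u 0] 0 d (by simp; ring) (by simp [hdef]; ring) le_rfl (by omega)
  obtain ⟨b, hb₁, hb₂⟩ := hmk ![v 1, -v 0] d 0 (by simp [hdef]; ring) (by simp; ring) (by omega) le_rfl
  have hx : (s + c * u 1) * v 0 + (t - c * u 0) * v 1 = r := by
    linear_combination - hdiv + c * hdef
  -- If `r = 0`, the form vanishes on `v`, so its value `1` on `u` is divisible by `d ≥ 2`.
  have hr1 : r ≠ 0 := by
    intro h0
    have := hvw ![s + c * u 1, t - c * u 0] (by simpa [h0] using hx)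
    simp only [Matrix.cons_val_zero, Matrix.cons_val_one] at this
    rw [show (s + c * u 1) * u 0 + (t - c * u 0) * u 1 = 1 by linear_combination hst] at this
    have := Int.le_of_dvd one_pos this
    omega
  obtain ⟨x, hx₁, hx₂⟩ := hmk ![s + c * u 1, t - c * u 0] 1 r
    (by simp only [Matrix.cons_val_zero, Matrix.cons_val_one]; linear_combination hst)
    (by simpa using hx) one_pos.le hr0
  obtain ⟨y, hy₁, hy₂⟩ := hmk ![v 1 - u 1 - (s + c * u 1), u 0 - v 0 - (t - c * u 0)] (d - 1) (d - r)
    (by simp only [Matrix.cons_val_zero, Matrix.cons_val_one]; linear_combination -hst - hdef)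
    (by simp only [Matrix.cons_val_zero, Matrix.cons_val_one]; linear_combination -hx - hdef)
    (by omega) (by omega)
  have hext : ∀ m n : dualMonoid (latticeCone {u, v}),
      m.1 0 * u 0 + m.1 1 * u 1 = n.1 0 * u 0 + n.1 1 * u 1 →
      m.1 0 * v 0 + m.1 1 * v 1 = n.1 0 * v 0 + n.1 1 * v 1 → m = n :=
    fun m n h1 h2 => Subtype.ext (eq_of_pairing_eq hd0 h1 h2)
  have hz₁ : (0 : dualMonoid (latticeCone {u, v})).1 0 * u 0 +
    (0 : dualMonoid (latticeCone {u, v})).1 1 * u 1 = 0 := by simp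
  have hz₂ : (0 : dualMonoid (latticeCone {u, v})).1 0 * v 0 +
    (0 : dualMonoid (latticeCone {u, v})).1 1 * v 1 = 0 := by simp
  have hadd₁ : ∀ m n : dualMonoid (latticeCone {u, v}), (m + n).1 0 * u 0 + (m + n).1 1 * u 1 =
      (m.1 0 * u 0 + m.1 1 * u 1) + (n.1 0 * u 0 + n.1 1 * u 1) := by
    intro m n; simp; ring
  have hadd₂ : ∀ m n : dualMonoid (latticeCone {u, v}), (m + n).1 0 * v 0 + (m + n).1 1 * v 1 =
      (m.1 0 * v 0 + m.1 1 * v 1) + (n.1 0 * v 0 + n.1 1 * v 1) := by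
    intro m n; simp; ring
  refine AddMonoidAlgebra.not_formallySmooth_localization_away (a := a) (c := b) (x := x) (y := y)
    ?_ ?_ ?_ ?_ ?_ ?_ ?_ ?_ ?_ ?_ ?_ ?_
    (AddMonoidAlgebra.lift ℂ ℂ _ (distinguishedHom (latticeCone {u, v}))) ?_ (f := f) ?_
    hsm.formallySmooth
  · intro m n hmn
    have h1 := hadd₁ m n
    have h2 := hadd₂ m n
    rw [hmn, hz₁] at h1
    rw [hmn, hz₂] at h2
    have := hmem m
    have := hmem n
    exact hext _ _ (by omega) (by omega)
  · intro m n hmn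
    have h1 := hadd₁ m n
    have h2 := hadd₂ m n
    rw [hmn, ha₁] at h1
    rw [hmn, ha₂] at h2
    have p1 := hmem m
    have p2 := hmem n
    -- Both summands vanish on `u`, being nonnegative there with sum `0`. Their values on `v` are
    -- then multiples of `d` with sum `d`, so one of them is `0`.
    obtain ⟨k, hk⟩ := huw m.1 (by omega)
    obtain ⟨l, hl⟩ := huw n.1 (by omega)
    rw [hk, hl, ← mul_add] at h2
    have h3 : k + l = 1 := mul_left_cancel₀ hd0 (by rw [mul_one]; exact h2.symm)
    have hk0 : 0 ≤ k := (mul_nonneg_iff_of_pos_left hdpos).1 (hk ▸ p1.2)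
    have hl0 : 0 ≤ l := (mul_nonneg_iff_of_pos_left hdpos).1 (hl ▸ p2.2)
    rcases (show k = 0 ∨ l = 0 by omega) with h0 | h0
    · rw [h0, mul_zero] at hk
      exact Or.inl (hext _ _ (by omega) (by omega))
    · rw [h0, mul_zero] at hl
      exact Or.inr (hext _ _ (by omega) (by omega))
  · intro m n hmn
    have h1 := hadd₁ m n
    have h2 := hadd₂ m n
    rw [hmn, hb₁] at h1
    rw [hmn, hb₂] at h2
    have p1 := hmem m
    have p2 := hmem n
    obtain ⟨k, hk⟩ := hvw m.1 (by omega)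
    obtain ⟨l, hl⟩ := hvw n.1 (by omega)
    rw [hk, hl, ← mul_add] at h1
    have h3 : k + l = 1 := mul_left_cancel₀ hd0 (by rw [mul_one]; exact h1.symm)
    have hk0 : 0 ≤ k := (mul_nonneg_iff_of_pos_left hdpos).1 (hk ▸ p1.1)
    have hl0 : 0 ≤ l := (mul_nonneg_iff_of_pos_left hdpos).1 (hl ▸ p2.1)
    rcases (show k = 0 ∨ l = 0 by omega) with h0 | h0
    · rw [h0, mul_zero] at hk
      exact Or.inl (hext _ _ (by omega) (by omega))
    · rw [h0, mul_zero] at hl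
      exact Or.inr (hext _ _ (by omega) (by omega))
  · rintro rfl; omega
  · rintro rfl; omega
  · rintro rfl; omega
  · rintro rfl; omega
  · rintro rfl; omega
  · rintro rfl; omega
  · rintro rfl; omega
  · rintro rfl; omega
  · refine hext _ _ ?_ ?_
    · rw [hadd₁, hadd₁]; omega
    · rw [hadd₂, hadd₂]; omega
  · intro m
    -- The cone spans the plane, so only the zero form vanishes on it and the distinguished point is
    -- the evaluation required by the obstruction.
    have key : (∀ x ∈ latticeCone {u, v}, pairing m.1 x = 0) ↔ m = 0 := by
      constructor
      · intro hm
        have h1 := hm _ (latticeToReal_mem_latticeCone (s := {u, v}) (u := u) (by simp))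
        have h2 := hm _ (latticeToReal_mem_latticeCone (s := {u, v}) (u := v) (by simp))
        rw [pairing_latticeToReal] at h1 h2
        norm_cast at h1 h2
        exact hext _ _ (by omega) (by omega)
      · rintro rfl x _
        simp [pairing]
    rw [AddMonoidAlgebra.lift_single, one_smul]
    simp only [distinguishedHom, MonoidHom.coe_mk, OneHom.coe_mk, toAdd_ofAdd, key]
  · exact hf

/-! ### Determinants, primitive vectors and faces of plane cones. -/

theorem latticeCone_pair_comm (u v : Fin 2 → ℤ) : latticeCone {u, v} = latticeCone {v, u} := by
  rw [Set.pair_comm]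

theorem wedge_swap (u v : Fin 2 → ℤ) : wedge v u = -wedge u v := by
  unfold wedge; ring

theorem wedge_plucker (a b c d : Fin 2 → ℤ) :
    wedge a b * wedge c d - wedge a c * wedge b d + wedge a d * wedge b c = 0 := by
  unfold wedge; ring

theorem wedge_smul_eq (u v w : Fin 2 → ℤ) (i : Fin 2) :
    wedge u v * w i = wedge w v * u i + wedge u w * v i := by
  unfold wedge
  fin_cases i <;> simp <;> ring

theorem salient_pair {u v : Fin 2 → ℤ} (h : wedge u v ≠ 0) :
    ((latticeCone {u, v} : PointedCone ℝ (Fin 2 → ℝ)) : ConvexCone ℝ (Fin 2 → ℝ)).Salient := by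
  intro x hx h0 hx'
  obtain ⟨a, b, ha, hb, rfl⟩ := mem_latticeCone_pair.1 hx
  obtain ⟨a', b', ha', hb', hab⟩ := mem_latticeCone_pair.1 hx'
  have e0 := congrFun hab 0
  have e1 := congrFun hab 1
  simp only [latticeToReal, Pi.add_apply, Pi.smul_apply, smul_eq_mul, Pi.neg_apply] at e0 e1
  have hw : ((u 0 : ℝ) * v 1 - u 1 * v 0) ≠ 0 := by exact_mod_cast h
  have h1 : a + a' = 0 := (mul_eq_zero.1 (show (a + a') * ((u 0 : ℝ) * v 1 - u 1 * v 0) = 0 by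
    linear_combination (v 1 : ℝ) * e0 - (v 0 : ℝ) * e1)).resolve_right hw
  have h2 : b + b' = 0 := (mul_eq_zero.1 (show (b + b') * ((u 0 : ℝ) * v 1 - u 1 * v 0) = 0 by
    linear_combination (u 0 : ℝ) * e1 - (u 1 : ℝ) * e0)).resolve_right hw
  apply h0
  rw [show a = 0 by linarith, show b = 0 by linarith]
  simp

theorem mem_pair_iff_wedge {u v w : Fin 2 → ℤ} (h : 0 < wedge u v) :
    latticeToReal w ∈ latticeCone {u, v} ↔ 0 ≤ wedge w v ∧ 0 ≤ wedge u w := by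
  constructor
  · intro hw
    obtain ⟨a, b, ha, hb, hab⟩ := mem_latticeCone_pair.1 hw
    have e0 := congrFun hab 0
    have e1 := congrFun hab 1
    simp only [latticeToReal, Pi.add_apply, Pi.smul_apply, smul_eq_mul] at e0 e1
    have h' : (0 : ℝ) < u 0 * v 1 - u 1 * v 0 := by exact_mod_cast h
    have h1 : (0 : ℝ) ≤ w 0 * v 1 - w 1 * v 0 := by
      have : (w 0 * v 1 - w 1 * v 0 : ℝ) = a * (u 0 * v 1 - u 1 * v 0) := by
        rw [← e0, ← e1]; ring
      rw [this]; positivity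
    have h2 : (0 : ℝ) ≤ u 0 * w 1 - u 1 * w 0 := by
      have : (u 0 * w 1 - u 1 * w 0 : ℝ) = b * (u 0 * v 1 - u 1 * v 0) := by
        rw [← e0, ← e1]; ring
      rw [this]; positivity
    exact ⟨by unfold wedge; exact_mod_cast h1, by unfold wedge; exact_mod_cast h2⟩
  · rintro ⟨h1, h2⟩
    exact mem_pair_of_smul_eq h h1 h2 (wedge_smul_eq u v w)

theorem wedge_eq_zero_of_mem_singleton {u w : Fin 2 → ℤ}
    (h : latticeToReal w ∈ latticeCone {u}) : wedge u w = 0 := by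
  obtain ⟨a, -, hab⟩ := mem_latticeCone_singleton.1 h
  have e0 := congrFun hab 0
  have e1 := congrFun hab 1
  simp only [latticeToReal, Pi.smul_apply, smul_eq_mul] at e0 e1
  have : (u 0 * w 1 - u 1 * w 0 : ℝ) = 0 := by rw [← e0, ← e1]; ring
  unfold wedge
  exact_mod_cast this

theorem IsPrimitive.eq_smul_of_wedge {u w : Fin 2 → ℤ} (hu : IsPrimitive u) (h : wedge u w = 0) :
    ∃ k : ℤ, ∀ i, w i = k * u i := by
  obtain ⟨s, t, hst⟩ : ∃ s t, s * u 0 + t * u 1 = 1 := hu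
  unfold wedge at h
  refine ⟨s * w 0 + t * w 1, fun i => ?_⟩
  fin_cases i
  · simp only [Fin.zero_eta]
    linear_combination - w 0 * hst - t * h
  · simp only [Fin.mk_one]
    linear_combination - w 1 * hst + s * h

theorem IsPrimitive.eq_or_eq_neg {u w : Fin 2 → ℤ} (hu : IsPrimitive u) (hw : IsPrimitive w)
    (h : wedge u w = 0) : w = u ∨ w = -u := by
  obtain ⟨k, hk⟩ := hu.eq_smul_of_wedge h
  obtain ⟨s, t, hst⟩ : ∃ s t, s * w 0 + t * w 1 = 1 := hw
  rw [hk 0, hk 1] at hst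
  have hk1 : k ∣ 1 := ⟨s * u 0 + t * u 1, by linear_combination -hst⟩
  rcases Int.isUnit_iff.1 (isUnit_of_dvd_one hk1) with rfl | rfl
  · left; ext i; rw [hk i]; ring
  · right; ext i; rw [hk i]; simp

theorem IsPrimitive.latticeCone_injective {u w : Fin 2 → ℤ} (hu : IsPrimitive u)
    (hw : IsPrimitive w) (h : latticeCone {u} = latticeCone {w}) : u = w := by
  have hmem : latticeToReal w ∈ latticeCone {u} := h ▸ latticeToReal_mem_latticeCone rfl
  rcases hu.eq_or_eq_neg hw (wedge_eq_zero_of_mem_singleton hmem) with h | rfl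
  · exact h.symm
  · have h0 := salient_eq_zero (salient_ray hu.ne_zero) (latticeToReal_mem_latticeCone rfl) (by
      have e : latticeToReal (-u) = -latticeToReal u := by ext i; simp [latticeToReal]
      rwa [e] at hmem)
    exact absurd (latticeToReal_eq_zero.1 h0) hu.ne_zero

theorem IsPrimitive.exists_wedge_eq_one {u : Fin 2 → ℤ} (hu : IsPrimitive u) :
    ∃ w, wedge u w = 1 := by
  obtain ⟨s, t, hst⟩ : ∃ s t, s * u 0 + t * u 1 = 1 := hu
  exact ⟨![-t, s], by simp [wedge]; linear_combination hst⟩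

theorem isPrimitive_of_wedge_eq_one {u w : Fin 2 → ℤ} (h : wedge u w = 1) : IsPrimitive u :=
  ⟨w 1, -w 0, by unfold wedge at h; linear_combination h⟩

theorem isPrimitive_of_wedge_eq_one' {u w : Fin 2 → ℤ} (h : wedge u w = 1) : IsPrimitive w :=
  ⟨-u 1, u 0, by unfold wedge at h; linear_combination h⟩

theorem not_isLatticeRay_pair {u v : Fin 2 → ℤ} (h : wedge u v ≠ 0) :
    ¬ IsLatticeRay (latticeCone {u, v}) := by
  rintro ⟨w, hw, hwe⟩
  have h1 : latticeToReal u ∈ latticeCone {w} := hwe ▸ latticeToReal_mem_latticeCone (by simp)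
  have h2 : latticeToReal v ∈ latticeCone {w} := hwe ▸ latticeToReal_mem_latticeCone (by simp)
  obtain ⟨k, hk⟩ := hw.eq_smul_of_wedge (wedge_eq_zero_of_mem_singleton h1)
  obtain ⟨l, hl⟩ := hw.eq_smul_of_wedge (wedge_eq_zero_of_mem_singleton h2)
  apply h
  unfold wedge
  rw [hk, hk, hl, hl]; ring

theorem isFaceOf_pair_right {u v : Fin 2 → ℤ} (h : wedge u v ≠ 0) :
    (latticeCone {v}).IsFaceOf (latticeCone {u, v}) := by
  rw [latticeCone_pair_comm]
  exact isFaceOf_pair (by rw [wedge_swap]; exact neg_ne_zero.2 h)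

/-- A subcone containing a positive multiple of `u` and a point off the ray of `u` would contain
their sum, which has two positive coefficients. So a subcone that avoids such points lies in one of
the two boundary rays. -/
theorem eq_of_le_pair {u v : Fin 2 → ℤ} {τ : PointedCone ℝ (Fin 2 → ℝ)}
    (hle : τ ≤ latticeCone {u, v})
    (h : ∀ a b : ℝ, 0 ≤ a → 0 ≤ b → a • latticeToReal u + b • latticeToReal v ∈ τ → a = 0 ∨ b = 0) :
    τ = ⊥ ∨ τ = latticeCone {u} ∨ τ = latticeCone {v} := by
  by_cases hex : ∃ a : ℝ, 0 < a ∧ a • latticeToReal u ∈ τ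
  · obtain ⟨a, ha, haτ⟩ := hex
    have : τ ≤ latticeCone {u} := by
      intro z hz
      obtain ⟨c, d, hc, hd, rfl⟩ := mem_latticeCone_pair.1 (hle hz)
      have h1 := add_mem haτ hz
      rw [← add_assoc, ← add_smul] at h1
      have h2 : d = 0 := (h _ _ (by positivity) hd h1).resolve_left (by positivity)
      rw [h2, zero_smul, add_zero]
      exact mem_latticeCone_singleton.2 ⟨c, hc, rfl⟩
    rcases eq_bot_or_eq_of_isFaceOf_ray this with h | h <;> simp [h]
  · have : τ ≤ latticeCone {v} := by
      intro z hz
      obtain ⟨c, d, hc, hd, rfl⟩ := mem_latticeCone_pair.1 (hle hz)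
      have hc0 : c = 0 := by
        rcases h c d hc hd hz with h0 | h0
        · exact h0
        · by_contra hne
          exact hex ⟨c, lt_of_le_of_ne hc (Ne.symm hne), by simpa [h0] using hz⟩
      rw [hc0, zero_smul, zero_add]
      exact mem_latticeCone_singleton.2 ⟨d, hd, rfl⟩
    rcases eq_bot_or_eq_of_isFaceOf_ray this with h | h <;> simp [h]

/-- A face containing a positive combination of `u` and `v` contains both generators; otherwise it
lies on the boundary. -/
theorem eq_of_isFaceOf_pair {u v : Fin 2 → ℤ} {τ : PointedCone ℝ (Fin 2 → ℝ)}
    (hτ : τ.IsFaceOf (latticeCone {u, v})) :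
    τ = ⊥ ∨ τ = latticeCone {u} ∨ τ = latticeCone {v} ∨ τ = latticeCone {u, v} := by
  have hu : latticeToReal u ∈ latticeCone {u, v} := latticeToReal_mem_latticeCone (by simp)
  have hv : latticeToReal v ∈ latticeCone {u, v} := latticeToReal_mem_latticeCone (by simp)
  by_cases h : ∀ a b : ℝ, 0 ≤ a → 0 ≤ b →
      a • latticeToReal u + b • latticeToReal v ∈ τ → a = 0 ∨ b = 0
  · rcases eq_of_le_pair hτ.le h with h | h | h <;> simp [h]
  · push Not at h
    obtain ⟨a, b, ha, hb, hab, ha0, hb0⟩ := h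
    have ha' := lt_of_le_of_ne ha (Ne.symm ha0)
    have hb' := lt_of_le_of_ne hb (Ne.symm hb0)
    refine Or.inr (Or.inr (Or.inr (le_antisymm hτ.le (latticeCone_le ?_))))
    rintro _ (rfl | rfl)
    · exact hτ.mem_of_smul_add_smul_mem_left hu hv ha' hb' hab
    · exact hτ.mem_of_smul_add_smul_mem_right hu hv ha' hb' hab

/-! ### Cones of a fan, adjacent rays and maximal fans. -/

theorem latticeCone_pair_eq_sup (u v : Fin 2 → ℤ) :
    latticeCone {u, v} = latticeCone {u} ⊔ latticeCone {v} := by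
  unfold latticeCone
  rw [Set.image_pair, PointedCone.hull, Submodule.span_insert]
  simp [PointedCone.hull]

/-- A cone of a fan is the origin, a ray, or spanned by a positively oriented pair of primitive
vectors. -/
theorem Fan.cone_cases (F : Fan) {σ : PointedCone ℝ (Fin 2 → ℝ)} (hσ : σ ∈ F.cones) :
    σ = ⊥ ∨ (∃ u, IsPrimitive u ∧ σ = latticeCone {u}) ∨
      ∃ u v, IsPrimitive u ∧ IsPrimitive v ∧ 0 < wedge u v ∧ σ = latticeCone {u, v} := by
  obtain ⟨s, hs⟩ := F.rational σ hσ
  obtain ⟨u, v, huv, hd⟩ := exists_pair s (hs ▸ F.salient σ hσ)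
  rw [huv] at hs
  rcases hd with rfl | hd
  · rw [Set.pair_eq_singleton] at hs
    by_cases h0 : v = 0
    · left
      rw [hs, h0, eq_bot_iff]
      refine latticeCone_le ?_
      rintro _ rfl
      simpa using latticeToReal_eq_zero.2 rfl
    · exact Or.inr (Or.inl (hs ▸ isLatticeRay_latticeCone h0))
  · have hu0 : u ≠ 0 := by rintro rfl; simp [wedge] at hd
    have hv0 : v ≠ 0 := by rintro rfl; simp [wedge] at hd
    -- Replace the generators by the primitive vectors on their rays; the sign of the determinant
    -- then decides their order.
    obtain ⟨u', hu', hue⟩ := isLatticeRay_latticeCone hu0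
    obtain ⟨v', hv', hve⟩ := isLatticeRay_latticeCone hv0
    have hσ' : σ = latticeCone {u', v'} := by
      rw [hs, latticeCone_pair_eq_sup, latticeCone_pair_eq_sup, hue, hve]
    have h1 : latticeToReal u' ∈ latticeCone {u, v} := by
      rw [← hs, hσ']; exact latticeToReal_mem_latticeCone (by simp)
    have hne : wedge u' v' ≠ 0 := by
      intro h0
      have hmu : latticeToReal u ∈ latticeCone {u'} := by
        rw [← hue]; exact latticeToReal_mem_latticeCone rfl
      have hmv : latticeToReal v ∈ latticeCone {v'} := by
        rw [← hve]; exact latticeToReal_mem_latticeCone rfl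
      obtain ⟨k, hk⟩ := hu'.eq_smul_of_wedge (wedge_eq_zero_of_mem_singleton hmu)
      obtain ⟨l, hl⟩ := hv'.eq_smul_of_wedge (wedge_eq_zero_of_mem_singleton hmv)
      have : wedge u v = k * l * wedge u' v' := by
        unfold wedge; rw [hk, hk, hl, hl]; ring
      rw [h0, mul_zero] at this
      omega
    rcases lt_or_gt_of_ne hne with h | h
    · exact Or.inr (Or.inr ⟨v', u', hv', hu', by rw [wedge_swap]; omega,
        by rw [hσ', latticeCone_pair_comm]⟩)
    · exact Or.inr (Or.inr ⟨u', v', hu', hv', h, hσ'⟩)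

/-- The origin and every ray are faces of cones spanned by lattice bases, so only the
two-dimensional cones can obstruct smoothness. -/
theorem Fan.isSmooth_of_wedge (F : Fan)
    (h : ∀ u v, IsPrimitive u → IsPrimitive v → 0 < wedge u v → latticeCone {u, v} ∈ F.cones →
      wedge u v = 1) : F.IsSmooth := by
  apply F.isSmooth_of_charts
  intro σ hσ
  rcases F.cone_cases hσ with rfl | ⟨u, hu, rfl⟩ | ⟨u, v, hu, hv, hd, rfl⟩
  · have h1 : wedge ![1, 0] ![0, 1] = 1 := by simp [wedge]
    have hs := salient_pair (by rw [h1]; exact one_ne_zero)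
    exact smooth_coneAlgebra_of_isFaceOf h1 hs (bot_isFaceOf hs)
  · obtain ⟨w, hw⟩ := hu.exists_wedge_eq_one
    exact smooth_coneAlgebra_of_isFaceOf hw (salient_pair (by rw [hw]; exact one_ne_zero))
      (isFaceOf_pair (by rw [hw]; exact one_ne_zero))
  · exact smooth_coneAlgebra_pair (h u v hu hv hd hσ)

theorem Fan.ray_left_mem (F : Fan) {u v : Fin 2 → ℤ} (hd : wedge u v ≠ 0)
    (h : latticeCone {u, v} ∈ F.cones) : latticeCone {u} ∈ F.cones :=
  F.face_mem _ h _ (isFaceOf_pair hd)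

theorem Fan.ray_right_mem (F : Fan) {u v : Fin 2 → ℤ} (hd : wedge u v ≠ 0)
    (h : latticeCone {u, v} ∈ F.cones) : latticeCone {v} ∈ F.cones :=
  F.face_mem _ h _ (isFaceOf_pair_right hd)

/-- No ray of a fan meets the interior of one of its two-dimensional cones. -/
theorem Fan.wedge_eq_zero_of_ray_mem (F : Fan) {u v w : Fin 2 → ℤ} (hd : 0 < wedge u v)
    (h : latticeCone {u, v} ∈ F.cones) (hw : latticeCone {w} ∈ F.cones)
    (hwu : 0 ≤ wedge u w) (hwv : 0 ≤ wedge w v) : wedge u w = 0 ∨ wedge w v = 0 := by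
  by_contra hcon
  push Not at hcon
  have hwu' : 0 < wedge u w := lt_of_le_of_ne hwu hcon.1.symm
  have hwv' : 0 < wedge w v := lt_of_le_of_ne hwv hcon.2.symm
  have hle : latticeCone {w} ≤ latticeCone {u, v} := by
    refine latticeCone_le ?_
    rintro _ rfl
    exact (mem_pair_iff_wedge hd).2 ⟨hwv, hwu⟩
  have hface := F.isFaceOf_of_le h hw hle
  have hu : latticeToReal u ∈ latticeCone {u, v} := latticeToReal_mem_latticeCone (by simp)
  have hv : latticeToReal v ∈ latticeCone {u, v} := latticeToReal_mem_latticeCone (by simp)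
  -- By Cramer's rule a positive combination of `u` and `v` equals `(u ∧ v) w`. The ray of `w` is a
  -- face, so it would contain `u` itself.
  have hmem : (wedge w v : ℝ) • latticeToReal u + (wedge u w : ℝ) • latticeToReal v ∈
      latticeCone {w} := by
    refine mem_latticeCone_singleton.2 ⟨wedge u v, by exact_mod_cast hd.le, ?_⟩
    ext i
    simp only [Pi.smul_apply, Pi.add_apply, smul_eq_mul, latticeToReal]
    exact_mod_cast wedge_smul_eq u v w i
  have := hface.mem_of_smul_add_smul_mem_left hu hv (by exact_mod_cast hwv')
    (by exact_mod_cast hwu') hmem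
  have h0 := wedge_eq_zero_of_mem_singleton this
  rw [wedge_swap] at h0
  omega

/-- If the rays spanned by `u` and `v` lie in a fan and no ray of the fan lies strictly between them,
then a cone of the fan meeting the interior of the cone spanned by `u` and `v` is that cone. -/
theorem Fan.eq_pair_of_mem_interior (F : Fan) {u v : Fin 2 → ℤ}
    (huF : latticeCone {u} ∈ F.cones) (hvF : latticeCone {v} ∈ F.cones) (hd : 0 < wedge u v)
    (hint : ∀ w, IsPrimitive w → latticeCone {w} ∈ F.cones → ¬ (0 < wedge u w ∧ 0 < wedge w v))
    {τ : PointedCone ℝ (Fin 2 → ℝ)} (hτ : τ ∈ F.cones) {a b : ℝ} (ha : 0 < a) (hb : 0 < b)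
    (hz : a • latticeToReal u + b • latticeToReal v ∈ τ) : τ = latticeCone {u, v} := by
  have hd' : (0 : ℝ) < u 0 * v 1 - u 1 * v 0 := by exact_mod_cast hd
  rcases F.cone_cases hτ with rfl | ⟨w, hw, rfl⟩ | ⟨x, y, hx, hy, hxy, rfl⟩
  · have h0 : a • latticeToReal u + b • latticeToReal v = 0 := by simpa using hz
    have e0 := congrFun h0 0
    have e1 := congrFun h0 1
    simp only [latticeToReal, Pi.add_apply, Pi.smul_apply, smul_eq_mul, Pi.zero_apply] at e0 e1
    have : a * (u 0 * v 1 - u 1 * v 0) = 0 := by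
      linear_combination (v 1 : ℝ) * e0 - (v 0 : ℝ) * e1
    exact absurd this (by positivity)
  · exfalso
    obtain ⟨c, hc, h0⟩ := mem_latticeCone_singleton.1 hz
    have e0 := congrFun h0 0
    have e1 := congrFun h0 1
    simp only [latticeToReal, Pi.add_apply, Pi.smul_apply, smul_eq_mul] at e0 e1
    have h1 : c * (u 0 * w 1 - u 1 * w 0) = b * (u 0 * v 1 - u 1 * v 0) := by
      linear_combination (u 0 : ℝ) * e1 - (u 1 : ℝ) * e0
    have h2 : c * (w 0 * v 1 - w 1 * v 0) = a * (u 0 * v 1 - u 1 * v 0) := by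
      linear_combination (v 1 : ℝ) * e0 - (v 0 : ℝ) * e1
    have p1 : 0 < c * (u 0 * w 1 - u 1 * w 0 : ℝ) := by rw [h1]; positivity
    have p2 : 0 < c * (w 0 * v 1 - w 1 * v 0 : ℝ) := by rw [h2]; positivity
    exact hint w hw hτ ⟨by unfold wedge; exact_mod_cast pos_of_mul_pos_right p1 hc,
      by unfold wedge; exact_mod_cast pos_of_mul_pos_right p2 hc⟩
  · have hxF := F.ray_left_mem hxy.ne' hτ
    have hyF := F.ray_right_mem hxy.ne' hτ
    obtain ⟨α, β, hα, hβ, h0⟩ := mem_latticeCone_pair.1 hz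
    have e0 := congrFun h0 0
    have e1 := congrFun h0 1
    simp only [latticeToReal, Pi.add_apply, Pi.smul_apply, smul_eq_mul] at e0 e1
    -- all wedge products in terms of real numbers
    have cast : ∀ p q : Fin 2 → ℤ, ((wedge p q : ℤ) : ℝ) = p 0 * q 1 - p 1 * q 0 := by
      intro p q; unfold wedge; push_cast; ring
    have huz : α * wedge u x + β * wedge u y = b * wedge u v := by
      simp only [cast]; linear_combination (u 0 : ℝ) * e1 - (u 1 : ℝ) * e0
    have hzv : α * wedge x v + β * wedge y v = a * wedge u v := by
      simp only [cast]; linear_combination (v 1 : ℝ) * e0 - (v 0 : ℝ) * e1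
    have hxz : a * wedge x u + b * wedge x v = β * wedge x y := by
      simp only [cast]; linear_combination -(x 0 : ℝ) * e1 + (x 1 : ℝ) * e0
    have hzy : a * wedge u y + b * wedge v y = α * wedge x y := by
      simp only [cast]; linear_combination -(y 1 : ℝ) * e0 + (y 0 : ℝ) * e1
    have hdR : (0 : ℝ) < wedge u v := by exact_mod_cast hd
    have hxyR : (0 : ℝ) < wedge x y := by exact_mod_cast hxy
    -- If a coefficient vanished, the interior point would lie on the ray of `x` or `y`, and that
    -- ray would run strictly between `u` and `v`.
    have hα0 : 0 < α := by
      refine lt_of_le_of_ne hα fun h => hint y hy hyF ?_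
      rw [← h, zero_mul, zero_add] at huz hzv
      have p1 : 0 < β * (wedge u y : ℝ) := by rw [huz]; positivity
      have p2 : 0 < β * (wedge y v : ℝ) := by rw [hzv]; positivity
      exact ⟨by exact_mod_cast pos_of_mul_pos_right p1 hβ,
        by exact_mod_cast pos_of_mul_pos_right p2 hβ⟩
    have hβ0 : 0 < β := by
      refine lt_of_le_of_ne hβ fun h => hint x hx hxF ?_
      rw [← h, zero_mul, add_zero] at huz hzv
      have p1 : 0 < α * (wedge u x : ℝ) := by rw [huz]; positivity
      have p2 : 0 < α * (wedge x v : ℝ) := by rw [hzv]; positivity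
      exact ⟨by exact_mod_cast pos_of_mul_pos_right p1 hα,
        by exact_mod_cast pos_of_mul_pos_right p2 hα⟩
    have hux : (wedge u x : ℝ) = - wedge x u := by rw [wedge_swap u x]; push_cast; ring
    have hvx : (wedge x v : ℝ) = - wedge v x := by rw [wedge_swap x v]; push_cast; ring
    have hvy : (wedge y v : ℝ) = - wedge v y := by rw [wedge_swap y v]; push_cast; ring
    have hX := hint x hx hxF
    have hY := hint y hy hyF
    have hPl : (wedge x y : ℝ) * wedge u v - wedge x u * wedge y v + wedge x v * wedge y u = 0 := by
      exact_mod_cast wedge_plucker x y u v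
    have hyu : (wedge y u : ℝ) = - wedge u y := by rw [wedge_swap u y]; push_cast; ring
    -- If `x` were past `u`, it would also be past `v`, since no ray lies between. Then `x ∧ z ≥ 0`
    -- fails at the common point `z = a u + b v`. The same argument for `y` puts `u` and `v` inside
    -- the cone of `x` and `y`.
    have hux0 : 0 ≤ wedge x u := by
      by_contra hcon
      have h1 : (wedge x u : ℝ) < 0 := by exact_mod_cast not_le.1 hcon
      have h2 : (wedge x v : ℝ) ≤ 0 := by
        have : ¬ 0 < wedge x v := fun h => hX ⟨by rw [wedge_swap]; omega, h⟩
        exact_mod_cast not_lt.1 this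
      have : 0 < β * (wedge x y : ℝ) := by positivity
      nlinarith
    have hvy0 : 0 ≤ wedge v y := by
      by_contra hcon
      have h1 : (wedge v y : ℝ) < 0 := by exact_mod_cast not_le.1 hcon
      have h2 : (wedge u y : ℝ) ≤ 0 := by
        have : ¬ 0 < wedge u y := fun h => hY ⟨h, by rw [wedge_swap]; omega⟩
        exact_mod_cast not_lt.1 this
      have : 0 < α * (wedge x y : ℝ) := by positivity
      nlinarith
    have hux0' : (0 : ℝ) ≤ wedge x u := by exact_mod_cast hux0
    have hvy0' : (0 : ℝ) ≤ wedge v y := by exact_mod_cast hvy0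
    have huy0 : 0 ≤ wedge u y := by
      by_contra hcon
      have h1 : (wedge u y : ℝ) < 0 := by exact_mod_cast not_le.1 hcon
      have : 0 < b * (wedge u v : ℝ) := by positivity
      nlinarith
    have hxv0 : 0 ≤ wedge x v := by
      by_contra hcon
      have h1 : (wedge x v : ℝ) < 0 := by exact_mod_cast not_le.1 hcon
      have : 0 < a * (wedge u v : ℝ) := by positivity
      nlinarith
    -- The rays of `u` and `v` cannot be interior to `τ`, so they are boundary rays. The Plücker
    -- relation `(x ∧ v)(u ∧ y) = (x ∧ y)(u ∧ v) + (x ∧ u)(v ∧ y) > 0` tells which one belongs to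
    -- which.
    have hu' := F.wedge_eq_zero_of_ray_mem hxy hτ huF hux0 huy0
    have hv' := F.wedge_eq_zero_of_ray_mem hxy hτ hvF hxv0 hvy0
    have hPlZ := wedge_plucker x y u v
    rw [wedge_swap v y, wedge_swap u y] at hPlZ
    have hpos : 0 < wedge x y * wedge u v := mul_pos hxy hd
    have hxu : wedge x u = 0 := by
      rcases hu' with h | h
      · exact h
      · rw [h] at hPlZ
        nlinarith [mul_nonneg hux0 hvy0]
    have hvy' : wedge v y = 0 := by
      rcases hv' with h | h
      · rw [hxu, h] at hPlZ
        simp at hPlZ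
        rcases hPlZ with h | h <;> omega
      · exact h
    have huyp : 0 < wedge u y := by
      refine lt_of_le_of_ne huy0 fun h => ?_
      rw [hxu, ← h] at hPlZ
      simp at hPlZ
      rcases hPlZ with h | h <;> omega
    have hxvp : 0 < wedge x v := by
      refine lt_of_le_of_ne hxv0 fun h => ?_
      rw [hxu, ← h] at hPlZ
      simp at hPlZ
      rcases hPlZ with h | h <;> omega
    have hux' : wedge u x = 0 := by rw [wedge_swap, hxu, neg_zero]
    have hyv' : wedge y v = 0 := by rw [wedge_swap, hvy', neg_zero]
    apply le_antisymm
    · refine latticeCone_le ?_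
      intro w hw
      rcases hw with rfl | rfl
      · exact (mem_pair_iff_wedge hd).2 ⟨hxv0, hux'.ge⟩
      · exact (mem_pair_iff_wedge hd).2 ⟨hyv'.ge, huy0⟩
    · refine latticeCone_le ?_
      rintro _ (rfl | rfl)
      · exact (mem_pair_iff_wedge hxy).2 ⟨huy0, hux0⟩
      · exact (mem_pair_iff_wedge hxy).2 ⟨hvy0, hxv0⟩


/-- Adding to a fan the cone between two adjacent rays. -/
def Fan.insertPair (F : Fan) {u v : Fin 2 → ℤ}
    (huF : latticeCone {u} ∈ F.cones) (hvF : latticeCone {v} ∈ F.cones) (hd : 0 < wedge u v)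
    (hint : ∀ w, IsPrimitive w → latticeCone {w} ∈ F.cones → ¬ (0 < wedge u w ∧ 0 < wedge w v)) :
    Fan :=
  have bot_mem : ⊥ ∈ F.cones := F.face_mem _ huF _ (bot_isFaceOf (F.salient _ huF))
  have key : ∀ τ ∈ F.cones, (latticeCone {u, v} ⊓ τ).IsFaceOf (latticeCone {u, v}) ∧
      (latticeCone {u, v} ⊓ τ).IsFaceOf τ := by
    intro τ hτ
    by_cases h : ∀ a b : ℝ, 0 ≤ a → 0 ≤ b →
        a • latticeToReal u + b • latticeToReal v ∈ latticeCone {u, v} ⊓ τ → a = 0 ∨ b = 0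
    · rcases eq_of_le_pair inf_le_left h with h | h | h <;> rw [h]
      · exact ⟨bot_isFaceOf (salient_pair hd.ne'), bot_isFaceOf (F.salient _ hτ)⟩
      · exact ⟨isFaceOf_pair hd.ne', F.isFaceOf_of_le hτ huF (h ▸ inf_le_right)⟩
      · exact ⟨isFaceOf_pair_right hd.ne', F.isFaceOf_of_le hτ hvF (h ▸ inf_le_right)⟩
    -- A member meeting the interior of the new cone is the new cone itself, so nothing remains to
    -- be checked.
    · push Not at h
      obtain ⟨a, b, ha, hb, hab, ha0, hb0⟩ := h
      rw [F.eq_pair_of_mem_interior huF hvF hd hint hτ (lt_of_le_of_ne ha ha0.symm)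
        (lt_of_le_of_ne hb hb0.symm) hab.2, inf_idem]
      exact ⟨.refl _, .refl _⟩
  { cones := insert (latticeCone {u, v}) F.cones
    finite := F.finite.insert _
    nonempty := ⟨_, Set.mem_insert _ _⟩
    rational := by
      rintro σ (rfl | hσ)
      · exact ⟨{u, v}, by simp⟩
      · exact F.rational σ hσ
    salient := by
      rintro σ (rfl | hσ)
      · exact salient_pair hd.ne'
      · exact F.salient σ hσ
    face_mem := by
      rintro σ (rfl | hσ) τ hτ
      · rcases eq_of_isFaceOf_pair hτ with rfl | rfl | rfl | rfl
        · exact Or.inr bot_mem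
        · exact Or.inr huF
        · exact Or.inr hvF
        · exact Or.inl rfl
      · exact Or.inr (F.face_mem σ hσ τ hτ)
    inf_isFaceOf := by
      rintro σ (rfl | hσ) τ (rfl | hτ)
      · rw [inf_idem]
      · exact (key τ hτ).1
      · rw [inf_comm]; exact (key σ hσ).2
      · exact F.inf_isFaceOf σ hσ τ hτ }

/-- Inserting the cone leaves the set of rays unchanged, so maximality forces it to be present
already. -/
theorem pair_mem_of_maximal {S : Set (PointedCone ℝ (Fin 2 → ℝ))} {F : Fan}
    (hF : Maximal (fun F : Fan => F.rays = S) F) {u v : Fin 2 → ℤ}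
    (huS : latticeCone {u} ∈ S) (hvS : latticeCone {v} ∈ S)
    (hd : 0 < wedge u v)
    (hint : ∀ w, IsPrimitive w → latticeCone {w} ∈ S → ¬ (0 < wedge u w ∧ 0 < wedge w v)) :
    latticeCone {u, v} ∈ F.cones := by
  have hS : F.rays = S := hF.1
  subst hS
  let F' := F.insertPair huS.1 hvS.1 hd fun w hw hwF => hint w hw ⟨hwF, w, hw, rfl⟩
  have hF' : F'.rays = F.rays := by
    ext ρ
    constructor
    · rintro ⟨rfl | hρ, h⟩
      · exact absurd h (not_isLatticeRay_pair hd.ne')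
      · exact ⟨hρ, h⟩
    · rintro ⟨hρ, h⟩
      exact ⟨Or.inr hρ, h⟩
  have hle : F ≤ F' := Set.subset_insert _ _
  exact hF.2 hF' hle (Set.mem_insert _ _)

/-! ### The empty fan, the full fan, and singular points of completions. -/

theorem cones_eq_singleton_of_rays_eq_empty {F : Fan} (h : F.rays = ∅) : F.cones = {⊥} := by
  have : ∀ σ ∈ F.cones, σ = ⊥ := by
    intro σ hσ
    rw [F.cone_eq_sSup hσ, h]
    simp
  obtain ⟨σ, hσ⟩ := F.nonempty
  refine Set.eq_singleton_iff_unique_mem.2 ⟨?_, this⟩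
  rw [← this σ hσ]
  exact hσ

theorem isSmooth_of_cones_eq_singleton {F : Fan} (h : F.cones = {⊥}) : F.IsSmooth := by
  apply F.isSmooth_of_wedge
  intro u v _ _ hd hF
  rw [h] at hF
  have h1 : latticeToReal u ∈ latticeCone {u, v} := latticeToReal_mem_latticeCone (by simp)
  rw [Set.mem_singleton_iff.1 hF] at h1
  have : u = 0 := latticeToReal_eq_zero.1 (by simpa using h1)
  subst this
  simp [wedge] at hd

/-- A cone of index at least two contains in its interior a primitive vector that is no longer than
its generators. -/
theorem exists_isPrimitive_interior {u v : Fin 2 → ℤ} (hu : IsPrimitive u) (hv : IsPrimitive v)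
    (hd : 2 ≤ wedge u v) {h : ℕ} (hu' : ∀ i, |u i| ≤ h) (hv' : ∀ i, |v i| ≤ h) :
    ∃ w, IsPrimitive w ∧ (∀ i, |w i| ≤ h) ∧ 0 < wedge u w ∧ 0 < wedge w v := by
  obtain ⟨w₀, hw₀⟩ := hu.exists_wedge_eq_one
  set d := wedge u v with hddef
  set t := wedge w₀ v / d with ht
  have hdiv : wedge w₀ v % d + d * t = wedge w₀ v := Int.emod_add_mul_ediv _ _
  have hr0 : 0 ≤ wedge w₀ v % d := Int.emod_nonneg _ (by omega)
  have hrd : wedge w₀ v % d < d := Int.emod_lt_of_pos _ (by omega)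
  set r := wedge w₀ v % d with hr
  -- Moving `w₀` along `u` keeps `u ∧ w = 1` and reduces `w ∧ v` to its residue `r` modulo `d`. Then
  -- `d w = r u + v` with `r + 1 ≤ d`, which gives the norm bound.
  set w : Fin 2 → ℤ := fun i => w₀ i - t * u i with hw
  have huw : wedge u w = 1 := by
    rw [← hw₀]; simp only [wedge, hw]; ring
  have hwv : wedge w v = r := by
    have : wedge w v = wedge w₀ v - t * d := by
      rw [hddef]; simp only [wedge, hw]; ring
    rw [this, ← hdiv]; ring
  have hr1 : r ≠ 0 := by
    intro h0
    rw [h0, wedge_swap, neg_eq_zero] at hwv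
    obtain ⟨k, hk⟩ := hv.eq_smul_of_wedge hwv
    have h1 : wedge u w = k * d := by
      rw [hddef]; unfold wedge; rw [hk, hk]; ring
    rw [huw] at h1
    have := Int.le_of_dvd one_pos ⟨k, h1.trans (mul_comm _ _)⟩
    omega
  refine ⟨w, isPrimitive_of_wedge_eq_one' huw, fun i => ?_, by omega, by omega⟩
  have hid := wedge_smul_eq u v w i
  rw [huw, hwv, one_mul, ← hddef] at hid
  have h1 : |d * w i| ≤ d * h := by
    rw [hid]
    calc |r * u i + v i| ≤ |r * u i| + |v i| := abs_add_le _ _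
      _ = r * |u i| + |v i| := by rw [abs_mul, abs_of_nonneg hr0]
      _ ≤ r * h + h := add_le_add (mul_le_mul_of_nonneg_left (hu' i) hr0) (hv' i)
      _ = (r + 1) * h := by ring
      _ ≤ d * h := mul_le_mul_of_nonneg_right (by omega) (by positivity)
  rw [abs_mul, abs_of_nonneg (show 0 ≤ d by omega)] at h1
  exact le_of_mul_le_mul_left h1 (by omega)

theorem rays_completionUpTo (h : ℕ) (S : Set (raysUpTo h)) :
    (completionUpTo h S).rays = Subtype.val '' S :=
  (completion_spec _ _ _).1

theorem maximal_completionUpTo (h : ℕ) (S : Set (raysUpTo h)) :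
    Maximal (fun F : Fan => F.rays = Subtype.val '' S) (completionUpTo h S) :=
  completion_spec _ _ _

theorem completionUpTo_empty_cones (h : ℕ) : (completionUpTo h ∅).cones = {⊥} :=
  cones_eq_singleton_of_rays_eq_empty (by rw [rays_completionUpTo, Set.image_empty])

/-- A cone of index at least two would have one of the rays of norm at most `h` in its interior. -/
theorem isSmooth_fullFan (h : ℕ) : (fullFan h).IsSmooth := by
  apply Fan.isSmooth_of_wedge
  intro u v hu hv hd hF
  have hrays : (fullFan h).rays = raysUpTo h := by
    rw [fullFan, rays_completionUpTo]; simp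
  have norm_le : ∀ {u}, IsPrimitive u → latticeCone {u} ∈ (fullFan h).cones → ∀ i, |u i| ≤ h := by
    intro u hu huF
    have : latticeCone {u} ∈ raysUpTo h := hrays ▸ ⟨huF, u, hu, rfl⟩
    obtain ⟨u', hu', hn, he⟩ := this
    rw [hu.latticeCone_injective hu' he]
    exact hn
  by_contra hne
  obtain ⟨w, hw, hwn, h1, h2⟩ := exists_isPrimitive_interior hu hv (by omega)
    (norm_le hu (Fan.ray_left_mem _ hd.ne' hF)) (norm_le hv (Fan.ray_right_mem _ hd.ne' hF))
  have hwF : latticeCone {w} ∈ (fullFan h).rays := hrays ▸ ⟨w, hw, hwn, rfl⟩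
  rcases Fan.wedge_eq_zero_of_ray_mem _ hd hF hwF.1 h1.le h2.le with h | h <;> omega

/-- The ray spanned by a primitive vector of norm at most `h`. -/
noncomputable def rayOf {h : ℕ} (u : {u : Fin 2 → ℤ // IsPrimitive u ∧ ∀ i, |u i| ≤ h}) : raysUpTo h :=
  ⟨latticeCone {u.1}, u.1, u.2.1, u.2.2, rfl⟩

theorem rayOf_injective (h : ℕ) : Function.Injective (rayOf (h := h)) := fun u w huw =>
  Subtype.ext (u.2.1.latticeCone_injective w.2.1 (congrArg Subtype.val huw))

/-- Two chosen rays with no chosen ray between them span a cone of the completion; if its index is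
large then the completion has a singularity of large index. -/
theorem hasSingularityOfIndexAtLeast_completionUpTo {h : ℕ} {S : Set (raysUpTo h)} {k : ℕ}
    (hk : 2 ≤ k) (u v : {u : Fin 2 → ℤ // IsPrimitive u ∧ ∀ i, |u i| ≤ h})
    (hu : rayOf u ∈ S) (hv : rayOf v ∈ S) (hd : (k : ℤ) ≤ wedge u.1 v.1)
    (hint : ∀ w, rayOf w ∈ S → ¬ (0 < wedge u.1 w.1 ∧ 0 < wedge w.1 v.1)) :
    (completionUpTo h S).HasSingularityOfIndexAtLeast k := by
  have hmem : latticeCone {u.1, v.1} ∈ (completionUpTo h S).cones := by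
    refine pair_mem_of_maximal (maximal_completionUpTo h S) ⟨_, hu, rfl⟩ ⟨_, hv, rfl⟩
      (by omega) ?_
    rintro w hw ⟨⟨_, w', hw', hn, rfl⟩, hwS, he⟩
    obtain rfl := hw'.latticeCone_injective hw he
    exact hint ⟨w', hw', hn⟩ hwS
  refine ⟨⟨_, hmem⟩, (wedge u.1 v.1).natAbs, by omega,
    ⟨u.1, v.1, u.2.1, v.2.1, by omega, rfl, rfl⟩, ?_⟩
  exact Fan.not_isSmoothAt_fixedPoint _ _ u.2.1 v.2.1 (by omega) rfl

theorem Fan.HasSingularityOfIndexAtLeast.not_isSmooth {F : Fan} {k : ℕ}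
    (h : F.HasSingularityOfIndexAtLeast k) : ¬ F.IsSmooth := by
  obtain ⟨σ, _, _, _, hσ⟩ := h
  exact fun hF => hσ (hF.isSmoothAt _)

end RandomToric

/-! ### Patterns in a Bernoulli random set: first and second moments. -/

namespace RandomToric

section Probability

open MeasureTheory ProbabilityTheory unitInterval

variable {ι : Type*}

/-- The sets that contain `A` and are disjoint from `B`. -/
def patternEvent (A B : Finset ι) : Set (Set ι) := {S | (∀ i ∈ A, i ∈ S) ∧ ∀ i ∈ B, i ∉ S}

theorem patternEvent_inter [DecidableEq ι] (A B A' B' : Finset ι) :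
    patternEvent A B ∩ patternEvent A' B' = patternEvent (A ∪ A') (B ∪ B') := by
  ext S
  simp only [patternEvent, Set.mem_inter_iff, Set.mem_ofPred_eq, Finset.mem_union]
  constructor
  · rintro ⟨⟨h1, h2⟩, h3, h4⟩
    exact ⟨fun i hi => hi.elim (h1 i) (h3 i), fun i hi => hi.elim (h2 i) (h4 i)⟩
  · rintro ⟨h1, h2⟩
    exact ⟨⟨fun i hi => h1 i (.inl hi), fun i hi => h2 i (.inl hi)⟩,
      fun i hi => h1 i (.inr hi), fun i hi => h2 i (.inr hi)⟩

theorem setBernoulli_real_patternEvent [DecidableEq ι] (p : I) {A B : Finset ι}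
    (hAB : Disjoint A B) :
    (setBernoulli (Set.univ : Set ι) p).real (patternEvent A B) =
      (p : ℝ) ^ A.card * (1 - p : ℝ) ^ B.card := by
  -- The event is a cylinder of the underlying product measure.
  have h : (fun q : ι → Prop => {i | q i}) ⁻¹' patternEvent A B =
      Set.pi ((A ∪ B : Finset ι) : Set ι) (fun i => if i ∈ A then {True} else {False}) := by
    ext q
    simp only [patternEvent, Set.mem_preimage, Set.mem_ofPred_eq, Set.mem_pi, Finset.mem_coe,
      Finset.mem_union]
    constructor
    · rintro ⟨h1, h2⟩ i hi
      split_ifs with hA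
      · simpa using h1 i hA
      · simpa using h2 i (hi.resolve_left hA)
    · intro h1
      refine ⟨fun i hi => ?_, fun i hi => ?_⟩
      · simpa [hi] using h1 i (.inl hi)
      · simpa [Finset.disjoint_right.1 hAB hi] using h1 i (.inr hi)
  rw [measureReal_def, setBernoulli_apply', h, Measure.infinitePi_pi _ (fun _ _ => .of_discrete),
    Finset.prod_union hAB, ENNReal.toReal_mul, ENNReal.toReal_prod, ENNReal.toReal_prod]
  congr 1
  · rw [← Finset.prod_const]
    refine Finset.prod_congr rfl fun i hi => ?_
    simp [hi]
  · rw [← Finset.prod_const]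
    refine Finset.prod_congr rfl fun i hi => ?_
    simp [Finset.disjoint_right.1 hAB hi]

variable {J : Type*}

open Classical in
/-- The number of patterns of a family that occur in a set. -/
noncomputable def patternCount (K : Finset J) (A B : J → Finset ι) (S : Set ι) : ℕ :=
  (K.filter fun j => S ∈ patternEvent (A j) (B j)).card

theorem patternCount_eq_sum (K : Finset J) (A B : J → Finset ι) (S : Set ι) :
    (patternCount K A B S : ℝ) = ∑ j ∈ K, (patternEvent (A j) (B j)).indicator 1 S := by
  classical
  simp [patternCount, Set.indicator_apply]

variable [Finite ι]

theorem integral_patternCount (p : I) (K : Finset J) (A B : J → Finset ι) {a b : ℕ}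
    (hAB : ∀ j ∈ K, Disjoint (A j) (B j)) (hA : ∀ j ∈ K, (A j).card = a)
    (hB : ∀ j ∈ K, (B j).card = b) :
    ∫ S, (patternCount K A B S : ℝ) ∂(setBernoulli (Set.univ : Set ι) p) =
      K.card * ((p : ℝ) ^ a * (1 - p : ℝ) ^ b) := by
  classical
  simp_rw [patternCount_eq_sum]
  rw [integral_finsetSum _ fun _ _ => .of_finite, ← nsmul_eq_mul, ← Finset.sum_const]
  refine Finset.sum_congr rfl fun j hj => ?_
  rw [integral_indicator_one .of_discrete, setBernoulli_real_patternEvent p (hAB j hj), hA j hj,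
    hB j hj]

theorem setBernoulli_real_le_patternCount (p : I) (K : Finset J) (A B : J → Finset ι) {a b : ℕ}
    (hAB : ∀ j ∈ K, Disjoint (A j) (B j)) (hA : ∀ j ∈ K, (A j).card = a)
    (hB : ∀ j ∈ K, (B j).card = b) {t : ℝ} (ht : 0 < t) :
    (setBernoulli (Set.univ : Set ι) p).real {S | t ≤ patternCount K A B S} ≤
      K.card * ((p : ℝ) ^ a * (1 - p : ℝ) ^ b) / t := by
  rw [le_div_iff₀' ht, ← integral_patternCount p K A B hAB hA hB]
  exact mul_meas_ge_le_integral_of_nonneg (.of_forall fun _ => Nat.cast_nonneg _) .of_finite t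

/-- Second moment bound: if each pattern of a family overlaps at most `D` patterns of the family,
then the number of occurring patterns is at least half of its mean outside an event of
probability `4 D / mean`. -/
theorem setBernoulli_real_patternCount_le [DecidableEq ι] (p : I) (K : Finset J)
    (A B : J → Finset ι) {a b D : ℕ}
    (hAB : ∀ j ∈ K, Disjoint (A j) (B j)) (hA : ∀ j ∈ K, (A j).card = a)
    (hB : ∀ j ∈ K, (B j).card = b)
    (hD : ∀ j ∈ K, ∃ L : Finset J, L.card ≤ D ∧
      ∀ l ∈ K, l ∉ L → Disjoint (A j ∪ B j) (A l ∪ B l))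
    (hpos : 0 < (K.card : ℝ) * ((p : ℝ) ^ a * (1 - p : ℝ) ^ b)) :
    (setBernoulli (Set.univ : Set ι) p).real
        {S | (patternCount K A B S : ℝ) ≤ K.card * ((p : ℝ) ^ a * (1 - p : ℝ) ^ b) / 2} ≤
      4 * D / (K.card * ((p : ℝ) ^ a * (1 - p : ℝ) ^ b)) := by
  classical
  set μ := setBernoulli (Set.univ : Set ι) p with hμ
  set w := (p : ℝ) ^ a * (1 - p : ℝ) ^ b with hw
  set m := (K.card : ℝ) * w with hm
  have hK : (0 : ℝ) < K.card := by
    rcases (Nat.cast_nonneg K.card : (0 : ℝ) ≤ K.card).eq_or_lt with h | h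
    · rw [hm, ← h, zero_mul] at hpos
      exact absurd hpos (lt_irrefl 0)
    · exact h
  have hw0 : 0 < w := pos_of_mul_pos_right hpos hK.le
  let X : J → Set ι → ℝ := fun j => (patternEvent (A j) (B j)).indicator 1
  have hX : ∀ j ∈ K, ∫ S, X j S ∂μ = w := by
    intro j hj
    simp only [X]
    rw [integral_indicator_one .of_discrete, hμ, setBernoulli_real_patternEvent p (hAB j hj),
      hA j hj, hB j hj]
  have hXX : ∀ j l, ∀ S, X j S * X l S =
      (patternEvent (A j) (B j) ∩ patternEvent (A l) (B l)).indicator (1 : Set ι → ℝ) S := by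
    intro j l S
    simp only [X]
    rw [Set.inter_indicator_one]
    rfl
  have hcov : ∀ j ∈ K, ∀ l ∈ K, ∫ S, (X j S - w) * (X l S - w) ∂μ =
      μ.real (patternEvent (A j) (B j) ∩ patternEvent (A l) (B l)) - w ^ 2 := by
    intro j hj l hl
    have e : ∀ S, (X j S - w) * (X l S - w) = X j S * X l S - w * X j S - w * X l S + w ^ 2 := by
      intro S; ring
    simp_rw [e, hXX]
    rw [integral_add .of_finite .of_finite, integral_sub .of_finite .of_finite,
      integral_sub .of_finite .of_finite, integral_const_mul, integral_const_mul, hX j hj, hX l hl,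
      integral_indicator_one .of_discrete]
    simp
    ring
  -- Disjoint patterns are independent and contribute no covariance; an overlapping pair contributes
  -- at most `w`, the probability of one pattern.
  have hvar : ∫ S, ((patternCount K A B S : ℝ) - m) ^ 2 ∂μ ≤ D * m := by
    have e : ∀ S, ((patternCount K A B S : ℝ) - m) ^ 2 =
        ∑ j ∈ K, ∑ l ∈ K, (X j S - w) * (X l S - w) := by
      intro S
      rw [← Finset.sum_mul_sum, Finset.sum_sub_distrib, patternCount_eq_sum]
      simp [X, m]
      ring
    simp_rw [e]
    rw [integral_finsetSum _ fun _ _ => .of_finite]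
    calc ∑ j ∈ K, ∫ S, ∑ l ∈ K, (X j S - w) * (X l S - w) ∂μ
        ≤ ∑ j ∈ K, D * w := by
          refine Finset.sum_le_sum fun j hj => ?_
          rw [integral_finsetSum _ fun _ _ => .of_finite]
          obtain ⟨L, hL, hdisj⟩ := hD j hj
          calc ∑ l ∈ K, ∫ S, (X j S - w) * (X l S - w) ∂μ
              ≤ ∑ l ∈ K, if l ∈ L then w else 0 := by
                refine Finset.sum_le_sum fun l hl => ?_
                rw [hcov j hj l hl]
                split_ifs with hlL
                · have h1 : μ.real (patternEvent (A j) (B j) ∩ patternEvent (A l) (B l)) ≤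
                      μ.real (patternEvent (A j) (B j)) :=
                    measureReal_mono Set.inter_subset_left
                  rw [hμ, setBernoulli_real_patternEvent p (hAB j hj), hA j hj, hB j hj] at h1
                  have := sq_nonneg w
                  linarith
                · have h1 := hdisj l hl hlL
                  simp only [Finset.disjoint_union_left, Finset.disjoint_union_right] at h1
                  rw [patternEvent_inter, hμ, setBernoulli_real_patternEvent,
                    Finset.card_union_of_disjoint h1.1.1, Finset.card_union_of_disjoint h1.2.2,
                    hA j hj, hB j hj, hA l hl, hB l hl, hw]
                  · apply le_of_eq; ring
                  · simp only [Finset.disjoint_union_left, Finset.disjoint_union_right]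
                    exact ⟨⟨hAB j hj, h1.1.2.symm⟩, h1.2.1, hAB l hl⟩
            _ = (K.filter (· ∈ L)).card * w := by
                rw [Finset.sum_ite, Finset.sum_const, Finset.sum_const_zero, add_zero, nsmul_eq_mul]
            _ ≤ D * w := by
                refine mul_le_mul_of_nonneg_right ?_ hw0.le
                have : (K.filter (· ∈ L)).card ≤ L.card :=
                  Finset.card_le_card fun x hx => (Finset.mem_filter.1 hx).2
                exact_mod_cast this.trans hL
      _ = D * m := by rw [Finset.sum_const, nsmul_eq_mul, hm]; ring
  -- Chebyshev's inequality at distance `m / 2` from the mean, which is the origin of the factor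
  -- `4`.
  have hmk := mul_meas_ge_le_integral_of_nonneg (μ := μ)
    (f := fun S => ((patternCount K A B S : ℝ) - m) ^ 2) (.of_forall fun _ => sq_nonneg _)
    .of_finite ((m / 2) ^ 2)
  have hsub : μ.real {S | (patternCount K A B S : ℝ) ≤ m / 2} ≤
      μ.real {S | (m / 2) ^ 2 ≤ ((patternCount K A B S : ℝ) - m) ^ 2} := by
    refine measureReal_mono fun S hS => ?_
    simp only [Set.mem_ofPred_eq] at hS ⊢
    nlinarith
  rw [le_div_iff₀ hpos]
  have h2 : (m / 2) ^ 2 * μ.real {S | (patternCount K A B S : ℝ) ≤ m / 2} ≤ D * m :=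
    (mul_le_mul_of_nonneg_left hsub (sq_nonneg _)).trans (hmk.trans hvar)
  have h3 : m * (μ.real {S | (patternCount K A B S : ℝ) ≤ m / 2} * m) ≤ m * (4 * D) := by
    nlinarith
  exact le_of_mul_le_mul_left h3 hpos

end Probability

end RandomToric

/-! ### Counting coprime pairs. -/

namespace RandomToric

section Counting

/-- The pairs `(a, b)` with `0 < b < a ≤ n`. -/
def trianglePairs (n : ℕ) : Finset (ℕ × ℕ) :=
  (Finset.range (n + 1) ×ˢ Finset.range (n + 1)).filter fun w => 0 < w.2 ∧ w.2 < w.1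

/-- The coprime pairs `(a, b)` with `0 < b < a ≤ n`. -/
def sector (n : ℕ) : Finset (ℕ × ℕ) := (trianglePairs n).filter fun w => Nat.Coprime w.1 w.2

theorem mem_trianglePairs {n : ℕ} {w : ℕ × ℕ} :
    w ∈ trianglePairs n ↔ 0 < w.2 ∧ w.2 < w.1 ∧ w.1 ≤ n := by
  simp only [trianglePairs, Finset.mem_filter, Finset.mem_product, Finset.mem_range]
  omega

theorem mem_sector {n : ℕ} {w : ℕ × ℕ} :
    w ∈ sector n ↔ 0 < w.2 ∧ w.2 < w.1 ∧ w.1 ≤ n ∧ Nat.Coprime w.1 w.2 := by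
  simp only [sector, Finset.mem_filter, mem_trianglePairs, and_assoc]

theorem card_trianglePairs (n : ℕ) : 2 * (trianglePairs n).card = n * (n - 1) := by
  have h : (trianglePairs n).card = ∑ a ∈ Finset.range (n + 1), (a - 1) := by
    have h1 : trianglePairs n = (Finset.range (n + 1)).biUnion
        fun a => (Finset.Ioo 0 a).map (Function.Embedding.sectR a ℕ) := by
      ext ⟨a, b⟩
      simp only [mem_trianglePairs, Finset.mem_biUnion, Finset.mem_range, Finset.mem_map,
        Finset.mem_Ioo, Function.Embedding.sectR_apply, Prod.mk.injEq]
      constructor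
      · rintro ⟨h1, h2, h3⟩
        exact ⟨a, by omega, b, ⟨h1, h2⟩, rfl, rfl⟩
      · rintro ⟨_, h1, _, h2, rfl, rfl⟩
        omega
    rw [h1, Finset.card_biUnion]
    · simp
    · intro a _ b _ hab
      rw [Function.onFun, Finset.disjoint_left]
      rintro ⟨c, d⟩ h h'
      simp only [Finset.mem_map, Function.Embedding.sectR_apply, Prod.mk.injEq] at h h'
      obtain ⟨_, _, rfl, _⟩ := h
      obtain ⟨_, _, rfl, _⟩ := h'
      exact hab rfl
  rw [h, Finset.sum_range_succ', mul_comm]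
  simp [Finset.sum_range_id_mul_two]

/-- The term `1/4` plus a telescoping bound for the rest. A limit below `1` is what makes the count
of coprime pairs quadratic. -/
theorem sum_Icc_two_inv_sq_le {n : ℕ} (hn : 2 ≤ n) :
    ∑ d ∈ Finset.Icc 2 n, (1 : ℝ) / (d : ℝ) ^ 2 ≤ 3 / 4 - 1 / n := by
  induction n, hn using Nat.le_induction with
  | base => norm_num
  | succ n hn ih =>
    rw [Finset.sum_Icc_succ_top (by omega)]
    have h0 : (0 : ℝ) < n := by positivity
    have h1 : (1 : ℝ) / ((n + 1 : ℕ) : ℝ) ^ 2 ≤ 1 / n - 1 / (n + 1 : ℕ) := by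
      push_cast
      rw [div_sub_div _ _ h0.ne' (by positivity), div_le_div_iff₀ (by positivity) (by positivity)]
      nlinarith
    linarith

/-- Of the `n(n - 1)/2` pairs, those with gcd `d` number at most `(n/d)²/2`. Summing over `d ≥ 2`
removes at most `3n²/8`. -/
theorem le_card_sector (n : ℕ) : (n : ℝ) ^ 2 ≤ 8 * (sector n).card + 4 * n := by
  rcases lt_or_ge n 2 with hn | hn
  · interval_cases n <;> norm_num
    have : (0 : ℝ) ≤ (sector 1).card := by positivity
    linarith
  have hcover : trianglePairs n ⊆ sector n ∪ (Finset.Icc 2 n).biUnion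
      fun d => (trianglePairs (n / d)).image fun w => (d * w.1, d * w.2) := by
    rintro ⟨a, b⟩ hab
    obtain ⟨h1, h2, h3⟩ := mem_trianglePairs.1 hab
    simp only at h1 h2 h3
    rw [Finset.mem_union]
    by_cases hc : Nat.Coprime a b
    · exact Or.inl (mem_sector.2 ⟨h1, h2, h3, hc⟩)
    · right
      have hg0 : 0 < Nat.gcd a b := Nat.gcd_pos_of_pos_right _ h1
      have hga : Nat.gcd a b ≤ a := Nat.gcd_le_left _ (by omega)
      have hg1 : Nat.gcd a b ≠ 1 := hc
      obtain ⟨a', ha'⟩ := Nat.gcd_dvd_left a b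
      obtain ⟨b', hb'⟩ := Nat.gcd_dvd_right a b
      refine Finset.mem_biUnion.2 ⟨Nat.gcd a b, Finset.mem_Icc.2 ⟨by omega, by omega⟩,
        Finset.mem_image.2 ⟨(a', b'), mem_trianglePairs.2 ⟨?_, ?_, ?_⟩, ?_⟩⟩
      · rw [hb'] at h1
        exact Nat.pos_of_mul_pos_left h1
      · by_contra hcon
        have := Nat.mul_le_mul_left (Nat.gcd a b) (not_lt.1 hcon)
        rw [← ha', ← hb'] at this
        omega
      · rw [Nat.le_div_iff_mul_le hg0, mul_comm]
        simp only
        omega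
      · simp only
        rw [← ha', ← hb']
  have hcard := (Finset.card_le_card hcover).trans (Finset.card_union_le _ _)
  have hb : (((Finset.Icc 2 n).biUnion
      fun d => (trianglePairs (n / d)).image fun w => (d * w.1, d * w.2)).card : ℝ) ≤
      3 / 8 * (n : ℝ) ^ 2 := by
    calc _ ≤ ((∑ d ∈ Finset.Icc 2 n, (trianglePairs (n / d)).card : ℕ) : ℝ) := by
          exact_mod_cast Finset.card_biUnion_le.trans
            (Finset.sum_le_sum fun d _ => Finset.card_image_le)
      _ ≤ ∑ d ∈ Finset.Icc 2 n, (n : ℝ) ^ 2 / 2 * (1 / (d : ℝ) ^ 2) := by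
          push_cast
          refine Finset.sum_le_sum fun d hd => ?_
          have hd0 : (0 : ℝ) < d := by
            have := (Finset.mem_Icc.1 hd).1
            positivity
          have h1 : 2 * ((trianglePairs (n / d)).card : ℝ) ≤ ((n / d : ℕ) : ℝ) ^ 2 := by
            have h2 := card_trianglePairs (n / d)
            have h3 : 2 * (trianglePairs (n / d)).card ≤ (n / d) ^ 2 := by
              rw [h2, pow_two]
              exact Nat.mul_le_mul_left _ (Nat.sub_le _ _)
            exact_mod_cast h3
          have h2 : ((n / d : ℕ) : ℝ) ^ 2 ≤ ((n : ℝ) / d) ^ 2 :=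
            pow_le_pow_left₀ (by positivity) Nat.cast_div_le 2
          rw [div_pow] at h2
          have : (n : ℝ) ^ 2 / 2 * (1 / (d : ℝ) ^ 2) = (n : ℝ) ^ 2 / (d : ℝ) ^ 2 / 2 := by ring
          rw [this]
          linarith
      _ ≤ (n : ℝ) ^ 2 / 2 * (3 / 4) := by
          rw [← Finset.mul_sum]
          refine mul_le_mul_of_nonneg_left ?_ (by positivity)
          have := sum_Icc_two_inv_sq_le hn
          have h0 : (0 : ℝ) ≤ 1 / n := by positivity
          linarith
      _ = 3 / 8 * (n : ℝ) ^ 2 := by ring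
  have ht : 2 * ((trianglePairs n).card : ℝ) = n * (n - 1) := by
    have := card_trianglePairs n
    rw [← Nat.cast_one (R := ℝ), ← Nat.cast_sub (by omega)]
    exact_mod_cast this
  have hcard' : ((trianglePairs n).card : ℝ) ≤ (sector n).card + ((Finset.Icc 2 n).biUnion
      fun d => (trianglePairs (n / d)).image fun w => (d * w.1, d * w.2)).card := by
    exact_mod_cast hcard
  nlinarith

end Counting

/-! ### Sector vectors and their neighbours. -/

/-- The primitive vectors of norm at most `h`. -/
abbrev PrimitiveVector (h : ℕ) : Type := {u : Fin 2 → ℤ // IsPrimitive u ∧ ∀ i, |u i| ≤ h}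

/-- The lattice vector with coordinates `w`. -/
def toVector (w : ℕ × ℕ) : Fin 2 → ℤ := ![w.1, w.2]

@[simp] theorem toVector_zero (w : ℕ × ℕ) : toVector w 0 = w.1 := rfl

@[simp] theorem toVector_one (w : ℕ × ℕ) : toVector w 1 = w.2 := rfl

theorem toVector_injective : Function.Injective toVector := by
  rintro ⟨a, b⟩ ⟨c, d⟩ h
  have h0 := congrFun h 0
  have h1 := congrFun h 1
  simp at h0 h1
  rw [h0, h1]

theorem isPrimitive_toVector {n : ℕ} {w : ℕ × ℕ} (hw : w ∈ sector n) : IsPrimitive (toVector w) :=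
  Nat.isCoprime_iff_coprime.2 (mem_sector.1 hw).2.2.2

theorem abs_toVector_le {n h : ℕ} (hn : n ≤ h) {w : ℕ × ℕ} (hw : w ∈ sector n) (i : Fin 2) :
    |toVector w i| ≤ h := by
  obtain ⟨h1, h2, h3, -⟩ := mem_sector.1 hw
  fin_cases i
  · simp; omega
  · simp; omega

/-- Solutions with a given determinant form a coset of `ℤ u`, and distinct ones differ by at least
`|u 0|` in the first coordinate. -/
theorem IsPrimitive.eq_of_wedge_eq {u w w' : Fin 2 → ℤ} (hu : IsPrimitive u)
    (h : wedge u w = wedge u w') (hlt : |w 0 - w' 0| < |u 0|) : w = w' := by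
  have h0 : wedge u (fun i => w i - w' i) = 0 := by
    unfold wedge at h ⊢; linear_combination h
  obtain ⟨k, hk⟩ := hu.eq_smul_of_wedge h0
  have hk0 : k = 0 := by
    by_contra hne
    have h1 := hk 0
    rw [h1, abs_mul] at hlt
    have : 1 ≤ |k| := Int.one_le_abs hne
    nlinarith [abs_nonneg (u 0)]
  ext i
  have := hk i
  rw [hk0, zero_mul] at this
  omega

/-- A vector strictly between `u` and `w` is a combination of this basis with coefficients at least
`1`, so its first coordinate is at least `u 0 + w 0`. The same holds between `w` and `v`, which
leaves only the ray of `w`. -/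
theorem eq_of_wedge_pos {u v w z : Fin 2 → ℤ} (huw : wedge u w = 1) (hwv : wedge w v = 1)
    (hz : IsPrimitive z) (h1 : 0 < wedge u z) (h2 : 0 < wedge z v) (hu0 : 0 ≤ u 0) (hv0 : 0 ≤ v 0)
    (hw0 : 0 ≤ w 0) (hzu : z 0 < u 0 + w 0) (hzv : z 0 < w 0 + v 0) : z = w := by
  have hwp : IsPrimitive w := isPrimitive_of_wedge_eq_one' huw
  rcases lt_trichotomy (wedge z w) 0 with h0 | h0 | h0
  · have hid := wedge_smul_eq w v z 0
    rw [hwv, wedge_swap z w, one_mul] at hid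
    have h3 : 0 ≤ (wedge z v - 1) * w 0 := mul_nonneg (by omega) hw0
    have h4 : 0 ≤ (-wedge z w - 1) * v 0 := mul_nonneg (by omega) hv0
    linarith
  · rcases hwp.eq_or_eq_neg hz (by rw [wedge_swap, h0, neg_zero]) with h | h
    · exact h
    · have : wedge u z = -1 := by
        rw [h, ← huw]; simp [wedge]; ring
      omega
  · have hid := wedge_smul_eq u w z 0
    rw [huw, one_mul] at hid
    have h3 : 0 ≤ (wedge z w - 1) * u 0 := mul_nonneg (by omega) hu0
    have h4 : 0 ≤ (wedge u z - 1) * w 0 := mul_nonneg (by omega) hw0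
    linarith

/-- A short primitive vector `w` has neighbours `u` and `v` of norm at most `h` such that the cone
spanned by `u` and `v` has large index and contains no other primitive vector of norm at most `h`. -/
theorem exists_neighbours {k n h : ℕ} (hk : 2 ≤ k) (hkn : k * n ≤ h) {w : ℕ × ℕ}
    (hw : w ∈ sector n) :
    ∃ u v : PrimitiveVector h, wedge u.1 (toVector w) = 1 ∧ wedge (toVector w) v.1 = 1 ∧
      (h : ℤ) - w.1 < u.1 0 ∧ (h : ℤ) - w.1 < v.1 0 ∧ (k : ℤ) ≤ wedge u.1 v.1 ∧
      ∀ z : PrimitiveVector h, 0 < wedge u.1 z.1 → 0 < wedge z.1 v.1 → z.1 = toVector w := by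
  obtain ⟨a, b⟩ := w
  obtain ⟨hb, hba, han, hcop⟩ := mem_sector.1 hw
  simp only at hb hba han hcop
  have hwp := isPrimitive_toVector hw
  have hka : (k : ℤ) * a ≤ h := by
    have : k * a ≤ h := (Nat.mul_le_mul_left k han).trans hkn
    exact_mod_cast this
  have hk' : (2 : ℤ) ≤ k := by exact_mod_cast hk
  have hb' : (1 : ℤ) ≤ b := by exact_mod_cast hb
  have hba' : (b : ℤ) + 1 ≤ a := by exact_mod_cast hba
  have hah : 2 * (a : ℤ) ≤ h := by nlinarith
  obtain ⟨s, t, hst⟩ : ∃ s t : ℤ, s * a + t * b = 1 := Nat.isCoprime_iff_coprime.2 hcop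
  have ha0 : (0 : ℤ) < a := by omega
  -- The vectors with `u ∧ w = 1` are `(t, -s) + q w`, and similarly for `v`. The quotients place
  -- both first coordinates in the last window `(h - a, h]`.
  set q := ((h : ℤ) - t) / a with hq
  set q' := ((h : ℤ) + t) / a with hq'
  have e1 : ((h : ℤ) - t) % a + a * q = h - t := Int.emod_add_mul_ediv _ _
  have e2 : ((h : ℤ) + t) % a + a * q' = h + t := Int.emod_add_mul_ediv _ _
  have r1 := Int.emod_nonneg ((h : ℤ) - t) ha0.ne'
  have r2 := Int.emod_lt_of_pos ((h : ℤ) - t) ha0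
  have r3 := Int.emod_nonneg ((h : ℤ) + t) ha0.ne'
  have r4 := Int.emod_lt_of_pos ((h : ℤ) + t) ha0
  set x := a * q + t with hx
  set y := b * q - s with hy
  set x' := a * q' - t with hx'
  set y' := b * q' + s with hy'
  have hx1 : (h : ℤ) - a < x := by omega
  have hx2 : x ≤ h := by omega
  have hx1' : (h : ℤ) - a < x' := by omega
  have hx2' : x' ≤ h := by omega
  have hyx : a * y = x * b - 1 := by rw [hx, hy]; linear_combination -hst
  have hyx' : a * y' = x' * b + 1 := by rw [hx', hy']; linear_combination hst
  have hy0 : 0 ≤ y := by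
    have h0 : 0 ≤ a * y := by rw [hyx]; nlinarith
    exact (mul_nonneg_iff_of_pos_left ha0).1 h0
  have hylt : y ≤ x := by
    have h0 : a * y ≤ a * x := by rw [hyx]; nlinarith
    exact le_of_mul_le_mul_left h0 ha0
  have hy0' : 0 ≤ y' := by
    have h0 : 0 ≤ a * y' := by rw [hyx']; nlinarith
    exact (mul_nonneg_iff_of_pos_left ha0).1 h0
  have hylt' : y' ≤ x' := by
    have h0 : a * y' ≤ a * x' := by rw [hyx']; nlinarith
    exact le_of_mul_le_mul_left h0 ha0
  have huw : wedge ![x, y] (toVector (a, b)) = 1 := by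
    simp [wedge]; linear_combination -hyx
  have hwv : wedge (toVector (a, b)) ![x', y'] = 1 := by
    simp [wedge]; linear_combination hyx'
  -- Here `a (q + q') = x + x' > 2 (h - a)`, while `h ≥ k a`.
  have hqk : k ≤ q + q' := by
    by_contra hcon
    have : (a : ℤ) * (q + q') ≤ a * (k - 1) := mul_le_mul_of_nonneg_left (by omega) ha0.le
    nlinarith
  have huv : wedge ![x, y] ![x', y'] = q + q' := by
    simp [wedge, hx, hy, hx', hy']
    linear_combination (q + q') * hst
  refine ⟨⟨![x, y], isPrimitive_of_wedge_eq_one huw, ?_⟩,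
    ⟨![x', y'], isPrimitive_of_wedge_eq_one' hwv, ?_⟩, huw, hwv, hx1, hx1', by
      simp only [huv]; exact hqk, ?_⟩
  · intro i
    rw [abs_le]
    fin_cases i <;> simp <;> constructor <;> omega
  · intro i
    rw [abs_le]
    fin_cases i <;> simp <;> constructor <;> omega
  · intro z h1 h2
    have hz0 := (abs_le.1 (z.2.2 0)).2
    exact eq_of_wedge_pos huw hwv z.2.1 h1 h2 (by simp; omega) (by simp; omega) (by simp)
      (by simp; omega) (by simp; omega)

end RandomToric

/-! ### Probability that no singular point occurs. -/

namespace RandomToric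

open MeasureTheory ProbabilityTheory unitInterval

theorem exists_primitiveVector {n h : ℕ} (hn : n ≤ h) {w : ℕ × ℕ} (hw : w ∈ sector n) :
    ∃ W : PrimitiveVector h, W.1 = toVector w :=
  ⟨⟨toVector w, isPrimitive_toVector hw, abs_toVector_le hn hw⟩, rfl⟩

/-- Singularities of large index arise from a short vector that is not chosen while both its
neighbours are. -/
theorem setBernoulli_real_not_hasSingularity_le (p : I) {k n h : ℕ} (hk : 2 ≤ k)
    (hkn : k * n ≤ h)
    (hpos : 0 < ((sector n).card : ℝ) * ((p : ℝ) ^ 2 * (1 - p : ℝ) ^ 1)) :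
    (setBernoulli (Set.univ : Set (raysUpTo h)) p).real
        {S | ¬ (completionUpTo h S).HasSingularityOfIndexAtLeast k} ≤
      12 / ((sector n).card * ((p : ℝ) ^ 2 * (1 - p : ℝ) ^ 1)) := by
  classical
  have hn2 : 2 * n ≤ h := (Nat.mul_le_mul_right n hk).trans hkn
  have hne : Nonempty (PrimitiveVector h) := by
    rcases (sector n).eq_empty_or_nonempty with h0 | ⟨w, hw⟩
    · rw [h0] at hpos; simp at hpos
    · exact ⟨(exists_primitiveVector (by omega) hw).choose⟩
  choose! u v huw hwv hu0 hv0 huv hint using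
    fun w (hw : w ∈ sector n) => exists_neighbours hk hkn hw
  choose! W hW using fun w (hw : w ∈ sector n) => exists_primitiveVector (h := h) (by omega) hw
  have hbound : ∀ w ∈ sector n, 0 < w.1 ∧ w.1 ≤ n := fun w hw => by
    obtain ⟨h1, h2, h3, -⟩ := mem_sector.1 hw
    exact ⟨by omega, h3⟩
  -- A neighbour `x` determines the short vector: its first coordinate exceeds `h - n ≥ n`, and
  -- short vectors differ by less than `n` there.
  have hinj : ∀ w ∈ sector n, ∀ w' ∈ sector n, ∀ x : PrimitiveVector h, (h : ℤ) - w.1 < x.1 0 →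
      wedge x.1 (toVector w) = wedge x.1 (toVector w') → w = w' := by
    intro w hw w' hw' x hx he
    have b1 := hbound w hw
    have b2 := hbound w' hw'
    refine toVector_injective (x.2.1.eq_of_wedge_eq he ?_)
    rw [lt_abs]
    left
    rw [abs_lt]
    simp only [toVector_zero]
    omega
  have huinj : ∀ w ∈ sector n, ∀ w' ∈ sector n, u w = u w' → w = w' := by
    intro w hw w' hw' he
    exact hinj w hw w' hw' (u w) (hu0 w hw) (by rw [huw w hw, he, huw w' hw'])
  have hvinj : ∀ w ∈ sector n, ∀ w' ∈ sector n, v w = v w' → w = w' := by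
    intro w hw w' hw' he
    refine hinj w hw w' hw' (v w) (hv0 w hw) ?_
    rw [wedge_swap, hwv w hw, he, wedge_swap, hwv w' hw']
  have hWinj : ∀ w ∈ sector n, ∀ w' ∈ sector n, W w = W w' → w = w' := by
    intro w hw w' hw' he
    exact toVector_injective (by rw [← hW w hw, ← hW w' hw', he])
  have huW : ∀ w ∈ sector n, ∀ w' ∈ sector n, u w ≠ W w' := by
    intro w hw w' hw' he
    have b0 := hu0 w hw
    have b1 := hbound w hw
    have b2 := hbound w' hw'
    rw [he, hW w' hw', toVector_zero] at b0
    omega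
  have hvW : ∀ w ∈ sector n, ∀ w' ∈ sector n, v w ≠ W w' := by
    intro w hw w' hw' he
    have b0 := hv0 w hw
    have b1 := hbound w hw
    have b2 := hbound w' hw'
    rw [he, hW w' hw', toVector_zero] at b0
    omega
  have huv' : ∀ w ∈ sector n, u w ≠ v w := by
    intro w hw he
    have h1 := huv w hw
    rw [he] at h1
    have h2 : wedge (v w).1 (v w).1 = 0 := by unfold wedge; ring
    omega
  let A : ℕ × ℕ → Finset (raysUpTo h) := fun w => {rayOf (u w), rayOf (v w)}
  let B : ℕ × ℕ → Finset (raysUpTo h) := fun w => {rayOf (W w)}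
  have hr := rayOf_injective h
  -- A pattern meets itself, at most one other whose `u` is its `v`, and at most one whose `v` is
  -- its `u`. Short vectors never coincide with neighbours. This gives `D = 3`, and `12` in the
  -- bound.
  have key := setBernoulli_real_patternCount_le p (sector n) A B (a := 2) (b := 1) (D := 3)
    (fun w hw => by
      simp only [A, B, Finset.disjoint_singleton_right, Finset.mem_insert, Finset.mem_singleton,
        hr.eq_iff, not_or]
      exact ⟨(huW w hw w hw).symm, (hvW w hw w hw).symm⟩)
    (fun w hw => Finset.card_pair (hr.ne (huv' w hw)))
    (fun w hw => Finset.card_singleton _)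
    (fun w hw => by
      refine ⟨{w} ∪ ((sector n).filter fun l => u l = v w) ∪ (sector n).filter fun l => v l = u w,
        ?_, ?_⟩
      · have c1 : ((sector n).filter fun l => u l = v w).card ≤ 1 := Finset.card_le_one.2 (by
          intro x hx y hy
          rw [Finset.mem_filter] at hx hy
          exact huinj x hx.1 y hy.1 (hx.2.trans hy.2.symm))
        have c2 : ((sector n).filter fun l => v l = u w).card ≤ 1 := Finset.card_le_one.2 (by
          intro x hx y hy
          rw [Finset.mem_filter] at hx hy
          exact hvinj x hx.1 y hy.1 (hx.2.trans hy.2.symm))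
        have c3 := Finset.card_union_le ({w} ∪ ((sector n).filter fun l => u l = v w))
          ((sector n).filter fun l => v l = u w)
        have c4 := Finset.card_union_le {w} ((sector n).filter fun l => u l = v w)
        rw [Finset.card_singleton] at c4
        omega
      · intro l hl hlL
        simp only [Finset.mem_union, Finset.mem_singleton, Finset.mem_filter, not_or, not_and] at hlL
        obtain ⟨⟨h1, h2⟩, h3⟩ := hlL
        have h2 := h2 hl
        have h3 := h3 hl
        have h4 : u w ≠ u l := fun e => h1 (huinj w hw l hl e).symm
        have h5 : v w ≠ v l := fun e => h1 (hvinj w hw l hl e).symm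
        have h6 : W w ≠ W l := fun e => h1 (hWinj w hw l hl e).symm
        simp only [A, B, Finset.disjoint_union_left, Finset.disjoint_union_right,
          Finset.disjoint_insert_left, Finset.disjoint_singleton_left,
          Finset.mem_insert, Finset.mem_singleton, hr.eq_iff, not_or]
        refine ⟨⟨⟨⟨h4, Ne.symm h3⟩, Ne.symm h2, h5⟩, (huW l hl w hw).symm, (hvW l hl w hw).symm⟩,
          ⟨huW w hw l hl, hvW w hw l hl⟩, h6⟩)
    hpos
  refine (measureReal_mono ?_).trans (key.trans_eq (by norm_num))
  intro S hS
  rw [Set.mem_ofPred_eq] at hS ⊢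
  have hzero : patternCount (sector n) A B S = 0 := by
    rw [patternCount, Finset.card_eq_zero, Finset.filter_eq_empty_iff]
    rintro w hw ⟨h1, h2⟩
    apply hS
    refine hasSingularityOfIndexAtLeast_completionUpTo hk (u w) (v w) (h1 _ (by simp [A]))
      (h1 _ (by simp [A])) (huv w hw) ?_
    rintro z hz ⟨hz1, hz2⟩
    have hzW : z = W w := Subtype.ext ((hint w hw z hz1 hz2).trans (hW w hw).symm)
    exact h2 _ (by simp [B]) (hzW ▸ hz)
  rw [hzero]
  have := hpos
  simp only [Nat.cast_zero]
  linarith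

/-- The pairs of vectors of the sector that form an oriented lattice basis. -/
def basisPairs (n : ℕ) : Finset ((ℕ × ℕ) × ℕ × ℕ) :=
  (sector n ×ˢ sector n).filter fun w => wedge (toVector w.1) (toVector w.2) = 1

/-- The member with the larger first coordinate determines the other one, once it is known which of
the two positions it occupies. -/
theorem card_basisPairs_le (n : ℕ) : (basisPairs n).card ≤ 2 * (sector n).card := by
  classical
  have h1 : ((basisPairs n).filter fun w => w.2.1 ≤ w.1.1).card ≤ (sector n).card := by
    refine Finset.card_le_card_of_injOn (fun w => w.1) ?_ ?_
    · intro w hw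
      simp only [basisPairs, Finset.coe_filter, Finset.mem_filter, Finset.mem_product] at hw
      exact hw.1.1.1
    · rintro ⟨w, z⟩ hw ⟨w', z'⟩ hw' he
      simp only [basisPairs, Finset.coe_filter, Finset.mem_filter, Finset.mem_product,
        Set.mem_ofPred_eq] at hw hw'
      simp only at he
      subst he
      obtain ⟨⟨⟨hs, hz⟩, hd⟩, hle⟩ := hw
      obtain ⟨⟨⟨-, hz'⟩, hd'⟩, hle'⟩ := hw'
      have b1 := mem_sector.1 hz
      have b2 := mem_sector.1 hz'
      have : z = z' := toVector_injective ((isPrimitive_toVector hs).eq_of_wedge_eq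
        (hd.trans hd'.symm) (by
          rw [lt_abs]; left; rw [abs_lt]; simp only [toVector_zero]; omega))
      rw [this]
  have h2 : ((basisPairs n).filter fun w => ¬ w.2.1 ≤ w.1.1).card ≤ (sector n).card := by
    refine Finset.card_le_card_of_injOn (fun w => w.2) ?_ ?_
    · intro w hw
      simp only [basisPairs, Finset.coe_filter, Finset.mem_filter, Finset.mem_product] at hw
      exact hw.1.1.2
    · rintro ⟨z, w⟩ hw ⟨z', w'⟩ hw' he
      simp only [basisPairs, Finset.coe_filter, Finset.mem_filter, Finset.mem_product,
        Set.mem_ofPred_eq] at hw hw'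
      simp only at he
      subst he
      obtain ⟨⟨⟨hz, hs⟩, hd⟩, hle⟩ := hw
      obtain ⟨⟨⟨hz', -⟩, hd'⟩, hle'⟩ := hw'
      have b1 := mem_sector.1 hz
      have b2 := mem_sector.1 hz'
      have : z = z' := toVector_injective ((isPrimitive_toVector hs).eq_of_wedge_eq
        (by rw [wedge_swap, hd, wedge_swap, hd']) (by
          rw [lt_abs]; left; rw [abs_lt]; simp only [toVector_zero]; omega))
      rw [this]
  rw [← Finset.card_filter_add_card_filter_not (s := basisPairs n) fun w => w.2.1 ≤ w.1.1]
  omega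

theorem wedge_toVector_pos_iff {w z : ℕ × ℕ} (hw : 0 < w.1) (hz : 0 < z.1) :
    0 < wedge (toVector w) (toVector z) ↔ (w.2 : ℚ) / w.1 < (z.2 : ℚ) / z.1 := by
  have hw' : (0 : ℚ) < w.1 := by exact_mod_cast hw
  have hz' : (0 : ℚ) < z.1 := by exact_mod_cast hz
  rw [div_lt_div_iff₀ hw' hz']
  simp only [wedge, toVector_zero, toVector_one, sub_pos]
  rw [mul_comm (w.1 : ℤ)]
  norm_cast

/-- The inequalities `0 < y < x` pass to positive combinations, so nothing outside the sector can
separate two of its vectors. -/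
theorem exists_toVector_of_between {h : ℕ} {w z : ℕ × ℕ} (hw : w ∈ sector h) (hz : z ∈ sector h)
    (hd : 0 < wedge (toVector w) (toVector z)) (x : PrimitiveVector h)
    (h1 : 0 < wedge (toVector w) x.1) (h2 : 0 < wedge x.1 (toVector z)) :
    ∃ y ∈ sector h, toVector y = x.1 := by
  obtain ⟨w1, w2, w3, -⟩ := mem_sector.1 hw
  obtain ⟨z1, z2, z3, -⟩ := mem_sector.1 hz
  have e0 := wedge_smul_eq (toVector w) (toVector z) x.1 0
  have e1 := wedge_smul_eq (toVector w) (toVector z) x.1 1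
  simp only [toVector_zero, toVector_one] at e0 e1
  have w1' : (0 : ℤ) < w.2 := by exact_mod_cast w1
  have z1' : (0 : ℤ) < z.2 := by exact_mod_cast z1
  have w2' : (0 : ℤ) < w.1 - w.2 := by omega
  have z2' : (0 : ℤ) < z.1 - z.2 := by omega
  have p1 : 0 < x.1 1 := by
    refine (mul_pos_iff_of_pos_left hd).1 ?_
    rw [e1]; positivity
  have p2 : 0 < x.1 0 - x.1 1 := by
    refine (mul_pos_iff_of_pos_left hd).1 ?_
    have : wedge (toVector w) (toVector z) * (x.1 0 - x.1 1) =
        wedge x.1 (toVector z) * (w.1 - w.2) + wedge (toVector w) x.1 * (z.1 - z.2) := by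
      linear_combination e0 - e1
    rw [this]; positivity
  have hn := (abs_le.1 (x.2.2 0)).2
  have hy : toVector ((x.1 0).toNat, (x.1 1).toNat) = x.1 := by
    ext i
    fin_cases i
    · simp; omega
    · simp; omega
  refine ⟨_, mem_sector.2 ⟨?_, ?_, ?_, ?_⟩, hy⟩
  · simp only; omega
  · simp only; omega
  · simp only; omega
  · have := x.2.1
    rw [← hy] at this
    exact Nat.isCoprime_iff_coprime.1 this

open Classical in
/-- Without singular points of index at least two, consecutive chosen vectors of the sector form
lattice bases. -/
theorem card_filter_sector_le {h : ℕ} {S : Set (raysUpTo h)}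
    (hS : ¬ (completionUpTo h S).HasSingularityOfIndexAtLeast 2) {W : ℕ × ℕ → PrimitiveVector h}
    (hW : ∀ w ∈ sector h, (W w).1 = toVector w) :
    ((sector h).filter fun w => rayOf (W w) ∈ S).card ≤
      ((basisPairs h).filter fun w => rayOf (W w.1) ∈ S ∧ rayOf (W w.2) ∈ S).card + 1 := by
  set Q := (sector h).filter fun w => rayOf (W w) ∈ S with hQ
  have hpos : ∀ w ∈ sector h, 0 < w.1 := fun w hw => by
    obtain ⟨h1, h2, -⟩ := mem_sector.1 hw
    omega
  have hQs : ∀ w ∈ Q, w ∈ sector h := fun w hw => (Finset.mem_filter.1 hw).1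
  have hnext : ∀ w ∈ Q, (∃ z ∈ Q, 0 < wedge (toVector w) (toVector z)) →
      ∃ z ∈ Q, wedge (toVector w) (toVector z) = 1 := by
    intro w hw ⟨z₀, hz₀, hwz₀⟩
    -- The successor of `w` is the chosen vector of least slope beyond it. No chosen vector lies
    -- between, so a determinant of at least two would create a singular point.
    obtain ⟨z, hz, hmin⟩ := Finset.exists_min_image
      (Q.filter fun z => 0 < wedge (toVector w) (toVector z)) (fun z => (z.2 : ℚ) / z.1)
      ⟨z₀, Finset.mem_filter.2 ⟨hz₀, hwz₀⟩⟩
    obtain ⟨hzQ, hwz⟩ := Finset.mem_filter.1 hz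
    refine ⟨z, hzQ, ?_⟩
    by_contra hne
    apply hS
    refine hasSingularityOfIndexAtLeast_completionUpTo le_rfl (W w) (W z)
      (Finset.mem_filter.1 hw).2 (Finset.mem_filter.1 hzQ).2 ?_ ?_
    · rw [hW w (hQs w hw), hW z (hQs z hzQ)]
      push_cast
      omega
    · rintro x hx ⟨h1, h2⟩
      rw [hW w (hQs w hw)] at h1
      rw [hW z (hQs z hzQ)] at h2
      obtain ⟨y, hy, hyx⟩ := exists_toVector_of_between (hQs w hw) (hQs z hzQ) hwz x h1 h2
      have hxW : W y = x := Subtype.ext ((hW y hy).trans hyx)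
      rw [← hyx] at h1 h2
      have h3 := hmin y (Finset.mem_filter.2 ⟨Finset.mem_filter.2 ⟨hy, hxW ▸ hx⟩, h1⟩)
      have h4 := (wedge_toVector_pos_iff (hpos y hy) (hpos z (hQs z hzQ))).1 h2
      exact absurd h3 (not_le.2 h4)
  choose! N hNQ hN using hnext
  rw [← Finset.card_filter_add_card_filter_not (s := Q)
    fun w => ∃ z ∈ Q, 0 < wedge (toVector w) (toVector z)]
  refine add_le_add ?_ ?_
  · refine Finset.card_le_card_of_injOn (fun w => (w, N w)) ?_ ?_
    · intro w hw
      obtain ⟨hwQ, hex⟩ := Finset.mem_filter.1 hw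
      have hz := hNQ w hwQ hex
      simp only [basisPairs, Finset.coe_filter, Finset.mem_filter, Finset.mem_product,
        Set.mem_ofPred_eq]
      exact ⟨⟨⟨hQs w hwQ, hQs _ hz⟩, hN w hwQ hex⟩, (Finset.mem_filter.1 hwQ).2,
        (Finset.mem_filter.1 hz).2⟩
    · intro w _ w' _ he
      exact (Prod.ext_iff.1 he).1
  -- Only the vector of largest slope has no successor; this is the `+ 1`.
  · refine Finset.card_le_one.2 fun w hw z hz => ?_
    obtain ⟨hwQ, hw'⟩ := Finset.mem_filter.1 hw
    obtain ⟨hzQ, hz'⟩ := Finset.mem_filter.1 hz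
    have h1 : ¬ 0 < wedge (toVector w) (toVector z) := fun h => hw' ⟨z, hzQ, h⟩
    have h2 : ¬ 0 < wedge (toVector z) (toVector w) := fun h => hz' ⟨w, hwQ, h⟩
    rw [wedge_swap] at h2
    rcases (isPrimitive_toVector (hQs w hwQ)).eq_or_eq_neg (isPrimitive_toVector (hQs z hzQ))
      (by omega) with h | h
    · exact (toVector_injective h).symm
    · have h3 := congrFun h 0
      have := hpos w (hQs w hwQ)
      have := hpos z (hQs z hzQ)
      simp at h3
      omega

/-- For sparse sets of rays, lattice bases among the chosen vectors are rarer than the chosen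
vectors themselves, so that singularities occur. -/
theorem setBernoulli_real_not_hasSingularity_two_le (p : I) {h : ℕ}
    (hpos : 4 ≤ ((sector h).card : ℝ) * p) :
    (setBernoulli (Set.univ : Set (raysUpTo h)) p).real
        {S | ¬ (completionUpTo h S).HasSingularityOfIndexAtLeast 2} ≤
      4 / ((sector h).card * p) + 8 * p := by
  classical
  have hN : (0 : ℝ) < (sector h).card := by
    rcases (Nat.cast_nonneg (sector h).card : (0 : ℝ) ≤ _).eq_or_lt with h | h
    · rw [← h] at hpos; norm_num at hpos
    · exact h
  have hp : (0 : ℝ) < p := pos_of_mul_pos_right (by linarith) hN.le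
  have hne : Nonempty (PrimitiveVector h) := by
    rcases (sector h).eq_empty_or_nonempty with h0 | ⟨w, hw⟩
    · rw [h0] at hN; simp at hN
    · exact ⟨(exists_primitiveVector le_rfl hw).choose⟩
  choose! W hW using fun w (hw : w ∈ sector h) => exists_primitiveVector (h := h) le_rfl hw
  have hr := rayOf_injective h
  have hWinj : ∀ w ∈ sector h, ∀ w' ∈ sector h, W w = W w' → w = w' := by
    intro w hw w' hw' he
    exact toVector_injective (by rw [← hW w hw, ← hW w' hw', he])
  let A₁ : ℕ × ℕ → Finset (raysUpTo h) := fun w => {rayOf (W w)}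
  let A₂ : (ℕ × ℕ) × ℕ × ℕ → Finset (raysUpTo h) := fun w => {rayOf (W w.1), rayOf (W w.2)}
  set μ := setBernoulli (Set.univ : Set (raysUpTo h)) p with hμ
  have key₁ : μ.real {S | (patternCount (sector h) A₁ (fun _ => ∅) S : ℝ) ≤
      (sector h).card * p / 2} ≤ 4 / ((sector h).card * p) := by
    have := setBernoulli_real_patternCount_le p (sector h) A₁ (fun _ => ∅) (a := 1) (b := 0) (D := 1)
      (fun w hw => Finset.disjoint_empty_right _) (fun w hw => Finset.card_singleton _)
      (fun w hw => Finset.card_empty)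
      (fun w hw => ⟨{w}, by simp, fun l hl hlw => by
        simp only [A₁, Finset.union_empty, Finset.disjoint_singleton, hr.ne_iff]
        intro he
        exact hlw (by simp [hWinj w hw l hl he])⟩) (by rw [pow_one, pow_zero, mul_one]; linarith)
    simpa using this
  -- Markov's inequality: the mean is at most `2Np²` with `N` the size of the sector, and the
  -- threshold is `Np/4`.
  have key₂ : μ.real {S | ((sector h).card : ℝ) * p / 4 ≤
      (patternCount (basisPairs h) A₂ (fun _ => ∅) S : ℝ)} ≤ 8 * p := by
    have := setBernoulli_real_le_patternCount p (basisPairs h) A₂ (fun _ => ∅) (a := 2) (b := 0)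
      (fun w hw => Finset.disjoint_empty_right _) (fun w hw => by
        simp only [basisPairs, Finset.mem_filter, Finset.mem_product] at hw
        refine Finset.card_pair (hr.ne fun he => ?_)
        have h1 := hw.2
        rw [hWinj _ hw.1.1 _ hw.1.2 he] at h1
        have h2 : wedge (toVector w.2) (toVector w.2) = 0 := by unfold wedge; ring
        omega)
      (fun w hw => Finset.card_empty) (t := (sector h).card * p / 4) (by linarith)
    refine this.trans ?_
    rw [pow_zero, mul_one, div_le_iff₀ (by linarith)]
    have hc : ((basisPairs h).card : ℝ) ≤ 2 * (sector h).card := by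
      exact_mod_cast card_basisPairs_le h
    have := mul_le_mul_of_nonneg_right hc (sq_nonneg (p : ℝ))
    linarith
  refine (measureReal_mono ?_).trans ((measureReal_union_le _ _).trans (add_le_add key₁ key₂))
  intro S hS
  rw [Set.mem_ofPred_eq] at hS
  have hle := card_filter_sector_le hS hW
  have e₁ : patternCount (sector h) A₁ (fun _ => ∅) S =
      ((sector h).filter fun w => rayOf (W w) ∈ S).card := by
    simp [patternCount, patternEvent, A₁]
  have e₂ : patternCount (basisPairs h) A₂ (fun _ => ∅) S =
      ((basisPairs h).filter fun w => rayOf (W w.1) ∈ S ∧ rayOf (W w.2) ∈ S).card := by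
    simp [patternCount, patternEvent, A₂]
  rw [← e₁, ← e₂] at hle
  have hle' : (patternCount (sector h) A₁ (fun _ => ∅) S : ℝ) ≤
      patternCount (basisPairs h) A₂ (fun _ => ∅) S + 1 := by exact_mod_cast hle
  rw [Set.mem_union, Set.mem_ofPred_eq, Set.mem_ofPred_eq]
  -- Outside both events `Np/2 < Np/4 + 1`, contrary to `Np ≥ 4`.
  by_contra hcon
  push Not at hcon
  linarith [hcon.1, hcon.2]

end RandomToric

/-! ### Asymptotics and the theorem. -/

namespace RandomToric

open MeasureTheory ProbabilityTheory unitInterval Filter Topology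

theorem withHighProbability_of_eventually_le {p : ℕ → I} {P : ℕ → Fan → Prop}
    (H : ∀ δ > 0, ∀ᶠ h in atTop, (setBernoulli (Set.univ : Set (raysUpTo h)) (p h)).real
      {S | ¬ P h (completionUpTo h S)} ≤ δ) : WithHighProbability p P := by
  have e : ∀ h, T h (p h) {F | P h F} =
      ENNReal.ofReal (1 - (setBernoulli (Set.univ : Set (raysUpTo h)) (p h)).real
        {S | ¬ P h (completionUpTo h S)}) := by
    intro h
    rw [T, Measure.map_apply (measurable_of_countable _) MeasurableSpace.measurableSet_top]
    have hc : {S | ¬ P h (completionUpTo h S)} = (completionUpTo h ⁻¹' {F | P h F})ᶜ := rfl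
    rw [hc, probReal_compl_eq_one_sub .of_discrete, sub_sub_cancel, ofReal_measureReal]
  unfold WithHighProbability
  simp_rw [e]
  rw [← ENNReal.ofReal_one]
  apply ENNReal.tendsto_ofReal
  suffices h : Tendsto (fun h => (setBernoulli (Set.univ : Set (raysUpTo h)) (p h)).real
      {S | ¬ P h (completionUpTo h S)}) atTop (𝓝 0) by
    simpa using h.const_sub 1
  rw [Metric.tendsto_nhds]
  intro δ hδ
  filter_upwards [H (δ / 2) (half_pos hδ)] with h hh
  rw [Real.dist_eq, sub_zero, abs_of_nonneg measureReal_nonneg]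
  linarith

theorem withHighProbability_of_le {p : ℕ → I} {P : ℕ → Fan → Prop} {f : ℕ → ℝ}
    (hf : Tendsto f atTop (𝓝 0))
    (H : ∀ᶠ h in atTop, (setBernoulli (Set.univ : Set (raysUpTo h)) (p h)).real
      {S | ¬ P h (completionUpTo h S)} ≤ f h) : WithHighProbability p P := by
  refine withHighProbability_of_eventually_le fun δ hδ => ?_
  filter_upwards [H, hf.eventually_le_const hδ] with h h1 h2 using h1.trans h2

theorem WithHighProbability.mono {p : ℕ → I} {P Q : ℕ → Fan → Prop}
    (hP : WithHighProbability p P) (h : ∀ n F, P n F → Q n F) : WithHighProbability p Q :=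
  tendsto_of_tendsto_of_tendsto_of_le_of_le hP tendsto_const_nhds
    (fun n => measure_mono fun F hF => h n F hF) fun _ => prob_le_one

theorem ncard_raysUpTo_le (h : ℕ) : (raysUpTo h).ncard ≤ (2 * h + 1) ^ 2 := by
  have hsub : raysUpTo h ⊆ (fun u : Fin 2 → ℤ => latticeCone {u}) ''
      ((Finset.Icc (fun _ => -(h : ℤ)) (fun _ => (h : ℤ)) : Finset (Fin 2 → ℤ)) :
        Set (Fin 2 → ℤ)) := by
    rintro _ ⟨u, -, hu, rfl⟩
    exact ⟨u, Finset.mem_coe.2 (Finset.mem_Icc.2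
      ⟨fun i => (abs_le.1 (hu i)).1, fun i => (abs_le.1 (hu i)).2⟩), rfl⟩
  refine (Set.ncard_le_ncard hsub ((Finset.finite_toSet _).image _)).trans
    ((Set.ncard_image_le (Finset.finite_toSet _)).trans ?_)
  rw [Set.ncard_coe_finset, Pi.card_Icc]
  simp only [Int.card_Icc, Finset.prod_const, Finset.card_univ, Fintype.card_fin]
  apply le_of_eq
  congr 1
  omega

/-- Bernoulli's inequality for `p ^ N`, where `N` is the number of elements. -/
theorem setBernoulli_real_ne_univ_le {ι : Type*} [Finite ι] (p : I) :
    (setBernoulli (Set.univ : Set ι) p).real {S | S ≠ Set.univ} ≤ Nat.card ι * (1 - p : ℝ) := by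
  have h1 : {S : Set ι | S ≠ Set.univ} = {Set.univ}ᶜ := rfl
  rw [h1, probReal_compl_eq_one_sub .of_discrete,
    setBernoulli_real_singleton p subset_rfl Set.finite_univ, Set.ncard_univ]
  have := one_add_mul_le_pow (a := (p : ℝ) - 1) (by linarith [p.2.1]) (Nat.card ι)
  simp only [sdiff_self, Set.bot_eq_empty, Set.ncard_empty, pow_zero, mul_one]
  rw [add_sub_cancel] at this
  linarith

theorem setBernoulli_real_ne_empty_le {ι : Type*} [Finite ι] (p : I) :
    (setBernoulli (Set.univ : Set ι) p).real {S | S ≠ ∅} ≤ Nat.card ι * (p : ℝ) := by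
  have h1 : {S : Set ι | S ≠ ∅} = {∅}ᶜ := rfl
  rw [h1, probReal_compl_eq_one_sub .of_discrete,
    setBernoulli_real_singleton p (Set.empty_subset _) Set.finite_univ, Set.sdiff_empty,
    Set.ncard_univ, Set.ncard_empty, pow_zero, one_mul]
  have := one_add_mul_le_pow (a := -(p : ℝ)) (by linarith [p.2.2]) (Nat.card ι)
  rw [← sub_eq_add_neg] at this
  linarith

theorem Prec.tendsto_card_mul {f : ℕ → ℝ} (hf : Prec f fun h => 1 / (h : ℝ) ^ 2)
    (hf0 : ∀ h, 0 ≤ f h) :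
    Tendsto (fun h => (Nat.card (raysUpTo h) : ℝ) * f h) atTop (𝓝 0) := by
  have h1 : Tendsto (fun h : ℕ => 9 * (f h / (1 / (h : ℝ) ^ 2))) atTop (𝓝 0) := by
    simpa using hf.2.const_mul 9
  refine squeeze_zero' (.of_forall fun h => mul_nonneg (Nat.cast_nonneg _) (hf0 h)) ?_ h1
  filter_upwards [eventually_ge_atTop 1] with h hh
  have hh' : (1 : ℝ) ≤ h := by exact_mod_cast hh
  have h2 : (Nat.card (raysUpTo h) : ℝ) ≤ 9 * (h : ℝ) ^ 2 := by
    have h3 : (Nat.card (raysUpTo h) : ℝ) ≤ (2 * h + 1) ^ 2 := by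
      rw [Nat.card_coe_set_eq]
      exact_mod_cast ncard_raysUpTo_le h
    nlinarith
  calc (Nat.card (raysUpTo h) : ℝ) * f h ≤ 9 * (h : ℝ) ^ 2 * f h :=
        mul_le_mul_of_nonneg_right h2 (hf0 h)
    _ = 9 * (f h / (1 / (h : ℝ) ^ 2)) := by rw [div_div_eq_mul_div, div_one]; ring

theorem withHighProbability_eq_fullFan {p : ℕ → I}
    (hp : Prec (fun h => 1 - (p h : ℝ)) fun h => 1 / (h : ℝ) ^ 2) :
    WithHighProbability p fun h F => F = fullFan h := by
  refine withHighProbability_of_le (hp.tendsto_card_mul fun h => sub_nonneg.2 (p h).2.2)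
    (.of_forall fun h => (measureReal_mono ?_).trans (setBernoulli_real_ne_univ_le (p h)))
  rintro S hS rfl
  exact hS rfl

theorem withHighProbability_cones_eq_singleton {p : ℕ → I}
    (hp : Prec (fun h => (p h : ℝ)) fun h => 1 / (h : ℝ) ^ 2) :
    WithHighProbability p fun _ F => F.cones = {⊥} := by
  refine withHighProbability_of_le (hp.tendsto_card_mul fun h => (p h).2.1)
    (.of_forall fun h => (measureReal_mono ?_).trans (setBernoulli_real_ne_empty_le (p h)))
  rintro S hS rfl
  exact hS (completionUpTo_empty_cones h)

/-- The assumption `h ≥ 16 k` lets the quadratic term absorb both the linear error of the count and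
the rounding of `h / k`. -/
theorem le_card_sector_div {k h : ℕ} (hk : 0 < k) (hh : 16 * k ≤ h) :
    (h : ℝ) ^ 2 / (64 * (k : ℝ) ^ 2) ≤ (sector (h / k)).card := by
  have hk' : (0 : ℝ) < k := by exact_mod_cast hk
  have hh' : 16 * (k : ℝ) ≤ h := by exact_mod_cast hh
  set x := (h : ℝ) / k with hx
  have h1 : x < ((h / k : ℕ) : ℝ) + 1 := by
    rw [hx, div_lt_iff₀ hk']
    have := Nat.lt_div_mul_add hk (a := h)
    have h2 : h < (h / k + 1) * k := by linarith
    exact_mod_cast h2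
  have hx16 : 16 ≤ x := by rw [hx, le_div_iff₀ hk']; exact hh'
  have h2 := le_card_sector (h / k)
  set n := ((h / k : ℕ) : ℝ) with hn
  have e : (h : ℝ) ^ 2 / (64 * (k : ℝ) ^ 2) = x ^ 2 / 64 := by
    rw [hx, div_pow]; field_simp
  rw [e]
  nlinarith

theorem Prec.eventually_pos {f g : ℕ → ℝ} (h : Prec f g) (hg : ∀ n, 0 ≤ g n) :
    ∀ᶠ n in atTop, 0 < g n := by
  filter_upwards [h.1] with n hn using lt_of_le_of_ne (hg n) (Ne.symm hn)

theorem setBernoulli_real_not_hasSingularity_le_div {p : I} {k h : ℕ} (hk : 2 ≤ k)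
    (hh : 16 * k ≤ h)
    (hp : 0 < (p : ℝ)) (hq : 0 < 1 - (p : ℝ)) :
    (setBernoulli (Set.univ : Set (raysUpTo h)) p).real
        {S | ¬ (completionUpTo h S).HasSingularityOfIndexAtLeast k} ≤
      768 * (k : ℝ) ^ 2 * (1 / (h : ℝ) ^ 2 / ((p : ℝ) ^ 2 * (1 - p : ℝ))) := by
  have hk' : (0 : ℝ) < k := by exact_mod_cast (show 0 < k by omega)
  have hh' : (0 : ℝ) < h := by exact_mod_cast (show 0 < h by omega)
  have hc := le_card_sector_div (show 0 < k by omega) hh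
  have hc0 : 0 < (h : ℝ) ^ 2 / (64 * (k : ℝ) ^ 2) := by positivity
  have hw : 0 < (p : ℝ) ^ 2 * (1 - p : ℝ) ^ 1 := by positivity
  refine (setBernoulli_real_not_hasSingularity_le p hk (Nat.mul_div_le h k)
    (mul_pos (hc0.trans_le hc) hw)).trans ?_
  calc (12 : ℝ) / ((sector (h / k)).card * ((p : ℝ) ^ 2 * (1 - p : ℝ) ^ 1))
      ≤ 12 / ((h : ℝ) ^ 2 / (64 * (k : ℝ) ^ 2) * ((p : ℝ) ^ 2 * (1 - p : ℝ) ^ 1)) := by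
        gcongr
    _ = 768 * (k : ℝ) ^ 2 * (1 / (h : ℝ) ^ 2 / ((p : ℝ) ^ 2 * (1 - p : ℝ))) := by
        rw [pow_one]
        field_simp
        norm_num

theorem withHighProbability_hasSingularity {p : ℕ → I} {k : ℕ} (hk : 2 ≤ k)
    (hp : Prec (fun h => 1 / (h : ℝ)) fun h => (p h : ℝ))
    (hq : Prec (fun h => 1 / (h : ℝ) ^ 2) fun h => 1 - (p h : ℝ)) :
    WithHighProbability p fun _ F => F.HasSingularityOfIndexAtLeast k := by
  have hlim : Tendsto (fun h : ℕ => 768 * (k : ℝ) ^ 2 *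
      (4 * (1 / (h : ℝ) ^ 2 / (1 - (p h : ℝ))) + 2 * (1 / (h : ℝ) / (p h : ℝ)) ^ 2))
      atTop (𝓝 0) := by
    simpa using ((hq.2.const_mul 4).add ((hp.2.pow 2).const_mul 2)).const_mul (768 * (k : ℝ) ^ 2)
  refine withHighProbability_of_le hlim ?_
  filter_upwards [hp.eventually_pos fun h => (p h).2.1,
    hq.eventually_pos fun h => sub_nonneg.2 (p h).2.2, eventually_ge_atTop (16 * k)]
    with h hp0 hq0 hh
  refine (setBernoulli_real_not_hasSingularity_le_div hk hh hp0 hq0).trans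
    (mul_le_mul_of_nonneg_left ?_ (by positivity))
  have hh0 : (0 : ℝ) < h := by exact_mod_cast (show 0 < h by omega)
  -- One of `p`, `1 - p` is at least `1/2`, so only one of the two growth conditions is needed for
  -- each `h`; `p` need not converge.
  rcases le_total (1 / 2) (p h : ℝ) with hp2 | hp2
  · have h1 : 1 / (h : ℝ) ^ 2 / ((p h : ℝ) ^ 2 * (1 - p h : ℝ)) ≤
        1 / (h : ℝ) ^ 2 / ((1 / 2) ^ 2 * (1 - p h : ℝ)) := by gcongr
    have h2 : 1 / (h : ℝ) ^ 2 / ((1 / 2) ^ 2 * (1 - p h : ℝ)) =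
        4 * (1 / (h : ℝ) ^ 2 / (1 - (p h : ℝ))) := by field_simp; norm_num
    have h3 : 0 ≤ 2 * (1 / (h : ℝ) / (p h : ℝ)) ^ 2 := by positivity
    linarith
  · have h1 : 1 / (h : ℝ) ^ 2 / ((p h : ℝ) ^ 2 * (1 - p h : ℝ)) ≤
        1 / (h : ℝ) ^ 2 / ((p h : ℝ) ^ 2 * (1 / 2)) := by gcongr; linarith
    have h2 : 1 / (h : ℝ) ^ 2 / ((p h : ℝ) ^ 2 * (1 / 2)) = 2 * (1 / (h : ℝ) / (p h : ℝ)) ^ 2 := by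
      field_simp
    have h3 : 0 ≤ 4 * (1 / (h : ℝ) ^ 2 / (1 - (p h : ℝ))) := by positivity
    linarith

theorem withHighProbability_hasSingularity_two {p : ℕ → I}
    (hp : Prec (fun h => 1 / (h : ℝ) ^ 2) fun h => (p h : ℝ))
    (hq : Prec (fun h => 1 / (h : ℝ) ^ 2) fun h => 1 - (p h : ℝ)) :
    WithHighProbability p fun _ F => F.HasSingularityOfIndexAtLeast 2 := by
  refine withHighProbability_of_eventually_le fun δ hδ => ?_
  -- With this cut the term `8 p` of the sparse bound is at most `δ / 2`. Above the cut, `p` is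
  -- bounded below and the deletion bound needs only the condition on `1 - p`.
  set ε := δ / 16 with hε
  have hε0 : 0 < ε := by positivity
  have hlim₁ : Tendsto (fun h : ℕ => 768 * 2 ^ 2 / ε ^ 2 * (1 / (h : ℝ) ^ 2 / (1 - (p h : ℝ))))
      atTop (𝓝 0) := by
    simpa using hq.2.const_mul (768 * 2 ^ 2 / ε ^ 2)
  have hlim₂ : Tendsto (fun h : ℕ => 256 * (1 / (h : ℝ) ^ 2 / (p h : ℝ))) atTop (𝓝 0) := by
    simpa using hp.2.const_mul 256
  filter_upwards [hp.eventually_pos fun h => (p h).2.1,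
    hq.eventually_pos fun h => sub_nonneg.2 (p h).2.2, eventually_ge_atTop (16 * 2),
    hlim₁.eventually_le_const hδ, hlim₂.eventually_le_const (half_pos hδ),
    hlim₂.eventually_le_const one_pos] with h hp0 hq0 hh h1 h2 h3
  have hh0 : (0 : ℝ) < h := by exact_mod_cast (show 0 < h by omega)
  rcases le_total ε (p h : ℝ) with hpε | hpε
  · refine (setBernoulli_real_not_hasSingularity_le_div le_rfl hh hp0 hq0).trans (le_trans ?_ h1)
    have h4 : 1 / (h : ℝ) ^ 2 / ((p h : ℝ) ^ 2 * (1 - p h : ℝ)) ≤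
        1 / (h : ℝ) ^ 2 / (ε ^ 2 * (1 - p h : ℝ)) := by gcongr
    calc _ ≤ 768 * ((2 : ℕ) : ℝ) ^ 2 * (1 / (h : ℝ) ^ 2 / (ε ^ 2 * (1 - p h : ℝ))) := by gcongr
      _ = 768 * 2 ^ 2 / ε ^ 2 * (1 / (h : ℝ) ^ 2 / (1 - (p h : ℝ))) := by
        push_cast
        field_simp
  · have hc := le_card_sector_div one_pos (show 16 * 1 ≤ h by omega)
    rw [Nat.div_one, Nat.cast_one, one_pow, mul_one] at hc
    have hm : (h : ℝ) ^ 2 / 64 * p h ≤ (sector h).card * p h :=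
      mul_le_mul_of_nonneg_right hc hp0.le
    have hm0 : 0 < (h : ℝ) ^ 2 / 64 * p h := by positivity
    have e : 4 / ((h : ℝ) ^ 2 / 64 * p h) = 256 * (1 / (h : ℝ) ^ 2 / (p h : ℝ)) := by
      field_simp; norm_num
    have h4 : 4 ≤ (sector h).card * (p h : ℝ) := by
      rw [← e, div_le_one hm0] at h3
      exact h3.trans hm
    refine (setBernoulli_real_not_hasSingularity_two_le (p h) h4).trans ?_
    have h5 : 4 / ((sector h).card * (p h : ℝ)) ≤ 4 / ((h : ℝ) ^ 2 / 64 * p h) := by gcongr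
    rw [e] at h5
    linarith

end RandomToric

theorem theorem1p1 (q : ℕ → unitInterval) :
    (RandomToric.Prec (fun h => (q h : ℝ)) (fun h => 1 / (h : ℝ) ^ 2) →
      RandomToric.WithHighProbability (fun h => unitInterval.symm (q h))
        (fun h F => F = RandomToric.fullFan h) ∧
      RandomToric.WithHighProbability (fun h => unitInterval.symm (q h))
        (fun _ F => F.IsSmooth)) ∧
    (RandomToric.Prec (fun h => 1 - (q h : ℝ)) (fun h => 1 / (h : ℝ) ^ 2) →
      RandomToric.WithHighProbability (fun h => unitInterval.symm (q h))
        (fun _ F => F.cones = {⊥}) ∧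
      RandomToric.WithHighProbability (fun h => unitInterval.symm (q h))
        (fun _ F => F.IsSmooth)) ∧
    (RandomToric.Prec (fun h => 1 / (h : ℝ) ^ 2) (fun h => (q h : ℝ)) →
      RandomToric.Prec (fun h => 1 / (h : ℝ) ^ 2) (fun h => 1 - (q h : ℝ)) →
      RandomToric.WithHighProbability (fun h => unitInterval.symm (q h))
        (fun _ F => ¬ F.IsSmooth)) ∧
    (∀ k : ℕ, 1 < k →
      RandomToric.Prec (fun h => 1 / (h : ℝ)) (fun h => 1 - (q h : ℝ)) →
      RandomToric.Prec (fun h => 1 / (h : ℝ) ^ 2) (fun h => (q h : ℝ)) →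
      RandomToric.WithHighProbability (fun h => unitInterval.symm (q h))
        (fun _ F => F.HasSingularityOfIndexAtLeast k)) := by
  have e : (fun h => 1 - (unitInterval.symm (q h) : ℝ)) = fun h => (q h : ℝ) := by
    funext h
    rw [unitInterval.coe_symm_eq, sub_sub_cancel]
  refine ⟨fun hq => ?_, fun hp => ?_, fun hq hp => ?_, fun k hk hp hq => ?_⟩
  · have h := RandomToric.withHighProbability_eq_fullFan
      (p := fun h => unitInterval.symm (q h)) (by rwa [e])
    exact ⟨h, h.mono fun n F hF => hF ▸ RandomToric.isSmooth_fullFan n⟩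
  · have h := RandomToric.withHighProbability_cones_eq_singleton
      (p := fun h => unitInterval.symm (q h)) hp
    exact ⟨h, h.mono fun n F hF => RandomToric.isSmooth_of_cones_eq_singleton hF⟩
  · exact (RandomToric.withHighProbability_hasSingularity_two
      (p := fun h => unitInterval.symm (q h)) hp (by rwa [e])).mono
      fun n F hF => hF.not_isSmooth
  · exact RandomToric.withHighProbability_hasSingularity hk hp (by rwa [e])
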